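/- All graphs are finite, simple and undirected. A subgraph $H$ is \emph{biconnected} if $H$ is connected and deleting any one vertex of $H$ leaves a (possibly empty) connected graph; a \emph{biconnected component} of $G$ is a maximal biconnected subgraph of $G$. A (not necessarily connected) graph is a \emph{block graph} if every biconnected component of it is a clique. Two independent sets $I,J$ of $G$ are \emph{adjacent} if the induced subgraph $G[I\mathbin{\triangle}J]$ is connected. \textsc{SymISR} is the following decision problem: given a graph $G$, two independent sets $I_s,I_t$ of $G$ and a non-negative integer $k$, is there a sequence $I_s=I_0,I_1,\dots,I_\ell=I_t$ of independent sets of $G$ with $\ell\le k$ such that $I_{i-1}$ and $I_i$ are adjacent for every $i\in\{1,\dots,\ell\}$? \textbf{Theorem.} \textsc{SymISR} can be solved in $O(n^5)$ time on block graphs, where $n$ is the number of vertices. That is, there are a single program for a deterministic word RAM (unit-cost copying, addition, subtraction, multiplication, comparison and indirect memory access on words of $O(\log(n+k+2))$ bits) and a function $\tau$ with $\tau(n)=O(n^5)$ such that, for every block graph $G$ on $n$ vertices (given by its adjacency matrix), all independent sets $I_s,I_t$ of $G$ (given by their characteristic vectors) and every integer $k\ge 0$ (given in one word), the program halts after at most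 $\tau(n)$ steps and correctly reports whether $(G,I_s,I_t,k)$ is a yes-instance. -/

import Mathlib

namespace SymISR

/-! ## Graphs -/

section Graphs

variable {V : Type*}

/-- A subgraph is biconnected if it is connected and stays connected (possibly empty) when any
one of its vertices is deleted. -/
def IsBiconnected {G : SimpleGraph V} (H : G.Subgraph) : Prop :=
  H.Connected ∧ ∀ v ∈ H.verts, (H.deleteVerts {v}).Preconnected

/-- A biconnected component is a maximal biconnected subgraph. -/
def IsBiconnectedComponent {G : SimpleGraph V} (H : G.Subgraph) : Prop :=
  Maximal IsBiconnected H

/-- A graph is a block graph if every biconnected component is a clique. It need not be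
connected. -/
def IsBlockGraph (G : SimpleGraph V) : Prop :=
  ∀ H : G.Subgraph, IsBiconnectedComponent H → G.IsClique H.verts

/-- Two vertex sets are adjacent if their symmetric difference induces a connected subgraph. -/
def FlipAdj (G : SimpleGraph V) (I J : Set V) : Prop :=
  (G.induce (symmDiff I J)).Connected

/-- `I 0, …, I l` is a reconfiguration sequence of length `l` from `S` to `T`: all members are
independent sets, and consecutive ones are adjacent. -/
def IsReconfSeq (G : SimpleGraph V) (S T : Set V) (l : ℕ) (I : ℕ → Set V) : Prop :=
  I 0 = S ∧ I l = T ∧ (∀ i ≤ l, G.IsIndepSet (I i)) ∧ ∀ i < l, FlipAdj G (I i) (I (i + 1))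

/-- The instance `(G, S, T, k)` is a yes-instance: there is a reconfiguration sequence from `S`
to `T` of length at most `k`. -/
def YesInstance (G : SimpleGraph V) (S T : Set V) (k : ℕ) : Prop :=
  ∃ l ≤ k, ∃ I : ℕ → Set V, IsReconfSeq G S T l I

end Graphs

/-! ## A word random access machine, programmed by structured programs -/

/-- A machine state: the registers and the addressable memory, all holding natural numbers. -/
structure State where
  reg : ℕ → ℕ
  mem : ℕ → ℕ

/-- The elementary instructions. Registers are named by numbers fixed in the program text; only
`load` and `store` address memory, indirectly through a register. -/
inductive Instr
  /-- `reg d := c` -/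
  | const (d c : ℕ)
  /-- `reg d := reg a` -/
  | move (d a : ℕ)
  /-- `reg d := reg a + reg b` -/
  | add (d a b : ℕ)
  /-- `reg d := reg a - reg b`, truncated at `0` -/
  | sub (d a b : ℕ)
  /-- `reg d := reg a * reg b` -/
  | mul (d a b : ℕ)
  /-- `reg d := mem (reg a)` -/
  | load (d a : ℕ)
  /-- `mem (reg a) := reg b` -/
  | store (a b : ℕ)

/-- The number that an instruction writes. -/
def Instr.value (s : State) : Instr → ℕ
  | .const _ c => c
  | .move _ a => s.reg a
  | .add _ a b => s.reg a + s.reg b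
  | .sub _ a b => s.reg a - s.reg b
  | .mul _ a b => s.reg a * s.reg b
  | .load _ a => s.mem (s.reg a)
  | .store _ b => s.reg b

/-- The state after writing that number to the target of the instruction. -/
def Instr.apply (s : State) (i : Instr) : State :=
  match i with
  | .const d _ | .move d _ | .add d _ _ | .sub d _ _ | .mul d _ _ | .load d _ =>
    { s with reg := Function.update s.reg d (i.value s) }
  | .store a _ => { s with mem := Function.update s.mem (s.reg a) (i.value s) }

/-- Programs: finite texts built from instructions by sequencing, branching and looping on the
comparison of two registers. -/
inductive Program
  | instr (i : Instr)
  | seq (P Q : Program)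
  /-- `if reg a < reg b then P else Q` -/
  | ite (a b : ℕ) (P Q : Program)
  /-- `while reg a < reg b do P` -/
  | loop (a b : ℕ) (P : Program)

/-- `Exec W P s t s'`: on a machine whose words hold the numbers below `W`, the program `P`,
started in state `s`, halts in state `s'` after exactly `t` steps. Every elementary instruction
and every comparison is one step. The machine is deterministic; a program that tries to write a
number `≥ W` gets stuck, i.e. has no execution. -/
inductive Exec (W : ℕ) : Program → State → ℕ → State → Prop
  | instr {i : Instr} {s : State} : i.value s < W → Exec W (.instr i) s 1 (i.apply s)
  | seq {P Q : Program} {s s' s'' : State} {t t' : ℕ} :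
      Exec W P s t s' → Exec W Q s' t' s'' → Exec W (.seq P Q) s (t + t') s''
  | ite_true {a b : ℕ} {P Q : Program} {s s' : State} {t : ℕ} :
      s.reg a < s.reg b → Exec W P s t s' → Exec W (.ite a b P Q) s (t + 1) s'
  | ite_false {a b : ℕ} {P Q : Program} {s s' : State} {t : ℕ} :
      ¬ s.reg a < s.reg b → Exec W Q s t s' → Exec W (.ite a b P Q) s (t + 1) s'
  | loop_true {a b : ℕ} {P : Program} {s s' s'' : State} {t t' : ℕ} :
      s.reg a < s.reg b → Exec W P s t s' → Exec W (.loop a b P) s' t' s'' →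
      Exec W (.loop a b P) s (t + t' + 1) s''
  | loop_false {a b : ℕ} {P : Program} {s : State} :
      ¬ s.reg a < s.reg b → Exec W (.loop a b P) s 1 s

/-! ## Deciding the problem -/

open Classical in
/-- The initial state for the instance `(G, S, T, k)` on `n` vertices: register `0` holds `n`,
register `1` holds `k`; the memory holds the adjacency matrix of `G` row by row, followed by the
characteristic vectors of `S` and of `T`. Everything else is `0`. -/
noncomputable def input {n : ℕ} (G : SimpleGraph (Fin n)) (S T : Set (Fin n)) (k : ℕ) :
    State where
  reg r := if r = 0 then n else if r = 1 then k else 0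
  mem x :=
    if (∃ i j : Fin n, G.Adj i j ∧ x = i * n + j) ∨ (∃ i ∈ S, x = n * n + i) ∨
        (∃ i ∈ T, x = n * n + n + i) then 1 else 0

open Classical in
/-- On the graphs of the class `𝒢`, the program `P` decides in at most `τ n` steps (`n` the number
of vertices) whether there is a reconfiguration sequence of length at most `k` between the two
given independent sets. It uses words that hold the numbers below `(n + k + 2) ^ c`, that is,
words of `O(log (n + k + 2))` bits. The answer (`1` for yes, `0` for no) is left in register
`0`. -/
def SolvesInTime (𝒢 : ∀ n : ℕ, SimpleGraph (Fin n) → Prop) (P : Program) (c : ℕ) (τ : ℕ → ℕ) :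
    Prop :=
  ∀ (n : ℕ) (G : SimpleGraph (Fin n)) (S T : Set (Fin n)) (k : ℕ),
    𝒢 n G → G.IsIndepSet S → G.IsIndepSet T →
      ∃ (t : ℕ) (s : State), t ≤ τ n ∧ Exec ((n + k + 2) ^ c) P (input G S T k) t s ∧
        s.reg 0 = if YesInstance G S T k then 1 else 0

end SymISR

/-!
A reconfiguration sequence is a list of *flips*: connected vertex sets such that all the sets that
arise are independent. The algorithm computes the length of a shortest such list by eliminating the
blocks of the graph one after the other, from the leaves of the block tree to the roots.

*Separation.* Suppose that the vertex set splits into `Y` and a block `K ∪ {p}` with `p ∈ Y`, such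
that there are no other edges between `Y` and `K`. A list of flips of the whole graph restricts to a
list on `Y` and to a list on `K ∪ {p}`, both with the same number of flips of `p`, and its length is
the sum of the two lengths minus this number. Conversely, two such lists can be glued along the
flips of `p`. So the block affects the rest only through the function that maps the number `a` of
flips of `p` to the cheapest treatment of the block, and eliminating the block means adding this
function to the costs of `p`. For this reason the lengths are taken together with costs
`c v a` for every vertex `v` that is flipped `a` times (`HasRun`). Initially the costs enforce that
`a` has the parity prescribed by the two given independent sets.

*A single block.* An independent set of a clique has at most one vertex, so that a list of flips
inside a clique is a walk among its vertices and one additional state for the empty set. Every flip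
leaves the current state for another one. A walk of length `N` in which each vertex `w` takes part
in `f w` steps exists if and only if, apart from parities, no `f w` exceeds `N`, the sum of the
`f w` is between `N` and `2 * N`, and the starting point takes part in a step
(`exists_run_of_frequencies`). The cheapest choice of `f` for given `N` and `a` is a knapsack
problem, solved by a table over the vertices of the block and the total `∑ f w` (`exec_tableCmd`).

*The order of the blocks.* In a block graph two neighbours of `v` that are connected by a path
avoiding `v` are adjacent, because `v` and the path lie on a cycle. Hence in an order of the
vertices in which every vertex comes next to an earlier one whenever possible, the earlier
neighbours of a vertex form a clique. A vertex with exactly one earlier neighbour `p` is the second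
vertex, after `p`, of the block of the two. Going through the order backwards, one eliminates the
block at this vertex (`hasRun_remaining_iff`) and skips its later vertices, which have at least two
earlier neighbours. A vertex without earlier neighbours is isolated when its turn comes, and it is
eliminated like a block whose cut vertex is a virtual one that is never flipped.

*Running time.* A shortest list has length at most `2 * n`, since all vertices of one set can be
removed and those of the other one be added one by one. So all numbers of interest are `O(n)`, and
five nested loops, of `O(n)` rounds each, suffice. The algorithm is written in a small language
whose values are cut off at a cap of `4 * n + 4`, which stands for infinity, and a verified
compiler (`Cmd.compiledCorrectly`) turns it into a program of the random access machine with a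
bound for the number of steps that depends only on the cap and the nesting of the loops.
-/

namespace SymISR


/-! ### Search orders of block graphs -/

section BlockGraphs

variable {V : Type*} {G : SimpleGraph V}

/-- The vertices `x` and `y` are joined by a walk of `G` inside the vertex set `A`. -/
def JoinedIn (G : SimpleGraph V) (A : Set V) (x y : V) : Prop :=
  ∃ p : G.Walk x y, ∀ z ∈ p.support, z ∈ A

namespace JoinedIn

variable {A B : Set V} {x y z : V}

lemma refl (hx : x ∈ A) : JoinedIn G A x x := ⟨.nil, by simpa using hx⟩

lemma symm (h : JoinedIn G A x y) : JoinedIn G A y x := by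
  obtain ⟨p, hp⟩ := h
  exact ⟨p.reverse, by simpa using hp⟩

lemma trans (h : JoinedIn G A x y) (h' : JoinedIn G A y z) : JoinedIn G A x z := by
  obtain ⟨p, hp⟩ := h
  obtain ⟨q, hq⟩ := h'
  refine ⟨p.append q, fun w hw => ?_⟩
  rcases (SimpleGraph.Walk.mem_support_append_iff _ _).1 hw with h | h
  exacts [hp _ h, hq _ h]

lemma of_adj (hx : x ∈ A) (hy : y ∈ A) (h : G.Adj x y) : JoinedIn G A x y :=
  ⟨h.toWalk, by simp [hx, hy]⟩

lemma mono (hAB : A ⊆ B) (h : JoinedIn G A x y) : JoinedIn G B x y := by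
  obtain ⟨p, hp⟩ := h
  exact ⟨p, fun z hz => hAB (hp z hz)⟩

/-- Induction along the edges of a walk inside `A`. -/
lemma induct {P : V → Prop} (h : JoinedIn G A x y) (hx : P x)
    (hs : ∀ u v, u ∈ A → v ∈ A → G.Adj u v → P u → P v) : P y := by
  obtain ⟨p, hp⟩ := h
  induction p with
  | nil => exact hx
  | cons hadj q ih =>
    simp only [SimpleGraph.Walk.support_cons, List.mem_cons, forall_eq_or_imp] at hp
    exact ih (hs _ _ hp.1 (hp.2 _ q.start_mem_support) hadj hx) hp.2

end JoinedIn

lemma preconnected_induce_iff_joinedIn {A : Set V} :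
    (G.induce A).Preconnected ↔ ∀ x ∈ A, ∀ y ∈ A, JoinedIn G A x y := by
  constructor
  · intro h x hx y hy
    have key : ∀ {a b : A} (p : (G.induce A).Walk a b), JoinedIn G A a b := by
      intro a b p
      induction p with
      | nil => exact .refl (Subtype.prop _)
      | cons hadj _ ih => exact (JoinedIn.of_adj (Subtype.prop _) (Subtype.prop _) hadj).trans ih
    exact key (h ⟨x, hx⟩ ⟨y, hy⟩).some
  · rintro h ⟨x, hx⟩ ⟨y, hy⟩
    obtain ⟨p, hp⟩ := h x hx y hy
    exact ⟨p.induce A hp⟩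

lemma connected_induce_iff_joinedIn {A : Set V} :
    (G.induce A).Connected ↔ A.Nonempty ∧ ∀ x ∈ A, ∀ y ∈ A, JoinedIn G A x y := by
  rw [SimpleGraph.connected_iff, preconnected_induce_iff_joinedIn, Set.nonempty_coe_sort,
    and_comm]

/-- The key property of block graphs: a walk between two neighbours of `v` that avoids `v` closes
to a cycle, which lies in one block, so the two neighbours are equal or adjacent. -/
lemma IsBlockGraph.adj_of_joinedIn_compl [Finite V] (hG : IsBlockGraph G) {v x y : V}
    (hx : G.Adj v x) (hy : G.Adj v y) (hxy : x ≠ y) (h : JoinedIn G {v}ᶜ x y) : G.Adj x y := by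
  classical
  obtain ⟨p₀, hp₀⟩ := h
  have hp : p₀.bypass.IsPath := p₀.bypass_isPath
  have hv : v ∉ p₀.bypass.support := fun h => hp₀ v (p₀.support_bypass_subset_support h) rfl
  generalize p₀.bypass = p at hp hv
  -- `H` is the subgraph induced by the cycle through `v` and `p`.
  set A : Set V := {z | z = v ∨ z ∈ p.support} with hA
  set H : G.Subgraph := (⊤ : G.Subgraph).induce A with hH
  have hfirst : ∀ (B : Set V) z (hz : z ∈ p.support),
      (∀ w ∈ (p.takeUntil z hz).support, w ∈ B) → JoinedIn G B z x :=
    fun B z hz hB => JoinedIn.symm ⟨_, hB⟩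
  have hlast : ∀ (B : Set V) z (hz : z ∈ p.support),
      (∀ w ∈ (p.dropUntil z hz).support, w ∈ B) → JoinedIn G B z y :=
    fun B z hz hB => ⟨_, hB⟩
  have hconn : H.Connected := by
    rw [hH, ← SimpleGraph.connected_induce_iff, connected_induce_iff_joinedIn]
    refine ⟨⟨v, .inl rfl⟩, ?_⟩
    have key : ∀ z ∈ A, JoinedIn G A z v := by
      rintro z (rfl | hz)
      · exact .refl (.inl rfl)
      · exact (hfirst A z hz fun w hw => .inr (p.support_takeUntil_subset_support _ hw)).trans
          (.of_adj (.inr p.start_mem_support) (.inl rfl) hx.symm)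
    exact fun a ha b hb => (key a ha).trans (key b hb).symm
  have hdel : ∀ u ∈ H.verts, (H.deleteVerts {u}).Preconnected := by
    intro u _
    have heq : H.deleteVerts {u} = (⊤ : G.Subgraph).induce (A \ {u}) := by
      ext a b
      · simp [hH]
      · simp only [hH, SimpleGraph.Subgraph.induce_adj, SimpleGraph.Subgraph.induce_verts,
          Set.mem_sdiff]
        tauto
    rw [heq, ← SimpleGraph.preconnected_induce_iff, preconnected_induce_iff_joinedIn]
    by_cases huv : u = v
    · subst huv
      have key : ∀ z ∈ A \ {u}, JoinedIn G (A \ {u}) z x := by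
        rintro z ⟨rfl | hz, hzu⟩
        · exact absurd rfl hzu
        · refine hfirst _ z hz fun w hw => ?_
          have := p.support_takeUntil_subset_support _ hw
          exact ⟨.inr this, fun h => hv (h ▸ this)⟩
      exact fun a ha b hb => (key a ha).trans (key b hb).symm
    · have hvA : v ∈ A \ {u} := ⟨.inl rfl, fun h => huv h.symm⟩
      have key : ∀ z ∈ A \ {u}, JoinedIn G (A \ {u}) z v := by
        rintro z ⟨rfl | hz, hzu⟩
        · exact .refl hvA
        · -- `u` cannot lie both before and after `z` on the path.
          by_cases h1 : u ∈ (p.takeUntil z hz).support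
          · have h2 : u ∉ (p.dropUntil z hz).support := by
              intro h2
              have hnd := hp.support_nodup
              rw [← p.take_spec hz, SimpleGraph.Walk.support_append, List.nodup_append] at hnd
              rw [← SimpleGraph.Walk.cons_tail_support, List.mem_cons] at h2
              rcases h2 with h2 | h2
              · exact hzu h2.symm
              · exact hnd.2.2 _ h1 _ h2 rfl
            have hsub : ∀ w ∈ (p.dropUntil z hz).support, w ∈ A \ {u} := fun w hw =>
              ⟨.inr (p.support_dropUntil_subset_support _ hw), fun h => h2 (h ▸ hw)⟩
            exact (hlast _ z hz hsub).trans
              (.of_adj (hsub _ (SimpleGraph.Walk.end_mem_support _)) hvA hy.symm)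
          · have hsub : ∀ w ∈ (p.takeUntil z hz).support, w ∈ A \ {u} := fun w hw =>
              ⟨.inr (p.support_takeUntil_subset_support _ hw), fun h => h1 (h ▸ hw)⟩
            exact (hfirst _ z hz hsub).trans
              (.of_adj (hsub _ (SimpleGraph.Walk.start_mem_support _)) hvA hx.symm)
      exact fun a ha b hb => (key a ha).trans (key b hb).symm
  obtain ⟨H', hle, hmax⟩ := Finite.exists_le_maximal (p := IsBiconnected) (⟨hconn, hdel⟩ :
    IsBiconnected H)
  exact hG H' hmax (hle.1 (show x ∈ A from .inr p.start_mem_support))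
    (hle.1 (show y ∈ A from .inr p.end_mem_support)) hxy

/-- A search order of `G`: the vertices are listed by `pos` in such a way that every vertex has an
earlier neighbour unless the earlier vertices form a union of components. -/
structure IsSearchOrder (G : SimpleGraph V) (pos : V → ℕ) : Prop where
  inj : Function.Injective pos
  search : ∀ w, (∃ u, pos u < pos w ∧ G.Adj u w) ∨
    ∀ u v, pos u < pos w → G.Adj u v → pos v < pos w

/-- Initial segments of a search order induce connected subgraphs of each component. -/
lemma IsSearchOrder.joinedIn_of_reachable {pos : V → ℕ} (ho : IsSearchOrder G pos) (j : ℕ) :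
    ∀ x y, pos x < j → pos y < j → G.Reachable x y → JoinedIn G {z | pos z < j} x y := by
  induction j with
  | zero => intro x y hx; omega
  | succ j ih =>
    have hmono : {z | pos z < j} ⊆ {z | pos z < j + 1} := fun z hz => Nat.lt_succ_of_lt hz
    have hlast : ∀ x w, pos x < j → pos w = j → G.Reachable x w →
        JoinedIn G {z | pos z < j + 1} x w := by
      intro x w hx hw hr
      have hx1 : x ∈ {z | pos z < j + 1} := hmono hx
      have hw1 : w ∈ {z | pos z < j + 1} := by simp [hw]
      rcases ho.search w with ⟨u, hu, hadj⟩ | hcl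
      · rw [hw] at hu
        exact ((ih x u hx hu (hr.trans hadj.symm.reachable)).mono hmono).trans
          (.of_adj (hmono hu) hw1 hadj)
      · obtain ⟨p⟩ := hr
        have : pos w < pos w :=
          JoinedIn.induct (G := G) (A := Set.univ) (P := fun z => pos z < pos w)
            ⟨p, fun _ _ => trivial⟩ (by omega) (fun u v _ _ h hu => hcl u v hu h)
        omega
    intro x y hx hy hr
    rcases Nat.lt_succ_iff_lt_or_eq.1 hx with hx' | hx' <;>
      rcases Nat.lt_succ_iff_lt_or_eq.1 hy with hy' | hy'
    · exact (ih x y hx' hy' hr).mono hmono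
    · exact hlast x y hx' hy' hr
    · exact (hlast y x hy' hx' hr.symm).symm
    · obtain rfl : x = y := ho.inj (hx'.trans hy'.symm)
      exact .refl hx

/-- In a search order of a block graph, the earlier neighbours of a vertex form a clique. -/
lemma IsSearchOrder.adj_of_earlier [Finite V] (hG : IsBlockGraph G) {pos : V → ℕ}
    (ho : IsSearchOrder G pos) {w x y : V} (hx : pos x < pos w) (hy : pos y < pos w)
    (hwx : G.Adj w x) (hwy : G.Adj w y) (hxy : x ≠ y) : G.Adj x y := by
  refine hG.adj_of_joinedIn_compl hwx hwy hxy
    ((ho.joinedIn_of_reachable (pos w) x y hx hy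
      (hwx.symm.reachable.trans hwy.reachable)).mono fun z hz => ?_)
  rintro rfl
  exact lt_irrefl (pos z) hz

/-- Block graphs contain no diamond. -/
lemma IsBlockGraph.adj_of_common_adj [Finite V] (hG : IsBlockGraph G) {u v x y : V}
    (huv : G.Adj u v) (hux : G.Adj u x) (hvx : G.Adj v x) (huy : G.Adj u y) (hvy : G.Adj v y)
    (hxy : x ≠ y) : G.Adj x y :=
  hG.adj_of_joinedIn_compl hux huy hxy
    ((JoinedIn.of_adj (A := {u}ᶜ) hux.ne' huv.ne' hvx.symm).trans (.of_adj huv.ne' huy.ne' hvy))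

/-- The vertices that are left when all vertices from position `j` on have been eliminated
together with the blocks that they complete: the vertices before position `j` and those of their
common neighbours that still share a block with two of them. -/
def remaining (G : SimpleGraph V) (pos : V → ℕ) (j : ℕ) : Set V :=
  {w | pos w < j ∨ ∃ x y, x ≠ y ∧ pos x < j ∧ pos y < j ∧ G.Adj w x ∧ G.Adj w y}

variable [Finite V] {pos : V → ℕ}

lemma remaining_succ_of_isolated (hG : IsBlockGraph G) (ho : IsSearchOrder G pos) {l : V}
    (hl : ∀ u, pos u < pos l → ¬ G.Adj l u) :
    remaining G pos (pos l + 1) = insert l (remaining G pos (pos l)) ∧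
      l ∉ remaining G pos (pos l) ∧ ∀ u ∈ remaining G pos (pos l), ¬ G.Adj u l := by
  have hlater : ∀ u x, pos l < pos u → pos x < pos l → G.Adj u x → ¬ G.Adj u l := by
    intro u x hu hx hux hul
    exact hl x hx (ho.adj_of_earlier hG (by omega) hu hux hul (by rintro rfl; omega)).symm
  refine ⟨?_, ?_, ?_⟩
  · ext w
    simp only [remaining, Set.mem_insert_iff, Set.mem_ofPred_eq]
    constructor
    · rintro (hw | ⟨x, y, hxy, hx, hy, hwx, hwy⟩)
      · rcases Nat.lt_succ_iff_lt_or_eq.1 hw with h | h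
        · exact .inr (.inl h)
        · exact .inl (ho.inj h)
      · by_cases hwl : w = l
        · exact .inl hwl
        have hwl' : pos w ≠ pos l := fun h => hwl (ho.inj h)
        by_cases hw : pos w < pos l
        · exact .inr (.inl hw)
        have hw' : pos l < pos w := by omega
        rcases Nat.lt_succ_iff_lt_or_eq.1 hx with hx | hx
        · rcases Nat.lt_succ_iff_lt_or_eq.1 hy with hy | hy
          · exact .inr (.inr ⟨x, y, hxy, hx, hy, hwx, hwy⟩)
          · obtain rfl := ho.inj hy
            exact absurd hwy (hlater w x hw' hx hwx)
        · obtain rfl := ho.inj hx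
          rcases Nat.lt_succ_iff_lt_or_eq.1 hy with hy | hy
          · exact absurd hwx (hlater w y hw' hy hwy)
          · exact absurd (ho.inj hy).symm hxy
    · rintro (rfl | hw | ⟨x, y, hxy, hx, hy, h⟩)
      · exact .inl (Nat.lt_succ_self _)
      · exact .inl (by omega)
      · exact .inr ⟨x, y, hxy, by omega, by omega, h⟩
  · rintro (h | ⟨x, y, hxy, hx, hy, hlx, hly⟩)
    · exact lt_irrefl _ h
    · exact hl x hx hlx
  · rintro u (h | ⟨x, y, hxy, hx, hy, hux, huy⟩) hul
    · exact hl u h hul.symm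
    · by_cases hu : pos u < pos l
      · exact hl u hu hul.symm
      · have : pos u ≠ pos l := fun h => hul.ne (ho.inj h)
        exact hlater u x (by omega) hx hux hul

/-- If `p` is the only earlier neighbour of `l`, then eliminating position `pos l` removes the
vertices of one block except for `p`, which is the only vertex that this block shares with the
rest. -/
lemma remaining_succ_of_unique (hG : IsBlockGraph G) (ho : IsSearchOrder G pos) {l p : V}
    (hp : pos p < pos l) (hlp : G.Adj l p) (hl : ∀ u, pos u < pos l → G.Adj l u → u = p) :
    remaining G pos (pos l + 1) =
        remaining G pos (pos l) ∪ {w | w = l ∨ G.Adj w l ∧ G.Adj w p} ∧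
      (∀ w, (w = l ∨ G.Adj w l ∧ G.Adj w p) → w ∉ remaining G pos (pos l) ∧ G.Adj w p) ∧
      p ∈ remaining G pos (pos l) ∧
      (∀ u ∈ remaining G pos (pos l), ∀ w, (w = l ∨ G.Adj w l ∧ G.Adj w p) → G.Adj u w → u = p) ∧
      (∀ w w', (w = l ∨ G.Adj w l ∧ G.Adj w p) → (w' = l ∨ G.Adj w' l ∧ G.Adj w' p) → w ≠ w' →
        G.Adj w w') := by
  have hearly : ∀ {w x y}, pos x < pos w → pos y < pos w → G.Adj w x → G.Adj w y → x ≠ y →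
      G.Adj x y := fun h1 h2 h3 h4 h5 => ho.adj_of_earlier hG h1 h2 h3 h4 h5
  have hpl : p ≠ l := hlp.ne'
  have hlate : ∀ w, G.Adj w l → G.Adj w p → pos l < pos w := by
    intro w hwl hwp
    by_contra h
    have : pos w ≠ pos l := fun h => hwl.ne (ho.inj h)
    exact hwp.ne (hl w (by omega) hwl.symm)
  have hnot : ∀ w, (w = l ∨ G.Adj w l ∧ G.Adj w p) → w ∉ remaining G pos (pos l) := by
    rintro w hw (h | ⟨x, y, hxy, hx, hy, hwx, hwy⟩)
    · rcases hw with rfl | ⟨hwl, hwp⟩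
      · exact lt_irrefl _ h
      · exact absurd h (hlate w hwl hwp).not_gt
    · rcases hw with rfl | ⟨hwl, hwp⟩
      · exact hxy ((hl x hx hwx).trans (hl y hy hwy).symm)
      · have hw := hlate w hwl hwp
        exact hxy ((hl x hx (hearly (by omega) hw hwx hwl (by rintro rfl; omega)).symm).trans
          (hl y hy (hearly (by omega) hw hwy hwl (by rintro rfl; omega)).symm).symm)
  refine ⟨?_, fun w hw => ⟨hnot w hw, ?_⟩, .inl hp, ?_, ?_⟩
  · ext w
    simp only [Set.mem_union, Set.mem_ofPred_eq]
    constructor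
    · intro hw
      by_cases hwl : w = l
      · exact .inr (.inl hwl)
      have hwl' : pos w ≠ pos l := fun h => hwl (ho.inj h)
      by_cases hw' : pos w < pos l
      · exact .inl (.inl hw')
      have key : ∀ x, pos x < pos l + 1 → x ≠ l → G.Adj w x → G.Adj w l → x = p := by
        intro x hx hxl hwx hwl
        have : pos x ≠ pos l := fun h => hxl (ho.inj h)
        exact hl x (by omega) (hearly (by omega) (by omega) hwx hwl hxl).symm
      rcases hw with hw | ⟨x, y, hxy, hx, hy, hwx, hwy⟩
      · omega
      · by_cases hxl : x = l
        · subst hxl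
          obtain rfl := key y hy hxy.symm hwy hwx
          exact .inr (.inr ⟨hwx, hwy⟩)
        · by_cases hyl : y = l
          · subst hyl
            obtain rfl := key x hx hxl hwx hwy
            exact .inr (.inr ⟨hwy, hwx⟩)
          · have h1 : pos x ≠ pos l := fun h => hxl (ho.inj h)
            have h2 : pos y ≠ pos l := fun h => hyl (ho.inj h)
            exact .inl (.inr ⟨x, y, hxy, by omega, by omega, hwx, hwy⟩)
    · rintro ((hw | ⟨x, y, hxy, hx, hy, h⟩) | rfl | ⟨hwl, hwp⟩)
      · exact .inl (by omega)
      · exact .inr ⟨x, y, hxy, by omega, by omega, h⟩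
      · exact .inl (by omega)
      · exact .inr ⟨p, l, hpl, by omega, by omega, hwp, hwl⟩
  · rcases hw with rfl | hw
    exacts [hlp, hw.2]
  · intro u hu w hw huw
    by_contra hup
    have hul' : u ≠ l := fun h => hnot l (.inl rfl) (h ▸ hu)
    have hupos : pos u ≠ pos l := fun h => hul' (ho.inj h)
    -- A remaining vertex adjacent to `l` is `p`.
    have hul : ¬ G.Adj u l := by
      intro hul
      rcases hu with hu | ⟨x, y, hxy, hx, hy, hux, huy⟩
      · exact hup (hl u hu hul.symm)
      · by_cases hu : pos u < pos l
        · exact hup (hl u hu hul.symm)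
        · exact hxy ((hl x hx
            (hearly (by omega) (by omega) hux hul (by rintro rfl; omega)).symm).trans
            (hl y hy (hearly (by omega) (by omega) huy hul (by rintro rfl; omega)).symm).symm)
    rcases hw with rfl | ⟨hwl, hwp⟩
    · exact hul huw
    have hw := hlate w hwl hwp
    have hwu : pos w ≠ pos u := fun h => huw.ne (ho.inj h.symm)
    by_cases hlt : pos u < pos w
    · exact hul (hearly hlt hw huw.symm hwl hul')
    · rcases hu with hu | ⟨x, y, hxy, hx, hy, hux, huy⟩
      · omega
      · exact hnot w (.inr ⟨hwl, hwp⟩) (.inr ⟨x, y, hxy, hx, hy,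
          hearly (by omega) (by omega) huw hux (by rintro rfl; omega),
          hearly (by omega) (by omega) huw huy (by rintro rfl; omega)⟩)
  · rintro w w' (rfl | ⟨hwl, hwp⟩) (rfl | ⟨hwl', hwp'⟩) hne
    · exact absurd rfl hne
    · exact hwl'.symm
    · exact hwl
    · exact hG.adj_of_common_adj hlp hwl.symm hwp.symm hwl'.symm hwp'.symm hne

lemma remaining_succ_of_two (hG : IsBlockGraph G) (ho : IsSearchOrder G pos) {l q q' : V}
    (hqq : q ≠ q') (hq : pos q < pos l) (hq' : pos q' < pos l) (hlq : G.Adj l q)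
    (hlq' : G.Adj l q') : remaining G pos (pos l + 1) = remaining G pos (pos l) := by
  have key : ∀ w x, pos l < pos w → pos x < pos l → G.Adj w x → G.Adj w l →
      w ∈ remaining G pos (pos l) := by
    intro w x hw hx hwx hwl
    have hxl : G.Adj x l := ho.adj_of_earlier hG (by omega) hw hwx hwl (by rintro rfl; omega)
    obtain ⟨r, hr, hrl, hrx⟩ : ∃ r, pos r < pos l ∧ G.Adj l r ∧ r ≠ x := by
      by_cases h : q = x
      · exact ⟨q', hq', hlq', fun h' => hqq (h.trans h'.symm)⟩
      · exact ⟨q, hq, hlq, h⟩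
    have hrx' : G.Adj r x := ho.adj_of_earlier hG hr hx hrl hxl.symm hrx
    refine .inr ⟨x, r, hrx.symm, hx, hr, hwx, ?_⟩
    exact hG.adj_of_common_adj hxl.symm hwl.symm hwx.symm hrl hrx'.symm (by rintro rfl; omega)
  ext w
  constructor
  · rintro (hw | ⟨x, y, hxy, hx, hy, hwx, hwy⟩)
    · rcases Nat.lt_succ_iff_lt_or_eq.1 hw with h | h
      · exact .inl h
      · obtain rfl := ho.inj h
        exact .inr ⟨q, q', hqq, hq, hq', hlq, hlq'⟩
    · by_cases hw : pos w < pos l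
      · exact .inl hw
      by_cases hwl : w = l
      · subst hwl
        exact .inr ⟨q, q', hqq, hq, hq', hlq, hlq'⟩
      have hwl' : pos w ≠ pos l := fun h => hwl (ho.inj h)
      rcases Nat.lt_succ_iff_lt_or_eq.1 hx with hx | hx
      · rcases Nat.lt_succ_iff_lt_or_eq.1 hy with hy | hy
        · exact .inr ⟨x, y, hxy, hx, hy, hwx, hwy⟩
        · obtain rfl := ho.inj hy
          exact key w x (by omega) hx hwx hwy
      · obtain rfl := ho.inj hx
        rcases Nat.lt_succ_iff_lt_or_eq.1 hy with hy | hy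
        · exact key w y (by omega) hy hwy hwx
        · exact absurd (ho.inj hy).symm hxy
  · rintro (hw | ⟨x, y, hxy, hx, hy, h⟩)
    · exact .inl (by omega)
    · exact .inr ⟨x, y, hxy, by omega, by omega, h⟩

end BlockGraphs


/-! ### Lists of flips -/

section Runs

variable {V : Type*} {G : SimpleGraph V}

/-- `L` is a list of flips that leads from `S` to `T`: every flip is a connected vertex set inside
`X`, and every set that arises after a flip is independent. -/
def IsRun (G : SimpleGraph V) (X : Set V) : Set V → List (Set V) → Set V → Prop
  | S, [], T => S = T
  | S, F :: L, T => F ⊆ X ∧ (G.induce F).Connected ∧ G.IsIndepSet (symmDiff S F) ∧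
      IsRun G X (symmDiff S F) L T

open Classical in
/-- The number of flips in a list that meet `Z`. For `Z = {v}` this is the number of times that
`v` is flipped. -/
noncomputable def hits (Z : Set V) : List (Set V) → ℕ
  | [] => 0
  | F :: L => (if (F ∩ Z).Nonempty then 1 else 0) + hits Z L

open Classical in
/-- The indicator of a set, with natural number values. -/
noncomputable def ind (S : Set V) (v : V) : ℕ := if v ∈ S then 1 else 0

lemma ind_of_mem {S : Set V} {v : V} (h : v ∈ S) : ind S v = 1 := if_pos h

lemma ind_of_notMem {S : Set V} {v : V} (h : v ∉ S) : ind S v = 0 := if_neg h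

lemma ind_le_one (S : Set V) (v : V) : ind S v ≤ 1 := by
  unfold ind; split_ifs <;> simp

lemma ind_congr {S T : Set V} {v : V} (h : v ∈ S ↔ v ∈ T) : ind S v = ind T v := by
  by_cases hT : v ∈ T
  · rw [ind_of_mem hT, ind_of_mem (h.2 hT)]
  · rw [ind_of_notMem hT, ind_of_notMem fun hS => hT (h.1 hS)]

lemma hits_le_length (Z : Set V) (L : List (Set V)) : hits Z L ≤ L.length := by
  induction L with
  | nil => simp [hits]
  | cons F L ih => simp only [hits, List.length_cons]; split_ifs <;> omega

lemma hits_cons_singleton (v : V) (F : Set V) (L : List (Set V)) :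
    hits {v} (F :: L) = ind F v + hits {v} L := by
  by_cases h : v ∈ F <;> simp [hits, ind, h]

lemma IsRun.append {X S T U : Set V} {L M : List (Set V)} (h : IsRun G X S L T)
    (h' : IsRun G X T M U) : IsRun G X S (L ++ M) U := by
  induction L generalizing S with
  | nil => obtain rfl : S = T := h; exact h'
  | cons F L ih => exact ⟨h.1, h.2.1, h.2.2.1, ih h.2.2.2⟩

/-- A vertex is flipped an odd number of times if and only if its membership changes. -/
lemma IsRun.even {X S T : Set V} {L : List (Set V)} (h : IsRun G X S L T) (v : V) :
    Even (hits {v} L + ind S v + ind T v) := by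
  induction L generalizing S with
  | nil =>
    obtain rfl : S = T := h
    simp [hits]
  | cons F L ih =>
    have := ih h.2.2.2
    rw [hits_cons_singleton]
    have hS : ind (symmDiff S F) v + 2 * (ind S v * ind F v) = ind S v + ind F v := by
      by_cases h1 : v ∈ S <;> by_cases h2 : v ∈ F <;> simp [ind, Set.mem_symmDiff, h1, h2]
    grind

lemma isIndepSet_symmDiff_inter {S F Y : Set V} (h : G.IsIndepSet (symmDiff S F)) :
    G.IsIndepSet (symmDiff (S ∩ Y) (F ∩ Y)) := by
  refine h.mono fun x hx => ?_
  simp only [Set.mem_symmDiff, Set.mem_inter_iff] at hx ⊢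
  tauto

lemma symmDiff_inter_inter (S F Y : Set V) :
    symmDiff (S ∩ Y) (F ∩ Y) = symmDiff S F ∩ Y := by
  ext x
  simp only [Set.mem_symmDiff, Set.mem_inter_iff]
  tauto

lemma IsRun.exists_restrict {X Y S T : Set V} {L : List (Set V)} (h : IsRun G X S L T)
    (hY : ∀ F ⊆ X, (G.induce F).Connected → (F ∩ Y).Nonempty → (G.induce (F ∩ Y)).Connected) :
    ∃ L', IsRun G Y (S ∩ Y) L' (T ∩ Y) ∧ L'.length = hits Y L ∧
      ∀ v ∈ Y, hits {v} L' = hits {v} L := by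
  induction L generalizing S with
  | nil =>
    obtain rfl : S = T := h
    exact ⟨[], rfl, rfl, fun _ _ => rfl⟩
  | cons F L ih =>
    obtain ⟨hF, hconn, hind, hrun⟩ := h
    obtain ⟨L', hrun', hlen, hhits⟩ := ih hrun
    by_cases hne : (F ∩ Y).Nonempty
    · refine ⟨(F ∩ Y) :: L', ⟨Set.inter_subset_right, hY F hF hconn hne,
        isIndepSet_symmDiff_inter hind, ?_⟩, ?_, fun v hv => ?_⟩
      · rwa [symmDiff_inter_inter]
      · simp [hits, hne, hlen, add_comm]
      · rw [hits_cons_singleton, hits_cons_singleton, hhits v hv]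
        congr 1
        exact ind_congr ⟨fun h => h.1, fun h => ⟨h, hv⟩⟩
    · refine ⟨L', ?_, by simp [hits, hne, hlen], fun v hv => ?_⟩
      · have : symmDiff S F ∩ Y = S ∩ Y := by
          rw [← symmDiff_inter_inter, Set.not_nonempty_iff_eq_empty.1 hne]
          simp
        rwa [this] at hrun'
      · rw [hits_cons_singleton, hhits v hv, ind_of_notMem, zero_add]
        exact fun h => hne ⟨v, h, hv⟩

/-- `Y` and `B` overlap in at most one vertex, and this vertex separates them. -/
structure IsSeparation (G : SimpleGraph V) (Y B : Set V) : Prop where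
  subsingleton : (Y ∩ B).Subsingleton
  adj : ∀ u ∈ Y, ∀ v ∈ B, G.Adj u v → u ∈ B ∨ v ∈ Y

namespace IsSeparation

variable {Y B F : Set V}

lemma symm (h : IsSeparation G Y B) : IsSeparation G B Y :=
  ⟨by rw [Set.inter_comm]; exact h.subsingleton, fun u hu v hv huv =>
    (h.adj v hv u hu huv.symm).symm⟩

lemma connected_inter (h : IsSeparation G Y B) (hF : F ⊆ Y ∪ B) (hconn : (G.induce F).Connected)
    (hne : (F ∩ Y).Nonempty) : (G.induce (F ∩ Y)).Connected := by
  rw [connected_induce_iff_joinedIn] at hconn ⊢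
  refine ⟨hne, fun x hx y hy => ?_⟩
  have key : (y ∈ Y ∧ JoinedIn G (F ∩ Y) x y) ∨
      (y ∈ B ∧ ∃ z ∈ Y ∩ B, z ∈ F ∧ JoinedIn G (F ∩ Y) x z) := by
    refine JoinedIn.induct (G := G) (A := F) (P := fun u => (u ∈ Y ∧ JoinedIn G (F ∩ Y) x u) ∨
      (u ∈ B ∧ ∃ z ∈ Y ∩ B, z ∈ F ∧ JoinedIn G (F ∩ Y) x z)) (hconn.2 x hx.1 y hy.1)
      (.inl ⟨hx.2, .refl hx⟩) ?_
    rintro u v hu hv huv (⟨huY, hj⟩ | ⟨huB, z, hz, hzF, hj⟩)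
    · rcases hF hv with hvY | hvB
      · exact .inl ⟨hvY, hj.trans (.of_adj ⟨hu, huY⟩ ⟨hv, hvY⟩ huv)⟩
      · rcases h.adj u huY v hvB huv with huB | hvY
        · exact .inr ⟨hvB, u, ⟨huY, huB⟩, hu, hj⟩
        · exact .inl ⟨hvY, hj.trans (.of_adj ⟨hu, huY⟩ ⟨hv, hvY⟩ huv)⟩
    · rcases hF hv with hvY | hvB
      · rcases h.adj v hvY u huB huv.symm with hvB | huY
        · obtain rfl := h.subsingleton hz ⟨hvY, hvB⟩
          exact .inl ⟨hvY, hj⟩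
        · obtain rfl := h.subsingleton hz ⟨huY, huB⟩
          exact .inl ⟨hvY, hj.trans (.of_adj ⟨hu, huY⟩ ⟨hv, hvY⟩ huv)⟩
      · exact .inr ⟨hvB, z, hz, hzF, hj⟩
  rcases key with ⟨-, hj⟩ | ⟨hyB, z, hz, hzF, hj⟩
  · exact hj
  · obtain rfl := h.subsingleton hz ⟨hy.2, hyB⟩
    exact hj

lemma inter_nonempty (h : IsSeparation G Y B) (hF : F ⊆ Y ∪ B) (hconn : (G.induce F).Connected)
    (hY : (F ∩ Y).Nonempty) (hB : (F ∩ B).Nonempty) : (F ∩ (Y ∩ B)).Nonempty := by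
  obtain ⟨x, hxF, hxY⟩ := hY
  obtain ⟨y, hyF, hyB⟩ := hB
  rw [connected_induce_iff_joinedIn] at hconn
  by_contra hne
  have hne : ∀ z ∈ F, z ∈ Y → z ∉ B := fun z h1 h2 h3 => hne ⟨z, h1, h2, h3⟩
  refine hne y hyF (JoinedIn.induct (G := G) (A := F) (P := fun u => u ∈ Y) (hconn.2 x hxF y hyF)
    hxY fun u v hu hv huv huY => ?_) hyB
  rcases hF hv with hvY | hvB
  · exact hvY
  · rcases h.adj u huY v hvB huv with huB | hvY
    · exact absurd huB (hne u hu huY)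
    · exact hvY

lemma hits_add_hits (h : IsSeparation G Y B) {S T : Set V} {L : List (Set V)}
    (hL : IsRun G (Y ∪ B) S L T) : hits Y L + hits B L = L.length + hits (Y ∩ B) L := by
  induction L generalizing S with
  | nil => simp [hits]
  | cons F L ih =>
    obtain ⟨hF, hconn, -, hrun⟩ := hL
    have hsum := ih hrun
    have hne : (F ∩ Y).Nonempty ∨ (F ∩ B).Nonempty := by
      obtain ⟨x, hx⟩ := (connected_induce_iff_joinedIn.1 hconn).1
      exact (hF hx).imp (fun h => ⟨x, hx, h⟩) fun h => ⟨x, hx, h⟩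
    have hmono1 : (F ∩ (Y ∩ B)).Nonempty → (F ∩ Y).Nonempty :=
      fun ⟨x, hx⟩ => ⟨x, hx.1, hx.2.1⟩
    have hmono2 : (F ∩ (Y ∩ B)).Nonempty → (F ∩ B).Nonempty :=
      fun ⟨x, hx⟩ => ⟨x, hx.1, hx.2.2⟩
    have hboth := h.inter_nonempty hF hconn
    simp only [hits, List.length_cons]
    by_cases h1 : (F ∩ Y).Nonempty <;> by_cases h2 : (F ∩ B).Nonempty <;>
      by_cases h3 : (F ∩ (Y ∩ B)).Nonempty <;> simp only [h1, h2, h3, if_true, if_false] <;>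
      first | omega | tauto

/-- A run on `Y ∪ B` restricts to runs on `Y` and on `B`, in which the flips of the common vertex
are counted twice. -/
lemma exists_restrict (h : IsSeparation G Y B) {S T : Set V} {L : List (Set V)}
    (hL : IsRun G (Y ∪ B) S L T) :
    ∃ L₁ L₂, IsRun G Y (S ∩ Y) L₁ (T ∩ Y) ∧ IsRun G B (S ∩ B) L₂ (T ∩ B) ∧
      L₁.length + L₂.length = L.length + hits (Y ∩ B) L ∧
      (∀ v ∈ Y, hits {v} L₁ = hits {v} L) ∧ ∀ v ∈ B, hits {v} L₂ = hits {v} L := by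
  obtain ⟨L₁, hrun₁, hlen₁, hhits₁⟩ := hL.exists_restrict fun F => h.connected_inter
  obtain ⟨L₂, hrun₂, hlen₂, hhits₂⟩ := hL.exists_restrict (Y := B) fun F hF =>
    h.symm.connected_inter (hF.trans (Set.union_comm Y B).subset)
  exact ⟨L₁, L₂, hrun₁, hrun₂, by rw [hlen₁, hlen₂, h.hits_add_hits hL], hhits₁, hhits₂⟩

/-- Two runs that flip the common vertex equally often can be merged into one run in which the
flips of the common vertex coincide. -/
lemma exists_glue (h : IsSeparation G Y B) {T₁ T₂ : Set V} :
    ∀ (m : ℕ) (L₁ L₂ : List (Set V)) (S₁ S₂ : Set V), L₁.length + L₂.length ≤ m →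
      S₁ ⊆ Y → S₂ ⊆ B → S₁ ∩ B = S₂ ∩ Y → G.IsIndepSet S₁ → G.IsIndepSet S₂ →
      IsRun G Y S₁ L₁ T₁ → IsRun G B S₂ L₂ T₂ → hits (Y ∩ B) L₁ = hits (Y ∩ B) L₂ →
      ∃ L, IsRun G (Y ∪ B) (S₁ ∪ S₂) L (T₁ ∪ T₂) ∧
        L.length + hits (Y ∩ B) L₁ = L₁.length + L₂.length ∧
        (∀ v ∈ Y, hits {v} L = hits {v} L₁) ∧ ∀ v ∈ B, hits {v} L = hits {v} L₂ := by
  have hindep : ∀ {S₁ S₂ : Set V}, S₁ ⊆ Y → S₂ ⊆ B → S₁ ∩ B = S₂ ∩ Y → G.IsIndepSet S₁ →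
      G.IsIndepSet S₂ → G.IsIndepSet (S₁ ∪ S₂) := by
    intro S₁ S₂ hS₁ hS₂ hagree h₁ h₂
    have hcross : ∀ u ∈ S₁, ∀ v ∈ S₂, ¬ G.Adj u v := by
      intro u hu v hv huv
      rcases h.adj u (hS₁ hu) v (hS₂ hv) huv with huB | hvY
      · exact h₂ (hagree.subset ⟨hu, huB⟩).1 hv huv.ne huv
      · exact h₁ hu (hagree.symm.subset ⟨hv, hvY⟩).1 huv.ne huv
    rintro u (hu | hu) v (hv | hv) huv
    · exact h₁ hu hv huv
    · exact hcross u hu v hv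
    · exact fun hadj => hcross v hv u hu hadj.symm
    · exact h₂ hu hv huv
  intro m
  induction m with
  | zero =>
    intro L₁ L₂ S₁ S₂ hlen _ _ _ _ _ hr₁ hr₂ _
    obtain rfl : L₁ = [] := List.eq_nil_of_length_eq_zero (by omega)
    obtain rfl : L₂ = [] := List.eq_nil_of_length_eq_zero (by omega)
    obtain rfl : S₁ = T₁ := hr₁
    obtain rfl : S₂ = T₂ := hr₂
    exact ⟨[], rfl, rfl, fun _ _ => rfl, fun _ _ => rfl⟩
  | succ m ih =>
    intro L₁ L₂ S₁ S₂ hlen hS₁ hS₂ hagree hi₁ hi₂ hr₁ hr₂ hhits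
    -- A flip of the first run that avoids the common vertex is performed at once.
    by_cases hfirst : ∃ F L, L₁ = F :: L ∧ ¬ (F ∩ (Y ∩ B)).Nonempty
    · obtain ⟨F, L₁, rfl, hF⟩ := hfirst
      obtain ⟨hFY, hconn, hind, hrun⟩ := hr₁
      have hFB : ∀ x ∈ F, x ∉ B := fun x hx hxB => hF ⟨x, hx, hFY hx, hxB⟩
      have hagree' : symmDiff S₁ F ∩ B = S₂ ∩ Y := by
        rw [← hagree]
        ext x
        have := hFB x
        simp only [Set.mem_symmDiff, Set.mem_inter_iff]
        tauto
      have hS₁' : symmDiff S₁ F ⊆ Y := fun x hx => hx.elim (fun h => hS₁ h.1) fun h => hFY h.1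
      have hstate : symmDiff (S₁ ∪ S₂) F = symmDiff S₁ F ∪ S₂ := by
        ext x
        have h1 := hFB x
        have h2 := @hS₂ x
        simp only [Set.mem_symmDiff, Set.mem_union]
        tauto
      simp only [hits, hF, if_false, zero_add] at hhits
      obtain ⟨L, hL, hlen', hh₁, hh₂⟩ := ih L₁ L₂ _ S₂ (by simp at hlen; omega) hS₁' hS₂ hagree'
        hind hi₂ hrun hr₂ hhits
      refine ⟨F :: L, ⟨hFY.trans Set.subset_union_left, hconn, ?_, ?_⟩, ?_, ?_, ?_⟩
      · rw [hstate]; exact hindep hS₁' hS₂ hagree' hind hi₂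
      · rwa [hstate]
      · simp only [hits, hF, if_false, zero_add, List.length_cons]; omega
      · intro v hv
        rw [hits_cons_singleton, hits_cons_singleton, hh₁ v hv]
      · intro v hv
        rw [hits_cons_singleton, hh₂ v hv, ind_of_notMem (fun h => hFB v h hv), zero_add]
    by_cases hsecond : ∃ F L, L₂ = F :: L ∧ ¬ (F ∩ (Y ∩ B)).Nonempty
    · obtain ⟨F, L₂, rfl, hF⟩ := hsecond
      obtain ⟨hFB, hconn, hind, hrun⟩ := hr₂
      have hFY : ∀ x ∈ F, x ∉ Y := fun x hx hxY => hF ⟨x, hx, hxY, hFB hx⟩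
      have hagree' : S₁ ∩ B = symmDiff S₂ F ∩ Y := by
        rw [hagree]
        ext x
        have := hFY x
        simp only [Set.mem_symmDiff, Set.mem_inter_iff]
        tauto
      have hS₂' : symmDiff S₂ F ⊆ B := fun x hx => hx.elim (fun h => hS₂ h.1) fun h => hFB h.1
      have hstate : symmDiff (S₁ ∪ S₂) F = S₁ ∪ symmDiff S₂ F := by
        ext x
        have h1 := hFY x
        have h2 := @hS₁ x
        simp only [Set.mem_symmDiff, Set.mem_union]
        tauto
      simp only [hits, hF, if_false, zero_add] at hhits
      obtain ⟨L, hL, hlen', hh₁, hh₂⟩ := ih L₁ L₂ S₁ _ (by simp at hlen; omega) hS₁ hS₂' hagree'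
        hi₁ hind hr₁ hrun hhits
      refine ⟨F :: L, ⟨hFB.trans Set.subset_union_right, hconn, ?_, ?_⟩, ?_, ?_, ?_⟩
      · rw [hstate]; exact hindep hS₁ hS₂' hagree' hi₁ hind
      · rwa [hstate]
      · simp only [List.length_cons]; omega
      · intro v hv
        rw [hits_cons_singleton, hh₁ v hv, ind_of_notMem (fun h => hFY v h hv), zero_add]
      · intro v hv
        rw [hits_cons_singleton, hits_cons_singleton, hh₂ v hv]
    push Not at hfirst hsecond
    rcases L₁ with _ | ⟨F₁, L₁⟩
    · rcases L₂ with _ | ⟨F₂, L₂⟩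
      · exact ih [] [] S₁ S₂ (by simp) hS₁ hS₂ hagree hi₁ hi₂ hr₁ hr₂ hhits
      · simp only [hits, hsecond F₂ L₂ rfl, if_true] at hhits
        omega
    rcases L₂ with _ | ⟨F₂, L₂⟩
    · simp only [hits, hfirst F₁ L₁ rfl, if_true] at hhits
      omega
    -- Both runs flip the common vertex `p` next.
    obtain ⟨p, hpF₁, hpYB⟩ := hfirst F₁ L₁ rfl
    obtain ⟨p', hpF₂, hpYB'⟩ := hsecond F₂ L₂ rfl
    obtain rfl := h.subsingleton hpYB hpYB'
    obtain ⟨hFY, hconn₁, hind₁, hrun₁⟩ := hr₁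
    obtain ⟨hFB, hconn₂, hind₂, hrun₂⟩ := hr₂
    have hp : ∀ x ∈ Y, x ∈ B → x = p := fun x h1 h2 => h.subsingleton ⟨h1, h2⟩ hpYB
    have hag : ∀ x, x ∈ S₁ ∧ x ∈ B ↔ x ∈ S₂ ∧ x ∈ Y := fun x => Set.ext_iff.1 hagree x
    have hF : ∀ x, x ∈ F₁ ∧ x ∈ B ↔ x ∈ F₂ ∧ x ∈ Y := by
      intro x
      constructor
      · rintro ⟨h1, h2⟩
        obtain rfl := hp x (hFY h1) h2
        exact ⟨hpF₂, hFY h1⟩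
      · rintro ⟨h1, h2⟩
        obtain rfl := hp x h2 (hFB h1)
        exact ⟨hpF₁, hFB h1⟩
    have hagree' : symmDiff S₁ F₁ ∩ B = symmDiff S₂ F₂ ∩ Y := by
      ext x
      have h1 := hag x
      have h2 := hF x
      simp only [Set.mem_symmDiff, Set.mem_inter_iff]
      tauto
    have hS₁' : symmDiff S₁ F₁ ⊆ Y := fun x hx => hx.elim (fun h => hS₁ h.1) fun h => hFY h.1
    have hS₂' : symmDiff S₂ F₂ ⊆ B := fun x hx => hx.elim (fun h => hS₂ h.1) fun h => hFB h.1
    have hstate : symmDiff (S₁ ∪ S₂) (F₁ ∪ F₂) = symmDiff S₁ F₁ ∪ symmDiff S₂ F₂ := by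
      ext x
      have h1 := hag x
      have h2 := hF x
      have h3 := @hS₁ x
      have h4 := @hS₂ x
      have h5 := @hFY x
      have h6 := @hFB x
      simp only [Set.mem_symmDiff, Set.mem_union]
      grind
    simp only [hits, hfirst F₁ L₁ rfl, hsecond F₂ L₂ rfl, if_true] at hhits
    obtain ⟨L, hL, hlen', hh₁, hh₂⟩ := ih L₁ L₂ _ _ (by simp at hlen; omega) hS₁' hS₂' hagree'
      hind₁ hind₂ hrun₁ hrun₂ (by omega)
    refine ⟨(F₁ ∪ F₂) :: L, ⟨Set.union_subset_union hFY hFB,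
      SimpleGraph.induce_union_connected hconn₁.preconnected hconn₂.preconnected ⟨p, hpF₁, hpF₂⟩,
      ?_, ?_⟩, ?_, ?_, ?_⟩
    · rw [hstate]; exact hindep hS₁' hS₂' hagree' hind₁ hind₂
    · rwa [hstate]
    · simp only [hits, hfirst F₁ L₁ rfl, if_true, List.length_cons]; omega
    · intro v hv
      rw [hits_cons_singleton, hits_cons_singleton, hh₁ v hv]
      have := hF v
      congr 1
      refine ind_congr ?_
      rw [Set.mem_union]
      tauto
    · intro v hv
      rw [hits_cons_singleton, hits_cons_singleton, hh₂ v hv]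
      have := hF v
      congr 1
      refine ind_congr ?_
      rw [Set.mem_union]
      tauto

end IsSeparation

/-! ### Runs inside a clique -/

lemma subsingleton_of_isIndepSet_of_isClique {S B : Set V} (hB : G.IsClique B)
    (hS : G.IsIndepSet S) (hSB : S ⊆ B) : S.Subsingleton := by
  intro x hx y hy
  by_contra hxy
  exact hS hx hy hxy (hB (hSB hx) (hSB hy) hxy)

/-- How often the vertices of a clique are flipped in a run inside the clique: a flip changes at
most two vertices, and exactly one if no vertex is occupied before it; an occupied vertex has to be
flipped first. -/
lemma IsRun.hits_clique {B : Finset V} (hB : G.IsClique (B : Set V)) {S T : Set V}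
    {L : List (Set V)} (hS : G.IsIndepSet S) (hSB : S ⊆ B) (h : IsRun G B S L T) :
    L.length ≤ ∑ v ∈ B, hits {v} L ∧ ∑ v ∈ B, hits {v} L ≤ 2 * L.length ∧
      (S = ∅ → L ≠ [] → ∑ v ∈ B, hits {v} L < 2 * L.length) ∧
      (∀ u ∈ S, L ≠ [] → 0 < hits {u} L) := by
  classical
  induction L generalizing S with
  | nil => simp [hits]
  | cons F L ih =>
    obtain ⟨hF, hconn, hind, hrun⟩ := h
    obtain ⟨x, hx⟩ := (connected_induce_iff_joinedIn.1 hconn).1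
    have hSF : symmDiff S F ⊆ B := fun z hz => hz.elim (fun h => hSB h.1) fun h => hF h.1
    obtain ⟨h1, h2, -, -⟩ := ih hind hSF hrun
    have hS1 := subsingleton_of_isIndepSet_of_isClique hB hS hSB
    have hS2 := subsingleton_of_isIndepSet_of_isClique hB hind hSF
    have hsum : ∑ v ∈ B, hits {v} (F :: L) = (B.filter (· ∈ F)).card + ∑ v ∈ B, hits {v} L := by
      simp only [hits_cons_singleton, Finset.sum_add_distrib, ind, Finset.card_filter]
    have hpos : 0 < (B.filter (· ∈ F)).card :=
      Finset.card_pos.2 ⟨x, by simpa [hx] using hF hx⟩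
    have hle : (B.filter (· ∈ F)).card ≤
        (B.filter (· ∈ S)).card + (B.filter (· ∈ symmDiff S F)).card := by
      refine (Finset.card_le_card fun z hz => ?_).trans (Finset.card_union_le _ _)
      simp only [Finset.mem_filter, Finset.mem_union, Set.mem_symmDiff] at hz ⊢
      tauto
    have hc1 : (B.filter (· ∈ S)).card ≤ 1 := Finset.card_le_one.2 fun a ha b hb =>
      hS1 (Finset.mem_filter.1 ha).2 (Finset.mem_filter.1 hb).2
    have hc2 : (B.filter (· ∈ symmDiff S F)).card ≤ 1 := Finset.card_le_one.2 fun a ha b hb =>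
      hS2 (Finset.mem_filter.1 ha).2 (Finset.mem_filter.1 hb).2
    rw [hsum, List.length_cons]
    refine ⟨by omega, by omega, fun h0 _ => ?_, fun u hu _ => ?_⟩
    · have : (B.filter (· ∈ S)).card = 0 := by simp [h0]
      omega
    · rw [hits_cons_singleton]
      by_cases huF : u ∈ F
      · rw [ind_of_mem huF]; omega
      · have hxS : x ∉ S := fun h => huF (hS1 hu h ▸ hx)
        exact absurd (hS2 (Or.inl ⟨hu, huF⟩) (Or.inr ⟨hx, hxS⟩) ▸ hx) huF

/-- The vertex set that consists of the given vertex, if any. The value `none` stands for a clique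
without an occupied vertex. -/
def occupied (x : Option V) : Set V := {v | some v = x}

lemma ind_occupied [DecidableEq V] (x : Option V) (v : V) :
    ind (occupied x) v = if some v = x then 1 else 0 := by
  unfold ind occupied
  simp

/-- A walk with prescribed end points that visits the letters with prescribed frequencies: if no
letter takes part in more than all of the `N` steps, then a walk exists subject to the obvious
parity conditions. It is found greedily, by moving to a letter that has to be used most often. The
letter `none` stands for the moments at which no vertex of the clique is occupied. -/
lemma exists_run_of_frequencies [Fintype V] [DecidableEq V] {B : Set V} (hB : G.IsClique B)
    {e : Option V} : ∀ (N : ℕ) (f : Option V → ℕ) (x : Option V),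
      (∀ v, 0 < f (some v) → v ∈ B) → ∑ z, f z = 2 * N → (∀ z, f z ≤ N) →
      (∀ z, Even (f z + (if z = x then 1 else 0) + (if z = e then 1 else 0))) →
      (N = 0 ∨ 0 < f x) →
      ∃ L, IsRun G B (occupied x) L (occupied e) ∧ L.length = N ∧
        ∀ v, hits {v} L = f (some v) := by
  intro N
  induction N with
  | zero =>
    intro f x _ hsum hle hpar _
    have h0 : ∀ z, f z = 0 := fun z => Nat.le_zero.1 (hle z)
    have hxe : x = e := by
      by_contra hne
      have := hpar x
      simp [h0, hne] at this
    exact ⟨[], by rw [hxe]; rfl, rfl, fun v => by simp [hits, h0]⟩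
  | succ N ih =>
    intro f x hsupp hsum hle hpar hx
    have hfx : 0 < f x := hx.resolve_left (Nat.succ_ne_zero N)
    have hsplit := Finset.add_sum_erase Finset.univ f (Finset.mem_univ x)
    have hfxle := hle x
    have hne : (Finset.univ.erase x).Nonempty := by
      by_contra h
      rw [Finset.not_nonempty_iff_eq_empty] at h
      rw [h, Finset.sum_empty] at hsplit
      omega
    obtain ⟨y, hy, hmax⟩ := Finset.exists_max_image _ f hne
    have hyx : y ≠ x := (Finset.mem_erase.1 hy).1
    have hsplit2 := Finset.add_sum_erase (Finset.univ.erase x) f hy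
    have hfy : 0 < f y := by
      by_contra h
      have : ∑ z ∈ Finset.univ.erase x, f z = 0 := Finset.sum_eq_zero fun z hz => by
        have := hmax z hz
        omega
      omega
    have hN : ∀ z, z ≠ x → z ≠ y → f z ≤ N := by
      intro z hzx hzy
      by_contra h
      have h1 := hle z
      have h2 := hmax z (Finset.mem_erase.2 ⟨hzx, Finset.mem_univ z⟩)
      have h3 := Finset.single_le_sum (f := f) (fun _ _ => Nat.zero_le _)
        (Finset.mem_erase.2 ⟨hzy, Finset.mem_erase.2 ⟨hzx, Finset.mem_univ z⟩⟩)
      omega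
    have hy2 : N = 0 ∨ 2 ≤ f y := by
      by_contra h
      push Not at h
      have hzero : ∀ z ∈ (Finset.univ.erase x).erase y, f z = 0 := by
        intro z hz
        obtain ⟨hzy, hz⟩ := Finset.mem_erase.1 hz
        have h1 := hmax z hz
        have hfy1 : f y = 1 := by omega
        have hye : y = e := by
          by_contra hne
          have := hpar y
          simp [hfy1, hyx, hne] at this
        by_contra h0
        have hfz1 : f z = 1 := by omega
        have := hpar z
        simp [hfz1, (Finset.mem_erase.1 hz).1, hye ▸ hzy] at this
      have := Finset.sum_eq_zero hzero
      omega
    set f' : Option V → ℕ := fun z => f z - (if z = x then 1 else 0) - (if z = y then 1 else 0)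
      with hf'
    have hrel : ∀ z, f' z + (if z = x then 1 else 0) + (if z = y then 1 else 0) = f z := by
      intro z
      simp only [hf']
      by_cases h1 : z = x
      · subst h1
        have : z ≠ y := hyx.symm
        simp [this]
        omega
      · by_cases h2 : z = y
        · subst h2
          simp [h1]
          omega
        · simp [h1, h2]
    have hsum' : ∑ z, f' z = 2 * N := by
      have h1 : ∑ z, (f' z + (if z = x then 1 else 0) + (if z = y then 1 else 0)) = ∑ z, f z :=
        Finset.sum_congr rfl fun z _ => hrel z
      rw [Finset.sum_add_distrib, Finset.sum_add_distrib, Finset.sum_ite_eq', Finset.sum_ite_eq',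
        if_pos (Finset.mem_univ _), if_pos (Finset.mem_univ _)] at h1
      omega
    obtain ⟨L, hrun, hlen, hhits⟩ := ih f' y
      (fun v hv => hsupp v (by have := hrel (some v); omega)) hsum'
      (by
        intro z
        have h1 := hrel z
        have h2 := hle z
        by_cases hzx : z = x
        · simp [hzx, hyx.symm] at h1 ⊢
          omega
        · by_cases hzy : z = y
          · simp [hzy, hyx] at h1 ⊢
            have := hle y
            omega
          · simp [hzx, hzy] at h1
            have := hN z hzx hzy
            omega)
      (by
        intro z
        have h1 := hpar z
        rw [← hrel z] at h1
        have h2 : f' z + (if z = x then 1 else 0) + (if z = y then 1 else 0) +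
            (if z = x then 1 else 0) + (if z = e then 1 else 0) =
            (f' z + (if z = y then 1 else 0) + (if z = e then 1 else 0)) +
            2 * (if z = x then 1 else 0) := by ring
        rw [h2] at h1
        exact (Nat.even_add.1 h1).2 (even_two_mul _))
      (by
        have := hrel y
        simp [hyx] at this
        omega)
    have hmemB : ∀ v : V, some v = x ∨ some v = y → v ∈ B := by
      rintro v (h | h)
      · exact hsupp v (by rw [h]; exact hfx)
      · exact hsupp v (by rw [h]; exact hfy)
    have hF : ∀ v, v ∈ symmDiff (occupied x) (occupied y) ↔ some v = x ∨ some v = y := by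
      intro v
      simp only [Set.mem_symmDiff, occupied, Set.mem_ofPred_eq]
      constructor
      · tauto
      · rintro (h | h)
        · exact .inl ⟨h, fun h' => hyx (h'.symm.trans h)⟩
        · exact .inr ⟨h, fun h' => hyx (h.symm.trans h')⟩
    have hstate : symmDiff (occupied x) (symmDiff (occupied x) (occupied y)) = occupied y :=
      symmDiff_symmDiff_cancel_left _ _
    refine ⟨symmDiff (occupied x) (occupied y) :: L,
      ⟨fun v hv => hmemB v ((hF v).1 hv), ?_, ?_, ?_⟩,
      by simp [hlen], fun v => ?_⟩
    · rw [connected_induce_iff_joinedIn]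
      refine ⟨?_, fun u hu v hv => ?_⟩
      · rcases x with _ | a
        · rcases y with _ | b
          · exact absurd rfl hyx
          · exact ⟨b, (hF b).2 (.inr rfl)⟩
        · exact ⟨a, (hF a).2 (.inl rfl)⟩
      · by_cases huv : u = v
        · exact huv ▸ .refl hu
        · exact .of_adj hu hv (hB (hmemB u ((hF u).1 hu)) (hmemB v ((hF v).1 hv)) huv)
    · rw [hstate]
      intro u hu v hv huv
      exact absurd (Option.some_injective _ (Eq.trans (show some u = y from hu)
        (show some v = y from hv).symm)) huv
    · rwa [hstate]
    · rw [hits_cons_singleton, hhits, ← hrel (some v), add_comm, add_assoc]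
      congr 1
      have := hF v
      unfold ind
      by_cases h1 : some v = x
      · have h2 : some v ≠ y := fun h => hyx (h.symm.trans h1)
        rw [if_pos (this.2 (.inl h1)), if_pos h1, if_neg h2]
      · by_cases h2 : some v = y
        · rw [if_pos (this.2 (.inr h2)), if_neg h1, if_pos h2]
        · rw [if_neg (fun h => (this.1 h).elim h1 h2), if_neg h1, if_neg h2]

end Runs


/-! ### Elimination of a block -/

section Elimination

variable {V : Type*} {G : SimpleGraph V}

lemma occupied_some (v : V) : occupied (some v) = {v} := by
  ext w
  simp [occupied]

lemma occupied_none : occupied (none : Option V) = ∅ := by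
  ext w
  simp [occupied]

lemma hits_empty (L : List (Set V)) : hits ∅ L = 0 := by
  induction L with
  | nil => rfl
  | cons F L ih => simp [hits, ih]

lemma exists_occupied_eq {S : Set V} (h : S.Subsingleton) : ∃ x, occupied x = S := by
  rcases h.eq_empty_or_singleton with rfl | ⟨v, rfl⟩
  exacts [⟨none, occupied_none⟩, ⟨some v, occupied_some v⟩]

open Classical in
/-- The membership indicator of a vertex or of the virtual vertex `none`, which is always
present. -/
noncomputable def weight (Y : Set V) : Option V → ℕ
  | none => 1
  | some v => ind Y v

/-- There is a list of flips inside `X` from `S` to `T` whose length, increased by the costs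
`c v a` for every vertex `v` of `X` that is flipped `a` times, is at most `y`. The cost of the
virtual vertex `none`, which is never flipped, is added as well. -/
def HasRun [Fintype V] (G : SimpleGraph V) (S T X : Set V) (c : Option V → ℕ → ℕ) (y : ℕ) : Prop :=
  ∃ L, IsRun G X (S ∩ X) L (T ∩ X) ∧
    L.length + ∑ z : Option V, weight X z * c z (hits (occupied z) L) ≤ y

/-- The additional cost `z` of the block that consists of `K` and the vertex `p`, if `p` is flipped
`a` times. The block takes part in `N` flips and `f w` is the number of flips of `w`. The
requirements are those under which a run inside the block with these frequencies exists, and `m`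
bounds the length of the runs under consideration. If `p` is `none`, then `K` is not attached to
anything else. -/
def BlockCost (S : Set V) (K : Finset V) (p : Option V) (c : Option V → ℕ → ℕ) (m a z : ℕ) : Prop :=
  ∃ N < m, a ≤ N ∧ (N ≠ 0 → ∀ v ∈ S, p = some v → 0 < a) ∧
    ∃ f : V → ℕ, (∀ w ∈ K, f w ≤ N ∧ (N ≠ 0 → w ∈ S → 0 < f w)) ∧
      N ≤ ∑ w ∈ K, f w + a ∧ ∑ w ∈ K, f w + a ≤ 2 * N ∧
      (N ≠ 0 → (∀ v ∈ S, v ∉ K ∧ p ≠ some v) → ∑ w ∈ K, f w + a < 2 * N) ∧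
      z + a = N + ∑ w ∈ K, c (some w) (f w)

variable [Fintype V] [DecidableEq V] {S T Y : Set V} {K : Finset V} {p : Option V}
  {c c' : Option V → ℕ → ℕ} {m : ℕ}

lemma sum_weight_union (hYK : ∀ w ∈ K, w ∉ Y) (g : Option V → ℕ) :
    ∑ z : Option V, weight (Y ∪ K) z * g z =
      ∑ z : Option V, weight Y z * g z + ∑ w ∈ K, g (some w) := by
  have hind : ∀ v, ind (Y ∪ (K : Set V)) v = ind Y v + if v ∈ K then 1 else 0 := by
    intro v
    by_cases hK : v ∈ K
    · rw [ind_of_mem (.inr hK), ind_of_notMem (hYK v hK), if_pos hK]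
    · rw [if_neg hK, add_zero]
      exact ind_congr ⟨fun h => h.resolve_right hK, fun h => .inl h⟩
  simp only [Fintype.sum_option, weight, hind, add_mul, Finset.sum_add_distrib, ite_mul, one_mul,
    zero_mul, Finset.sum_ite_mem, Finset.univ_inter]
  ring

lemma sum_weight_of_eq (hp : ∀ v, p = some v → v ∈ Y) (hc : ∀ z ≠ p, c' z = c z)
    (h : Option V → ℕ) :
    ∑ z : Option V, weight Y z * c' z (h z) + c p (h p) =
      ∑ z : Option V, weight Y z * c z (h z) + c' p (h p) := by
  have hw : weight Y p = 1 := by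
    rcases p with _ | v
    · rfl
    · exact ind_of_mem (hp v rfl)
  rw [← Finset.add_sum_erase _ _ (Finset.mem_univ p),
    ← Finset.add_sum_erase (a := p) _ (fun z => weight Y z * c z (h z)) (Finset.mem_univ p), hw,
    Finset.sum_congr rfl fun z hz => by rw [hc z (Finset.mem_erase.1 hz).1]]
  ring

/-- The run inside a block that realizes prescribed numbers of flips. -/
lemma exists_run_block (hS : G.IsIndepSet S) (hT : G.IsIndepSet T) {B : Finset V}
    (hB : G.IsClique (B : Set V)) {N : ℕ} {f : V → ℕ} (hle : ∀ v ∈ B, f v ≤ N)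
    (hpar : ∀ v ∈ B, Even (f v + ind S v + ind T v)) (h1 : N ≤ ∑ v ∈ B, f v)
    (h2 : ∑ v ∈ B, f v ≤ 2 * N) (hstart : N ≠ 0 → ∀ v ∈ S, v ∈ B → 0 < f v)
    (hfree : N ≠ 0 → (∀ v ∈ S, v ∉ B) → ∑ v ∈ B, f v < 2 * N) :
    ∃ L, IsRun G B (S ∩ B) L (T ∩ B) ∧ L.length = N ∧ ∀ v ∈ B, hits {v} L = f v := by
  have hsub : ∀ {U : Set V}, G.IsIndepSet U → (U ∩ B).Subsingleton := fun hU =>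
    subsingleton_of_isIndepSet_of_isClique hB (hU.mono Set.inter_subset_left)
      Set.inter_subset_right
  obtain ⟨x, hx⟩ := exists_occupied_eq (hsub hS)
  obtain ⟨e, he⟩ := exists_occupied_eq (hsub hT)
  -- The number of flips of the phantom vertex is chosen to make the sum equal to `2 * N`.
  let F : Option V → ℕ := fun z => z.elim (2 * N - ∑ v ∈ B, f v) fun v => if v ∈ B then f v else 0
  have hsome : ∑ v, F (some v) = ∑ v ∈ B, f v := by
    simp [F, Finset.sum_ite_mem]
  have hsum : ∑ z, F z = 2 * N := by
    rw [Fintype.sum_option, hsome]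
    simp only [F, Option.elim_none]
    omega
  have heven : ∀ v : V, Even (F (some v) + (if some v = x then 1 else 0) +
      (if some v = e then 1 else 0)) := by
    intro v
    rw [← ind_occupied, ← ind_occupied, hx, he]
    by_cases hv : v ∈ B
    · have h3 : ind (S ∩ B) v = ind S v := ind_congr (by simp [hv])
      have h4 : ind (T ∩ B) v = ind T v := ind_congr (by simp [hv])
      simpa [F, hv, h3, h4] using hpar v hv
    · rw [ind_of_notMem (fun h => hv h.2), ind_of_notMem (fun h => hv h.2)]
      simp [F, hv]
  have key := exists_run_of_frequencies (B := B) hB (e := e) N F x ?_ hsum ?_ ?_ ?_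
  · obtain ⟨L, hrun, hlen, hhits⟩ := key
    rw [hx, he] at hrun
    exact ⟨L, hrun, hlen, fun v hv => by rw [hhits]; simp [F, hv]⟩
  · intro v hv
    by_contra h
    have h : v ∉ B := h
    simp [F, h] at hv
  · rintro (_ | v)
    · simp only [F, Option.elim_none]
      omega
    · simp only [F, Option.elim_some]
      split_ifs with hv
      · exact hle v hv
      · exact Nat.zero_le _
  · rintro (_ | v)
    · have htot : ∑ z : Option V, (F z + (if z = x then 1 else 0) + (if z = e then 1 else 0)) =
          2 * N + 2 := by
        rw [Finset.sum_add_distrib, Finset.sum_add_distrib, Finset.sum_ite_eq',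
          Finset.sum_ite_eq', if_pos (Finset.mem_univ _), if_pos (Finset.mem_univ _), hsum]
      rw [Fintype.sum_option] at htot
      have hrest := Finset.even_sum _ fun v (_ : v ∈ Finset.univ) => heven v
      have : Even (2 * N + 2) := ⟨N + 1, by ring⟩
      rw [← htot] at this
      exact (Nat.even_add.1 this).2 hrest
    · exact heven v
  · by_cases hN : N = 0
    · exact .inl hN
    refine .inr ?_
    rcases x with _ | v
    · have := hfree hN fun v hv hvB => by
        have : v ∈ occupied (none : Option V) := hx ▸ ⟨hv, hvB⟩
        rw [occupied_none] at this
        exact this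
      simp only [F, Option.elim_none]
      omega
    · have hv : v ∈ S ∩ B := hx ▸ (rfl : some v = some v)
      have hvB : v ∈ B := hv.2
      simpa [F, hvB] using hstart hN v hv.1 hvB

/-- Eliminating a block. The vertices `K` form a clique together with `p`, and only `p` has
neighbours among the other vertices `Y`. Then `K` can be deleted if the optimal cost of the
block is added to the cost of `p`. -/
theorem hasRun_eliminate (hS : G.IsIndepSet S) (hT : G.IsIndepSet T) (hYK : ∀ w ∈ K, w ∉ Y)
    (hp : ∀ v, p = some v → v ∈ Y) (hK : ∀ w ∈ K, ∀ w' ∈ K, w ≠ w' → G.Adj w w')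
    (hpK : ∀ v, p = some v → ∀ w ∈ K, G.Adj w v)
    (hedge : ∀ u ∈ Y, ∀ w ∈ K, G.Adj u w → p = some u)
    (hpar : ∀ v a, c (some v) a < m → Even (a + ind S v + ind T v))
    (hc : ∀ z ≠ p, c' z = c z)
    (hcp : ∀ a < m, ∀ y < m, c' p a ≤ y ↔ ∃ z, BlockCost S K p c m a z ∧ c p a + z ≤ y)
    {y : ℕ} (hy : y < m) :
    HasRun G S T (Y ∪ K) c y ↔ HasRun G S T Y c' y := by
  set B : Finset V := K ∪ p.toFinset with hBdef
  have hmemB : ∀ v, v ∈ B ↔ v ∈ K ∨ p = some v := by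
    intro v
    simp [hBdef]
  have hunion : Y ∪ (B : Set V) = Y ∪ K := by
    ext v
    have := hp v
    simp only [Set.mem_union, SetLike.mem_coe, hmemB]
    tauto
  have hinter : Y ∩ (B : Set V) = occupied p := by
    ext v
    have h1 := hp v
    have h2 := hYK v
    simp only [Set.mem_inter_iff, SetLike.mem_coe, hmemB, occupied, Set.mem_ofPred_eq,
      eq_comm (a := some v)]
    tauto
  have hBclique : G.IsClique (B : Set V) := by
    intro u hu v hv huv
    rcases (hmemB u).1 hu with hu | hu <;> rcases (hmemB v).1 hv with hv | hv
    · exact hK u hu v hv huv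
    · exact hpK v hv u hu
    · exact (hpK u hu v hv).symm
    · exact absurd (Option.some_injective _ (hu.symm.trans hv)) huv
  have hsep : IsSeparation G Y B := by
    refine ⟨?_, fun u hu v hv huv => ?_⟩
    · rw [hinter]
      intro u hu v hv
      exact Option.some_injective _ (Eq.trans hu (Eq.symm hv))
    · rcases (hmemB v).1 hv with hv | hv
      · exact .inl ((hmemB u).2 (.inr (hedge u hu v hv huv)))
      · exact .inr (hp v hv)
  -- The flips of `p`, if any, are the flips that are common to both sides.
  have hsumB : ∀ (L : List (Set V)) (f : V → ℕ), (∀ v, p = some v → f v = hits (occupied p) L) →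
      ∑ v ∈ B, f v = ∑ w ∈ K, f w + hits (occupied p) L := by
    intro L f hf
    rcases hpc : p with _ | v
    · simp [hBdef, hpc, occupied_none, hits_empty]
    · have hvK : v ∉ K := fun h => hYK v h (hp v hpc)
      rw [hBdef, hpc, Option.toFinset_some, Finset.sum_union (by simpa using hvK),
        Finset.sum_singleton, hf v hpc, hpc]
  have hocc : ∀ v (L : List (Set V)), p = some v → hits {v} L = hits (occupied p) L := by
    rintro v L h
    rw [h, occupied_some]
  have hrestr : ∀ U : Set V, U ∩ (Y ∪ K) ∩ Y = U ∩ Y ∧ U ∩ (Y ∪ K) ∩ B = U ∩ B := by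
    intro U
    constructor <;> ext v
    · simp only [Set.mem_inter_iff, Set.mem_union]; tauto
    · have h1 := hp v
      simp only [Set.mem_inter_iff, Set.mem_union, SetLike.mem_coe, hmemB]; tauto
  constructor
  · rintro ⟨L, hL, hcost⟩
    rw [← hunion] at hL
    obtain ⟨L₁, L₂, hL₁, hL₂, hlen, hh₁, hh₂⟩ := hsep.exists_restrict hL
    rw [hunion, (hrestr S).1, (hrestr T).1] at hL₁
    rw [hunion, (hrestr S).2, (hrestr T).2] at hL₂
    rw [hinter] at hlen
    obtain ⟨ha1, ha2, ha3, ha4⟩ := hL₂.hits_clique hBclique (hS.mono Set.inter_subset_left)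
      Set.inter_subset_right
    have hpa : hits (occupied p) L₁ = hits (occupied p) L := by
      rcases hpc : p with _ | v
      · simp [occupied_none, hits_empty]
      · rw [occupied_some]; exact hh₁ v (hp v hpc)
    have hpa₂ : hits (occupied p) L₂ = hits (occupied p) L := by
      rcases hpc : p with _ | v
      · simp [occupied_none, hits_empty]
      · rw [occupied_some]; exact hh₂ v ((hmemB v).2 (.inr hpc))
    set a := hits (occupied p) L with ha
    have haL₁ : a ≤ L₁.length := hpa ▸ hits_le_length _ _
    have haL₂ : a ≤ L₂.length := hpa₂ ▸ hits_le_length _ _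
    rw [sum_weight_union hYK] at hcost
    have hsum := hsumB L₂ (fun v => hits {v} L₂) (fun v h => hocc v L₂ h)
    rw [hpa₂] at hsum
    have hKcost : ∑ w ∈ K, c (some w) (hits (occupied (some w)) L) =
        ∑ w ∈ K, c (some w) (hits {w} L₂) := Finset.sum_congr rfl fun w hw => by
      rw [occupied_some, hh₂ w ((hmemB w).2 (.inl hw))]
    rw [hKcost] at hcost
    have hne : L₂.length ≠ 0 → L₂ ≠ [] := fun h h' => h (by rw [h']; rfl)
    have hblock : BlockCost S K p c m a (L₂.length - a + ∑ w ∈ K, c (some w) (hits {w} L₂)) := by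
      refine ⟨L₂.length, by omega, haL₂, fun hN v hv hpv => ?_, fun w => hits {w} L₂,
        fun w hw => ⟨hits_le_length _ _, fun hN hwS => ?_⟩, by beta_reduce; omega,
        by beta_reduce; omega,
        fun hN hfree => ?_, by beta_reduce; omega⟩
      · rw [← hpa₂, ← hocc v L₂ hpv]
        exact ha4 v ⟨hv, (hmemB v).2 (.inr hpv)⟩ (hne hN)
      · exact ha4 w ⟨hwS, (hmemB w).2 (.inl hw)⟩ (hne hN)
      · have := ha3 (Set.eq_empty_of_forall_notMem fun v hv => by
          rcases (hmemB v).1 hv.2 with h | h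
          exacts [(hfree v hv.1).1 h, (hfree v hv.1).2 h]) (hne hN)
        beta_reduce
        omega
    have hYcost : ∑ z, weight Y z * c z (hits (occupied z) L) =
        ∑ z, weight Y z * c z (hits (occupied z) L₁) := by
      refine Finset.sum_congr rfl fun z _ => ?_
      rcases z with _ | v
      · simp [occupied_none, hits_empty]
      · by_cases hv : v ∈ Y
        · rw [occupied_some, hh₁ v hv]
        · simp [weight, ind_of_notMem hv]
    have hswap := sum_weight_of_eq (c := c) (c' := c') hp hc fun z => hits (occupied z) L₁
    simp only [hpa] at hswap
    have hcpa : c p a ≤ ∑ z, weight Y z * c z (hits (occupied z) L₁) := by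
      have hw : weight Y p = 1 := by
        rcases hpc : p with _ | v
        · rfl
        · exact ind_of_mem (hp v hpc)
      have := Finset.single_le_sum (f := fun z => weight Y z * c z (hits (occupied z) L₁))
        (fun _ _ => Nat.zero_le _) (Finset.mem_univ p)
      simpa [hw, hpa] using this
    have hc'p := (hcp a (by omega) (c p a + (L₂.length - a +
      ∑ w ∈ K, c (some w) (hits {w} L₂))) (by omega)).2 ⟨_, hblock, le_rfl⟩
    exact ⟨L₁, hL₁, by omega⟩
  · rintro ⟨L₁, hL₁, hcost⟩
    set a := hits (occupied p) L₁ with ha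
    have haL₁ : a ≤ L₁.length := hits_le_length _ _
    have hswap := sum_weight_of_eq (c := c) (c' := c') hp hc fun z => hits (occupied z) L₁
    have hc'pa : c' p a ≤ ∑ z, weight Y z * c' z (hits (occupied z) L₁) := by
      have hw : weight Y p = 1 := by
        rcases hpc : p with _ | v
        · rfl
        · exact ind_of_mem (hp v hpc)
      have := Finset.single_le_sum (f := fun z => weight Y z * c' z (hits (occupied z) L₁))
        (fun _ _ => Nat.zero_le _) (Finset.mem_univ p)
      simpa [hw, ← ha] using this
    obtain ⟨z, ⟨N, hN, haN, hstart, f, hf, h1, h2, hfree, hz⟩, hcz⟩ :=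
      (hcp a (by omega) (c' p a) (by omega)).1 le_rfl
    set g : V → ℕ := fun v => if p = some v then a else f v with hg
    have hgK : ∀ w ∈ K, g w = f w := fun w hw => if_neg fun h => hYK w hw (hp w h)
    have hsum : ∑ v ∈ B, g v = ∑ w ∈ K, f w + a := by
      rw [hsumB L₁ g (fun v h => if_pos h), Finset.sum_congr rfl hgK]
    have hLp : ∀ v, p = some v → g v = a := fun v h => if_pos h
    have key := exists_run_block (N := N) (f := g) hS hT hBclique ?_ ?_
      (by omega) (by omega) ?_ ?_
    · obtain ⟨L₂, hL₂, hlen₂, hh₂⟩ := key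
      obtain ⟨L, hL, hlen, hhY, hhB⟩ := hsep.exists_glue _ L₁ L₂ (S ∩ Y) (S ∩ B) le_rfl
        Set.inter_subset_right Set.inter_subset_right
        (by ext v; simp only [Set.mem_inter_iff]; tauto) (hS.mono Set.inter_subset_left)
        (hS.mono Set.inter_subset_left) hL₁ hL₂ (by
          rw [hinter]
          rcases hpc : p with _ | v
          · simp [occupied_none, hits_empty]
          · rw [occupied_some, hh₂ v ((hmemB v).2 (.inr hpc)), hLp v hpc, hocc v L₁ hpc])
      rw [← Set.inter_union_distrib_left, ← Set.inter_union_distrib_left, hunion] at hL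
      rw [hinter] at hlen
      refine ⟨L, hL, ?_⟩
      have hYcost : ∑ z, weight Y z * c z (hits (occupied z) L) =
          ∑ z, weight Y z * c z (hits (occupied z) L₁) := by
        refine Finset.sum_congr rfl fun z _ => ?_
        rcases z with _ | v
        · simp [occupied_none, hits_empty]
        · by_cases hv : v ∈ Y
          · rw [occupied_some, hhY v hv]
          · simp [weight, ind_of_notMem hv]
      have hKcost : ∑ w ∈ K, c (some w) (hits (occupied (some w)) L) =
          ∑ w ∈ K, c (some w) (f w) := Finset.sum_congr rfl fun w hw => by
        have hwB := (hmemB w).2 (.inl hw)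
        rw [occupied_some, hhB w hwB, hh₂ w hwB, hgK w hw]
      rw [sum_weight_union hYK, hYcost, hKcost]
      simp only [← ha] at hswap
      omega
    · intro v hv
      rcases (hmemB v).1 hv with h | h
      · rw [hgK v h]; exact (hf v h).1
      · rw [hLp v h]; exact haN
    · intro v hv
      rcases (hmemB v).1 hv with h | h
      · rw [hgK v h]
        refine hpar v _ ?_
        have := Finset.single_le_sum (f := fun w => c (some w) (f w)) (fun _ _ => Nat.zero_le _) h
        omega
      · have hvY : ∀ U : Set V, ind (U ∩ Y) v = ind U v := fun U =>
          ind_congr ⟨fun h => h.1, fun h' => ⟨h', hp v h⟩⟩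
        have := hL₁.even v
        rw [hocc v L₁ h, ← ha, hvY, hvY] at this
        rwa [hLp v h]
    · intro hN0 v hv hvB
      rcases (hmemB v).1 hvB with h | h
      · rw [hgK v h]; exact (hf v h).2 hN0 hv
      · rw [hLp v h]; exact hstart hN0 v hv h
    · intro hN0 hfr
      rw [hsum]
      exact hfree hN0 fun v hv =>
        ⟨fun h => hfr v hv ((hmemB v).2 (.inl h)), fun h => hfr v hv ((hmemB v).2 (.inr h))⟩

end Elimination


/-! ### Reconfiguration sequences and the successive elimination of blocks -/

section Instances

variable {V : Type*} {G : SimpleGraph V} {S T : Set V}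

lemma yesInstance_iff_exists_isRun (hS : G.IsIndepSet S) {k : ℕ} :
    YesInstance G S T k ↔ ∃ L, IsRun G Set.univ S L T ∧ L.length ≤ k := by
  constructor
  · rintro ⟨l, hl, I, hI⟩
    suffices ∃ L, IsRun G Set.univ S L T ∧ L.length = l by
      obtain ⟨L, hL, rfl⟩ := this
      exact ⟨L, hL, hl⟩
    clear hl hS
    induction l generalizing I S with
    | zero => exact ⟨[], hI.1.symm.trans hI.2.1, rfl⟩
    | succ l ih =>
      obtain ⟨h0, hT, hind, hadj⟩ := hI
      obtain ⟨L, hL, hlen⟩ := ih (S := I 1) (fun i => I (i + 1))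
        ⟨rfl, hT, fun i hi => hind _ (by omega), fun i hi => hadj _ (by omega)⟩
      have h1 : symmDiff S (symmDiff S (I 1)) = I 1 := symmDiff_symmDiff_cancel_left _ _
      refine ⟨symmDiff S (I 1) :: L, ⟨Set.subset_univ _, ?_, ?_, ?_⟩, by simp [hlen]⟩
      · have := hadj 0 (by omega)
        rwa [h0] at this
      · rw [h1]; exact hind 1 (by omega)
      · rwa [h1]
  · rintro ⟨L, hL, hk⟩
    refine ⟨L.length, hk, ?_⟩
    clear hk
    induction L generalizing S with
    | nil =>
      refine ⟨fun _ => S, rfl, hL, fun _ _ => hS, fun i hi => absurd hi (Nat.not_lt_zero i)⟩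
    | cons F L ih =>
      obtain ⟨-, hconn, hind, hrun⟩ := hL
      obtain ⟨I, h0, hT, hindep, hadj⟩ := ih hind hrun
      refine ⟨fun i => Nat.casesOn i S I, rfl, hT, ?_, ?_⟩
      · rintro (_ | i) hi
        · exact hS
        · exact hindep i (by simpa using hi)
      · rintro (_ | i) hi
        · change FlipAdj G S (I 0)
          rw [h0, FlipAdj, symmDiff_symmDiff_cancel_left]
          exact hconn
        · exact hadj i (by simpa using hi)

lemma connected_induce_singleton (v : V) : (G.induce {v}).Connected := by
  rw [connected_induce_iff_joinedIn]
  refine ⟨⟨v, rfl⟩, ?_⟩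
  rintro x rfl y rfl
  exact .refl rfl

lemma exists_isRun_of_subset (A : Finset V) (hA : G.IsIndepSet (A : Set V)) :
    (∃ L, IsRun G Set.univ A L ∅ ∧ L.length = A.card) ∧
      ∃ L, IsRun G Set.univ ∅ L A ∧ L.length = A.card := by
  classical
  induction A using Finset.induction_on with
  | empty => exact ⟨⟨[], by simp [IsRun], rfl⟩, ⟨[], by simp [IsRun], rfl⟩⟩
  | insert v A hv ih =>
    have hA' : G.IsIndepSet (A : Set V) := hA.mono (by simp)
    obtain ⟨⟨L, hL, hLlen⟩, M, hM, hMlen⟩ := ih hA'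
    have h1 : symmDiff (↑(insert v A)) {v} = (A : Set V) := by
      ext x
      by_cases hx : x = v
      · subst hx; simp [Set.mem_symmDiff, hv]
      · simp [Set.mem_symmDiff, hx]
    have h2 : symmDiff (A : Set V) {v} = ↑(insert v A) := by
      rw [← h1, symmDiff_symmDiff_cancel_right]
    refine ⟨⟨{v} :: L, ⟨Set.subset_univ _, connected_induce_singleton v, ?_, ?_⟩, ?_⟩,
      M ++ [{v}], hM.append ⟨Set.subset_univ _, connected_induce_singleton v, ?_, ?_⟩, ?_⟩
    · rwa [h1]
    · rwa [h1]
    · simp [hLlen, hv]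
    · rwa [h2]
    · rw [h2]; rfl
    · simp [hMlen, hv]

/-- Removing the vertices of `S` and adding those of `T`, one by one, is a reconfiguration
sequence. -/
lemma yesInstance_two_mul_card [Fintype V] (hS : G.IsIndepSet S) (hT : G.IsIndepSet T) :
    YesInstance G S T (2 * Fintype.card V) := by
  classical
  rw [yesInstance_iff_exists_isRun hS]
  obtain ⟨⟨L, hL, hlen⟩, -⟩ := exists_isRun_of_subset (G := G) S.toFinset (by simpa using hS)
  obtain ⟨-, M, hM, hMlen⟩ := exists_isRun_of_subset (G := G) T.toFinset (by simpa using hT)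
  simp only [Set.coe_toFinset] at hL hM
  refine ⟨L ++ M, hL.append hM, ?_⟩
  have h1 := S.toFinset.card_le_univ
  have h2 := T.toFinset.card_le_univ
  simp only [List.length_append]
  omega

variable [Fintype V] {c c' : Option V → ℕ → ℕ} {m : ℕ}

/-- If the costs only enforce the parity of the numbers of flips, then they can be ignored. -/
lemma hasRun_univ_iff (hS : G.IsIndepSet S) (hnone : c none 0 = 0)
    (hc : ∀ v, ∀ a < m, Even (a + ind S v + ind T v) → c (some v) a = 0) {y : ℕ} (hy : y < m) :
    HasRun G S T Set.univ c y ↔ YesInstance G S T y := by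
  rw [yesInstance_iff_exists_isRun hS]
  simp only [HasRun, Set.inter_univ]
  refine exists_congr fun L => and_congr_right fun hL => ?_
  constructor
  · intro h; omega
  · intro h
    have hzero : ∑ z : Option V, weight Set.univ z * c z (hits (occupied z) L) = 0 := by
      refine Finset.sum_eq_zero fun z _ => ?_
      rcases z with _ | v
      · simp [occupied_none, hits_empty, hnone]
      · rw [occupied_some, hc v _ ((hits_le_length _ _).trans_lt (by omega)) (hL.even v), mul_zero]
    omega

lemma hasRun_empty_iff {y : ℕ} : HasRun G S T ∅ c y ↔ c none 0 ≤ y := by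
  have hsum : ∀ L : List (Set V),
      ∑ z : Option V, weight ∅ z * c z (hits (occupied z) L) = c none 0 := by
    intro L
    simp [Fintype.sum_option, weight, occupied_none, hits_empty, ind]
  simp only [HasRun, hsum, Set.inter_empty]
  constructor
  · rintro ⟨L, -, h⟩
    omega
  · intro h
    exact ⟨[], rfl, by simpa using h⟩

variable [DecidableEq V] {pos : V → ℕ}

/-- One step of the elimination along a search order, for a vertex `l` with at most one earlier
neighbour `p`. -/
lemma hasRun_remaining_iff (hG : IsBlockGraph G) (ho : IsSearchOrder G pos)
    (hS : G.IsIndepSet S) (hT : G.IsIndepSet T) {l : V} {p : Option V}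
    (hp : ∀ u, p = some u ↔ pos u < pos l ∧ G.Adj l u) {K : Finset V}
    (hK : ∀ w, w ∈ K ↔ w = l ∨ ∃ u, p = some u ∧ G.Adj w l ∧ G.Adj w u)
    (hpar : ∀ v a, c (some v) a < m → Even (a + ind S v + ind T v))
    (hc : ∀ z ≠ p, c' z = c z)
    (hcp : ∀ a < m, ∀ y < m, c' p a ≤ y ↔ ∃ z, BlockCost S K p c m a z ∧ c p a + z ≤ y)
    {y : ℕ} (hy : y < m) :
    HasRun G S T (remaining G pos (pos l + 1)) c y ↔
      HasRun G S T (remaining G pos (pos l)) c' y := by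
  rcases p with _ | p
  · obtain ⟨h1, h2, h3⟩ := remaining_succ_of_isolated hG ho (l := l)
      fun u hu hlu => by simpa using (hp u).2 ⟨hu, hlu⟩
    have hK' : ∀ w, w ∈ K ↔ w = l := fun w => by simp [hK]
    have hunion : remaining G pos (pos l + 1) = remaining G pos (pos l) ∪ K := by
      rw [h1]
      ext w
      simp [hK', or_comm]
    rw [hunion]
    refine hasRun_eliminate hS hT ?_ (by simp) ?_ (by simp) ?_ hpar hc hcp hy
    · intro w hw
      rw [hK'] at hw
      exact hw ▸ h2
    · intro w hw w' hw' hne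
      rw [hK'] at hw hw'
      exact absurd (hw.trans hw'.symm) hne
    · intro u hu w hw huw
      rw [hK'] at hw
      subst hw
      exact absurd huw (h3 u hu)
  · obtain ⟨hpl, hlp⟩ := (hp p).1 rfl
    obtain ⟨h1, h2, h3, h4, h5⟩ := remaining_succ_of_unique hG ho hpl hlp
      fun u hu hlu => (Option.some_injective _ ((hp u).2 ⟨hu, hlu⟩)).symm
    have hK' : ∀ w, w ∈ K ↔ w = l ∨ G.Adj w l ∧ G.Adj w p := fun w => by simp [hK]
    have hunion : remaining G pos (pos l + 1) = remaining G pos (pos l) ∪ K := by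
      rw [h1]
      ext w
      simp [hK']
    rw [hunion]
    refine hasRun_eliminate hS hT ?_ ?_ ?_ ?_ ?_ hpar hc hcp hy
    · exact fun w hw => (h2 w ((hK' w).1 hw)).1
    · rintro v ⟨⟩
      exact h3
    · exact fun w hw w' hw' => h5 w w' ((hK' w).1 hw) ((hK' w').1 hw')
    · rintro v ⟨⟩ w hw
      exact (h2 w ((hK' w).1 hw)).2
    · intro u hu w hw huw
      rw [h4 u hu w ((hK' w).1 hw) huw]

end Instances


/-! ### A small imperative language with bounded loops -/

/-- Expressions over variables, over two-dimensional arrays, over the input, and over a constant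
`cap` of the environment. Subtraction is truncated. -/
inductive Expr
  | const (c : ℕ)
  | var (x : ℕ)
  | cap
  | add (e₁ e₂ : Expr)
  | sub (e₁ e₂ : Expr)
  | mul (e₁ e₂ : Expr)
  | inp (e : Expr)
  | arr (q : ℕ) (i j : Expr)

/-- Commands: assignments to variables and to array cells, branching on whether an expression is
positive, and loops in which a variable runs through the numbers below the value that an expression
has at the beginning. -/
inductive Cmd
  | skip
  | assign (x : ℕ) (e : Expr)
  | store (q : ℕ) (i j e : Expr)
  | seq (C D : Cmd)
  | ite (e : Expr) (C D : Cmd)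
  | loop (x : ℕ) (e : Expr) (C : Cmd)

/-- The values of the variables and of the array cells. -/
structure Store where
  v : ℕ → ℕ
  a : ℕ → ℕ → ℕ → ℕ

/-- Assignment to a variable. -/
def Store.setVar (σ : Store) (x c : ℕ) : Store :=
  { σ with v := Function.update σ.v x c }

/-- Assignment to an array cell. -/
def Store.setArr (σ : Store) (q i j c : ℕ) : Store :=
  { σ with a := fun q' i' j' => if q' = q ∧ i' = i ∧ j' = j then c else σ.a q' i' j' }

/-- What a command can read but not change: the bound for all stored values, and the input. -/
structure Env where
  cap : ℕ
  inp : ℕ → ℕ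

/-- The value of an expression. -/
def Expr.eval (E : Env) (σ : Store) : Expr → ℕ
  | .const c => c
  | .var x => σ.v x
  | .cap => E.cap
  | .add e₁ e₂ => e₁.eval E σ + e₂.eval E σ
  | .sub e₁ e₂ => e₁.eval E σ - e₂.eval E σ
  | .mul e₁ e₂ => e₁.eval E σ * e₂.eval E σ
  | .inp e => E.inp (e.eval E σ)
  | .arr q i j => σ.a q (i.eval E σ) (j.eval E σ)

/-- The first `n` rounds of an iteration. -/
def iter (f : ℕ → Store → Store) (σ : Store) : ℕ → Store
  | 0 => σ
  | n + 1 => f n (iter f σ n)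

/-- The effect of a command. All stored values are cut off at `E.cap`, so that they fit into the
words of the machine without further ado. -/
def Cmd.exec (E : Env) : Cmd → Store → Store
  | .skip, σ => σ
  | .assign x e, σ => σ.setVar x (min (e.eval E σ) E.cap)
  | .store q i j e, σ => σ.setArr q (i.eval E σ) (j.eval E σ) (min (e.eval E σ) E.cap)
  | .seq C D, σ => D.exec E (C.exec E σ)
  | .ite e C D, σ => if 0 < e.eval E σ then C.exec E σ else D.exec E σ
  | .loop x e C, σ => iter (fun i τ => C.exec E (τ.setVar x i)) σ (min (e.eval E σ) E.cap)

/-- An upper bound for the number of instructions that evaluate an expression. -/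
def Expr.len : Expr → ℕ
  | .const _ | .var _ | .cap => 1
  | .add e₁ e₂ | .sub e₁ e₂ | .mul e₁ e₂ => e₁.len + e₂.len + 1
  | .inp e => e.len + 6
  | .arr _ i j => i.len + j.len + 9

/-- An upper bound for the number of steps of a command, if all loops have at most `B` rounds. -/
def Cmd.cost (B : ℕ) : Cmd → ℕ
  | .skip => 1
  | .assign _ e => e.len + 4
  | .store _ i j e => i.len + j.len + e.len + 12
  | .seq C D => C.cost B + D.cost B
  | .ite e C D => e.len + 3 + C.cost B + D.cost B
  | .loop _ e C => e.len + 5 + B * (C.cost B + 6)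

/-- The nesting depth of the loops. -/
def Cmd.depth : Cmd → ℕ
  | .skip | .assign _ _ | .store _ _ _ _ => 0
  | .seq C D | .ite _ C D => max C.depth D.depth
  | .loop _ _ C => C.depth + 1

/-- Nested loops are the only source of running time. -/
lemma Cmd.exists_cost_le (C : Cmd) : ∃ k, ∀ B, C.cost B ≤ k * (B + 1) ^ C.depth := by
  induction C with
  | skip => exact ⟨1, fun B => by simp [cost, depth]⟩
  | assign x e => exact ⟨e.len + 4, fun B => by simp [cost, depth]⟩
  | store q i j e => exact ⟨i.len + j.len + e.len + 12, fun B => by simp [cost, depth]⟩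
  | seq C D hC hD =>
    obtain ⟨k, hk⟩ := hC
    obtain ⟨l, hl⟩ := hD
    refine ⟨k + l, fun B => ?_⟩
    rw [add_mul]
    exact Nat.add_le_add
      ((hk B).trans (Nat.mul_le_mul_left _ (Nat.pow_le_pow_right (by omega) (le_max_left _ _))))
      ((hl B).trans (Nat.mul_le_mul_left _ (Nat.pow_le_pow_right (by omega) (le_max_right _ _))))
  | ite e C D hC hD =>
    obtain ⟨k, hk⟩ := hC
    obtain ⟨l, hl⟩ := hD
    refine ⟨e.len + 3 + k + l, fun B => ?_⟩
    rw [add_mul, add_mul]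
    exact Nat.add_le_add (Nat.add_le_add (Nat.le_mul_of_pos_right _ (by positivity))
      ((hk B).trans (Nat.mul_le_mul_left _ (Nat.pow_le_pow_right (by omega) (le_max_left _ _)))))
      ((hl B).trans (Nat.mul_le_mul_left _ (Nat.pow_le_pow_right (by omega) (le_max_right _ _))))
  | loop x e C hC =>
    obtain ⟨k, hk⟩ := hC
    refine ⟨e.len + 5 + (k + 6), fun B => ?_⟩
    rw [add_mul]
    refine Nat.add_le_add (Nat.le_mul_of_pos_right _ (by positivity)) ?_
    have h1 : 1 ≤ (B + 1) ^ C.depth := Nat.one_le_pow _ _ (by omega)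
    calc B * (C.cost B + 6) ≤ (B + 1) * (k * (B + 1) ^ C.depth + 6 * (B + 1) ^ C.depth) :=
          Nat.mul_le_mul (by omega) (Nat.add_le_add (hk B) (by omega))
      _ = (k + 6) * (B + 1) ^ (Cmd.loop x e C).depth := by simp only [depth, pow_succ]; ring

/-! ### Compilation to the random access machine -/

/-- The program that performs the instructions of a list. -/
def Program.ofList : List Instr → Program
  | [] => .loop 0 0 (.instr (.const 0 0))
  | i :: L => .seq (.instr i) (ofList L)

/-- The state after the instructions of a list. -/
def runList : List Instr → State → State
  | [], s => s
  | i :: L, s => runList L (i.apply s)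

/-- All numbers written by the instructions of a list fit into words below `W`. -/
def Safe (W : ℕ) : List Instr → State → Prop
  | [], _ => True
  | i :: L, s => i.value s < W ∧ Safe W L (i.apply s)

lemma runList_append (L M : List Instr) (s : State) :
    runList (L ++ M) s = runList M (runList L s) := by
  induction L generalizing s with
  | nil => rfl
  | cons i L ih => exact ih _

lemma safe_append {W : ℕ} {L M : List Instr} {s : State} :
    Safe W (L ++ M) s ↔ Safe W L s ∧ Safe W M (runList L s) := by
  induction L generalizing s with
  | nil => simp [Safe, runList]
  | cons i L ih => simp only [List.cons_append, Safe, runList, ih, and_assoc]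

lemma exec_ofList {W : ℕ} {L : List Instr} {s : State} (h : Safe W L s) :
    Exec W (.ofList L) s (L.length + 1) (runList L s) := by
  induction L generalizing s with
  | nil => exact .loop_false (lt_irrefl _)
  | cons i L ih =>
    have := Exec.seq (.instr h.1) (ih h.2)
    rwa [add_comm 1] at this

/-- Cell `(i, j)` of array `q` is stored at the address `base + pair (pair i j) q`. The pairing is
injective and can be computed without division. -/
def pair (i j : ℕ) : ℕ := (i + j) * (i + j) + i

lemma pair_inj {i j i' j' : ℕ} (h : pair i j = pair i' j') : i = i' ∧ j = j' := by
  unfold pair at h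
  have hsum : i + j = i' + j' := by
    rcases lt_trichotomy (i + j) (i' + j') with hlt | heq | hlt
    · nlinarith
    · exact heq
    · nlinarith
  rw [hsum] at h
  omega

/-- The register of a temporary value. Variables occupy the registers with even numbers. -/
def tmp (t : ℕ) : ℕ := 2 * t + 1

/-- Replaces the temporary value `t` by its minimum with the cap in register `3`. -/
def capCode (t : ℕ) : List Instr :=
  [.sub (tmp (t + 1)) (tmp t) 3, .sub (tmp t) (tmp t) (tmp (t + 1))]

/-- Computes the address of the cell of array `q` whose coordinates are the temporary values `t`
and `t + 1`, as the temporary value `t + 2`. Register `5` holds the base address. -/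
def addrCode (t q : ℕ) : List Instr :=
  [.add (tmp (t + 2)) (tmp t) (tmp (t + 1)), .mul (tmp (t + 2)) (tmp (t + 2)) (tmp (t + 2)),
    .add (tmp (t + 2)) (tmp (t + 2)) (tmp t), .const (tmp (t + 3)) q,
    .add (tmp (t + 3)) (tmp (t + 2)) (tmp (t + 3)), .mul (tmp (t + 3)) (tmp (t + 3)) (tmp (t + 3)),
    .add (tmp (t + 2)) (tmp (t + 3)) (tmp (t + 2)), .add (tmp (t + 2)) (tmp (t + 2)) 5]

/-- The code that evaluates an expression to the temporary value `t`, leaving the earlier temporary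
values untouched. Input cells from the base address on read as `0`. -/
def Expr.compile : Expr → ℕ → List Instr
  | .const c, t => [.const (tmp t) c]
  | .var x, t => [.move (tmp t) (2 * x)]
  | .cap, t => [.move (tmp t) 3]
  | .add e₁ e₂, t => e₁.compile t ++ (e₂.compile (t + 1) ++ [.add (tmp t) (tmp t) (tmp (t + 1))])
  | .sub e₁ e₂, t => e₁.compile t ++ (e₂.compile (t + 1) ++ [.sub (tmp t) (tmp t) (tmp (t + 1))])
  | .mul e₁ e₂, t => e₁.compile t ++ (e₂.compile (t + 1) ++ [.mul (tmp t) (tmp t) (tmp (t + 1))])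
  | .inp e, t => e.compile t ++ [.sub (tmp (t + 1)) 5 (tmp t), .const (tmp (t + 2)) 1,
      .sub (tmp (t + 1)) (tmp (t + 2)) (tmp (t + 1)),
      .sub (tmp (t + 1)) (tmp (t + 2)) (tmp (t + 1)),
      .load (tmp t) (tmp t), .mul (tmp t) (tmp t) (tmp (t + 1))]
  | .arr q i j, t => i.compile t ++ (j.compile (t + 1) ++ (addrCode t q ++
      [.load (tmp t) (tmp (t + 2))]))

/-- The program of a command that may use the temporary values from `t` on. -/
def Cmd.compile : Cmd → ℕ → Program
  | .skip, _ => .ofList []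
  | .assign x e, t => .ofList (e.compile t ++ (capCode t ++ [.move (2 * x) (tmp t)]))
  | .store q i j e, t => .ofList (e.compile t ++ (capCode t ++ (i.compile (t + 1) ++
      (j.compile (t + 2) ++ (addrCode (t + 1) q ++ [.store (tmp (t + 3)) (tmp t)])))))
  | .seq C D, t => .seq (C.compile t) (D.compile t)
  | .ite e C D, t => .seq (.ofList (e.compile t ++ [Instr.const (tmp (t + 1)) 0]))
      (.ite (tmp (t + 1)) (tmp t) (C.compile t) (D.compile t))
  | .loop x e C, t => .seq (.ofList (e.compile t ++ (capCode t ++ [Instr.const (tmp (t + 1)) 0])))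
      (.loop (tmp (t + 1)) (tmp t) (.seq (.ofList [.move (2 * x) (tmp (t + 1))])
        (.seq (C.compile (t + 2))
          (.ofList [.const (tmp (t + 2)) 1, .add (tmp (t + 1)) (tmp (t + 1)) (tmp (t + 2))]))))

/-- An exponent `d` such that all numbers that occur in the evaluation of an expression are smaller
than `X ^ d`, if the cap and the base address are smaller than `X ^ 3`. -/
def Expr.size : Expr → ℕ
  | .const c => c + 1
  | .var _ | .cap => 3
  | .add e₁ e₂ | .sub e₁ e₂ | .mul e₁ e₂ => e₁.size + e₂.size
  | .inp e => e.size + 3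
  | .arr q i j => 9 * (i.size + j.size) + 2 * q + 5

/-- An exponent for all numbers that occur in the execution of a command. -/
def Cmd.size : Cmd → ℕ
  | .skip => 1
  | .assign _ e => e.size + 3
  | .store q i j e => e.size + 9 * (i.size + j.size) + 2 * q + 5
  | .seq C D => C.size + D.size
  | .ite e C D => e.size + 1 + C.size + D.size
  | .loop _ e C => e.size + 3 + C.size

/-- The machine state `s` represents the store `σ`. -/
structure Rep (E : Env) (base : ℕ) (σ : Store) (s : State) : Prop where
  var : ∀ x, s.reg (2 * x) = σ.v x
  cap : s.reg 3 = E.cap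
  base_eq : s.reg 5 = base
  inp_eq : ∀ x < base, s.mem x = E.inp x
  arr : ∀ q i j, s.mem (base + pair (pair i j) q) = σ.a q i j
  var_le : ∀ x, σ.v x ≤ E.cap
  mem_le : ∀ x, s.mem x ≤ E.cap

/-- The state `s'` arises from `s` by changing temporary values from `t` on. -/
structure Frame (t : ℕ) (s s' : State) : Prop where
  mem : s'.mem = s.mem
  var : ∀ x, s'.reg (2 * x) = s.reg (2 * x)
  tmp : ∀ i < t, s'.reg (tmp i) = s.reg (tmp i)

lemma Frame.trans {t t' : ℕ} {s s' s'' : State} (h : Frame t s s') (h' : Frame t' s' s'')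
    (ht : t ≤ t') : Frame t s s'' :=
  ⟨h'.mem.trans h.mem, fun x => (h'.var x).trans (h.var x), fun i hi =>
    (h'.tmp i (by omega)).trans (h.tmp i hi)⟩

lemma Rep.frame {E : Env} {base t : ℕ} {σ : Store} {s s' : State} (h : Rep E base σ s)
    (hf : Frame t s s') (ht : 3 ≤ t) : Rep E base σ s' :=
  ⟨fun x => (hf.var x).trans (h.var x), (hf.tmp 1 (by omega)).trans h.cap,
    (hf.tmp 2 (by omega)).trans h.base_eq, by rw [hf.mem]; exact h.inp_eq,
    by rw [hf.mem]; exact h.arr,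
    h.var_le, by rw [hf.mem]; exact h.mem_le⟩

lemma tmp_ne_two_mul (t x : ℕ) : tmp t ≠ 2 * x := by unfold tmp; omega

lemma two_mul_ne_tmp (t x : ℕ) : 2 * x ≠ tmp t := by unfold tmp; omega

lemma tmp_inj {t t' : ℕ} : tmp t = tmp t' ↔ t = t' := by unfold tmp; omega

section Powers

variable {X a b x y : ℕ}

lemma add_lt_pow_add (hX : 2 ≤ X) (ha : 1 ≤ a) (hb : 1 ≤ b) (hx : x < X ^ a) (hy : y < X ^ b) :
    x + y < X ^ (a + b) := by
  have h1 : 2 ≤ X ^ a := hX.trans (Nat.le_self_pow (by omega) X)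
  have h2 : 2 ≤ X ^ b := hX.trans (Nat.le_self_pow (by omega) X)
  rw [pow_add]
  nlinarith

lemma mul_lt_pow_add (hx : x < X ^ a) (hy : y < X ^ b) : x * y < X ^ (a + b) := by
  rw [pow_add]
  exact Nat.mul_lt_mul'' hx hy

lemma lt_pow_mono (hX : 2 ≤ X) (hab : a ≤ b) (hx : x < X ^ a) : x < X ^ b :=
  hx.trans_le (Nat.pow_le_pow_right (by omega) hab)

lemma lt_pow_succ (hX : 2 ≤ X) (c : ℕ) : c < X ^ (c + 1) :=
  (Nat.lt_pow_self (n := c) (by omega : 1 < X)).trans_le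
    (Nat.pow_le_pow_right (by omega) (by omega))

end Powers

lemma Expr.one_le_size (e : Expr) : 1 ≤ e.size := by
  induction e <;> simp only [size] <;> omega

lemma Expr.length_compile (e : Expr) (t : ℕ) : (e.compile t).length = e.len := by
  induction e generalizing t with
  | add e₁ e₂ h₁ h₂ | sub e₁ e₂ h₁ h₂ | mul e₁ e₂ h₁ h₂ => simp [compile, len, h₁, h₂]; omega
  | inp e h => simp [compile, len, h]
  | arr q i j hi hj => simp [compile, len, hi, hj, addrCode]; omega
  | _ => rfl

lemma frame_update {t : ℕ} {s : State} {i c : ℕ} (hi : t ≤ i) :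
    Frame t s { s with reg := Function.update s.reg (tmp i) c } :=
  ⟨rfl, fun x => Function.update_of_ne (two_mul_ne_tmp i x) _ _, fun j hj =>
    Function.update_of_ne (fun h => by rw [tmp_inj] at h; omega) _ _⟩

/-- The correctness of the address computation. -/
lemma addrCode_spec {X W base t q a b i j : ℕ} {s : State} (hX : 2 ≤ X) (ht : 3 ≤ t)
    (ha : 1 ≤ a) (hb : 1 ≤ b)
    (hbase : base < X ^ 3) (h5 : s.reg 5 = base) (hi : s.reg (tmp t) = i)
    (hj : s.reg (tmp (t + 1)) = j) (hia : i < X ^ a) (hjb : j < X ^ b)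
    (hW : X ^ (9 * (a + b) + 2 * q + 5) ≤ W) :
    Safe W (addrCode t q) s ∧
      (runList (addrCode t q) s).reg (tmp (t + 2)) = base + pair (pair i j) q ∧
      Frame (t + 2) s (runList (addrCode t q) s) := by
  have hq := lt_pow_succ hX q
  have h1 := add_lt_pow_add hX ha hb hia hjb
  have h2 := mul_lt_pow_add h1 h1
  have h3 := add_lt_pow_add hX (by omega) ha h2 hia
  have h4 := add_lt_pow_add hX (by omega) (by omega) h3 hq
  have h6 := mul_lt_pow_add h4 h4
  have h7 := add_lt_pow_add hX (by omega) (by omega) h6 h3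
  have h8 := add_lt_pow_add hX (by omega) (by omega) h7 hbase
  have hle : ∀ {d x : ℕ}, x < X ^ d → d ≤ 9 * (a + b) + 2 * q + 5 → x < W := fun hx hd =>
    (lt_pow_mono hX hd hx).trans_le hW
  have e5 : (5 : ℕ) = tmp 2 := rfl
  rw [e5] at h5
  have ht0 : t ≠ 0 := by omega
  refine ⟨?_, ?_, ?_⟩
  · simp [addrCode, Safe, Instr.value, Instr.apply, tmp_inj, hi, hj, h5, e5,
      ht0]
    exact ⟨hle h1 (by omega), hle h2 (by omega), hle h3 (by omega), hle hq (by omega),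
      hle h4 (by omega), hle h6 (by omega), hle h7 (by omega), hle h8 (by omega)⟩
  · simp [addrCode, runList, Instr.value, Instr.apply, tmp_inj, hi, hj, h5,
      e5, ht0, pair]
    ring
  · refine ⟨rfl, fun x => ?_, fun k hk => ?_⟩
    · simp [addrCode, runList, Instr.value, Instr.apply, Function.update_apply, two_mul_ne_tmp]
    · have n1 : ¬ (k = t + 2) := by omega
      have n2 : ¬ (k = t + 3) := by omega
      simp [addrCode, runList, Instr.value, Instr.apply, Function.update_apply, tmp_inj, n1, n2]

/-- The assumptions on the environment under which code is run on words below `W`. -/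
structure Fits (E : Env) (base X : ℕ) : Prop where
  two_le : 2 ≤ X
  cap_lt : E.cap < X ^ 3
  base_lt : base < X ^ 3
  inp : ∀ x, base ≤ x → E.inp x = 0

lemma Expr.compile_spec {E : Env} {base X W : ℕ} (hE : Fits E base X) {σ : Store} (e : Expr) :
    ∀ (t : ℕ) (s : State), 3 ≤ t → Rep E base σ s → X ^ e.size ≤ W →
      Safe W (e.compile t) s ∧ (runList (e.compile t) s).reg (tmp t) = e.eval E σ ∧
      Frame t s (runList (e.compile t) s) ∧ e.eval E σ < X ^ e.size := by
  have hX := hE.two_le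
  -- The common part of the binary operations.
  have hbin : ∀ (e₁ e₂ : Expr) (i : Instr) (c : ℕ) (t : ℕ) (s : State), 3 ≤ t → Rep E base σ s →
      X ^ (e₁.size + e₂.size) ≤ W → c < X ^ (e₁.size + e₂.size) →
      (∀ s' : State, s'.reg (tmp t) = e₁.eval E σ → s'.reg (tmp (t + 1)) = e₂.eval E σ →
        i.value s' = c ∧ i.apply s' = { s' with reg := Function.update s'.reg (tmp t) c }) →
      (∀ (t : ℕ) (s : State), 3 ≤ t → Rep E base σ s → X ^ e₁.size ≤ W →
        Safe W (e₁.compile t) s ∧ (runList (e₁.compile t) s).reg (tmp t) = e₁.eval E σ ∧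
        Frame t s (runList (e₁.compile t) s) ∧ e₁.eval E σ < X ^ e₁.size) →
      (∀ (t : ℕ) (s : State), 3 ≤ t → Rep E base σ s → X ^ e₂.size ≤ W →
        Safe W (e₂.compile t) s ∧ (runList (e₂.compile t) s).reg (tmp t) = e₂.eval E σ ∧
        Frame t s (runList (e₂.compile t) s) ∧ e₂.eval E σ < X ^ e₂.size) →
      Safe W (e₁.compile t ++ (e₂.compile (t + 1) ++ [i])) s ∧
        (runList (e₁.compile t ++ (e₂.compile (t + 1) ++ [i])) s).reg (tmp t) = c ∧
        Frame t s (runList (e₁.compile t ++ (e₂.compile (t + 1) ++ [i])) s) ∧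
        c < X ^ (e₁.size + e₂.size) := by
    intro e₁ e₂ i c t s ht hs hW hc hi h₁ h₂
    obtain ⟨s1, v1, f1, -⟩ := h₁ t s ht hs
      ((Nat.pow_le_pow_right (by omega) (by omega)).trans hW)
    obtain ⟨s2, v2, f2, -⟩ := h₂ (t + 1) _ (by omega) (hs.frame f1 ht)
      ((Nat.pow_le_pow_right (by omega) (by omega)).trans hW)
    obtain ⟨hv, ha⟩ := hi (runList (e₂.compile (t + 1)) (runList (e₁.compile t) s))
      ((f2.tmp t (by omega)).trans v1) v2
    simp only [safe_append, runList_append]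
    refine ⟨⟨s1, s2, by rw [hv]; exact hc.trans_le hW, trivial⟩, ?_, ?_, hc⟩
    · simp only [runList, ha, Function.update_self]
    · simp only [runList, ha]
      exact (f1.trans f2 (by omega)).trans (frame_update le_rfl) le_rfl
  induction e with
  | const c =>
    intro t s ht hs hW
    have hc := lt_pow_succ hX c
    exact ⟨⟨hc.trans_le hW, trivial⟩, Function.update_self _ _ _, frame_update le_rfl, hc⟩
  | var x =>
    intro t s ht hs hW
    have hc := (hs.var_le x).trans_lt hE.cap_lt
    refine ⟨⟨?_, trivial⟩, ?_, frame_update le_rfl, hc⟩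
    · change s.reg (2 * x) < W
      rw [hs.var]
      exact hc.trans_le hW
    · exact (Function.update_self _ _ _).trans (hs.var x)
  | cap =>
    intro t s ht hs hW
    refine ⟨⟨?_, trivial⟩, ?_, frame_update le_rfl, hE.cap_lt⟩
    · change s.reg 3 < W
      rw [hs.cap]
      exact hE.cap_lt.trans_le hW
    · exact (Function.update_self _ _ _).trans hs.cap
  | add e₁ e₂ h₁ h₂ =>
    intro t s ht hs hW
    have b1 := (h₁ t s ht hs ((Nat.pow_le_pow_right (by omega) (by simp [size])).trans hW)).2.2.2
    have b2 := (h₂ t s ht hs ((Nat.pow_le_pow_right (by omega) (by simp [size])).trans hW)).2.2.2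
    exact hbin e₁ e₂ _ _ t s ht hs hW
      (add_lt_pow_add hX e₁.one_le_size e₂.one_le_size b1 b2)
      (fun s' u1 u2 => by simp [Instr.value, Instr.apply, u1, u2, eval]) h₁ h₂
  | sub e₁ e₂ h₁ h₂ =>
    intro t s ht hs hW
    have b1 := (h₁ t s ht hs ((Nat.pow_le_pow_right (by omega) (by simp [size])).trans hW)).2.2.2
    exact hbin e₁ e₂ _ _ t s ht hs hW
      ((Nat.sub_le _ _).trans_lt (lt_pow_mono hX (by omega) b1))
      (fun s' u1 u2 => by simp [Instr.value, Instr.apply, u1, u2, eval]) h₁ h₂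
  | mul e₁ e₂ h₁ h₂ =>
    intro t s ht hs hW
    have b1 := (h₁ t s ht hs ((Nat.pow_le_pow_right (by omega) (by simp [size])).trans hW)).2.2.2
    have b2 := (h₂ t s ht hs ((Nat.pow_le_pow_right (by omega) (by simp [size])).trans hW)).2.2.2
    exact hbin e₁ e₂ _ _ t s ht hs hW (mul_lt_pow_add b1 b2)
      (fun s' u1 u2 => by simp [Instr.value, Instr.apply, u1, u2, eval]) h₁ h₂
  | inp e h =>
    intro t s ht hs hW
    obtain ⟨s1, v1, f1, b1⟩ := h t s ht hs
      ((Nat.pow_le_pow_right (by omega) (by simp [size])).trans hW)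
    have hs1 := hs.frame f1 ht
    set s₁ := runList (e.compile t) s with hs₁
    set x := e.eval E σ with hx
    have e5 : (5 : ℕ) = tmp 2 := rfl
    have hb := hs1.base_eq
    rw [e5] at hb
    have hW3 : X ^ 3 ≤ W := (Nat.pow_le_pow_right (by omega) (by simp [size])).trans hW
    have h1W : 1 < W := (by omega : 1 < X).trans_le
      ((Nat.le_self_pow (by omega) X).trans hW3)
    have ne1 : ¬ (2 = t + 1) := by omega
    have ne2 : ¬ (2 = t) := by omega
    have hmem := (hs1.mem_le x).trans_lt hE.cap_lt
    have hval : s₁.mem x * (1 - (1 - (base - x))) = E.inp x := by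
      by_cases hlt : x < base
      · have : 1 - (1 - (base - x)) = 1 := by omega
        rw [this, mul_one, hs1.inp_eq x hlt]
      · have : 1 - (1 - (base - x)) = 0 := by omega
        rw [this, mul_zero, hE.inp x (by omega)]
    have hlt : E.inp x < X ^ 3 := by
      rw [← hval]
      refine (Nat.mul_le_mul_left _ (by omega : 1 - (1 - (base - x)) ≤ 1)).trans_lt ?_
      rwa [mul_one]
    simp only [compile, safe_append, runList_append, ← hs₁]
    refine ⟨⟨s1, ?_⟩, ?_, f1.trans (t' := t) ?_ le_rfl,
      lt_pow_mono hX (by simp [size]) hlt⟩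
    · simp [Safe, Instr.value, Instr.apply, tmp_inj, v1, e5, hb]
      exact ⟨by have := hE.base_lt; omega, h1W, by omega, by omega, hmem.trans_le hW3,
        by rw [hval]; exact hlt.trans_le hW3⟩
    · simp [runList, Instr.value, Instr.apply, tmp_inj, v1, e5, hb]
      exact hval
    · refine ⟨rfl, fun y => ?_, fun k hk => ?_⟩
      · simp [runList, Instr.value, Instr.apply, Function.update_apply, two_mul_ne_tmp]
      · have n1 : ¬ (k = t) := by omega
        have n2 : ¬ (k = t + 1) := by omega
        have n3 : ¬ (k = t + 2) := by omega
        simp [runList, Instr.value, Instr.apply, tmp_inj, n1, n2, n3]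
  | arr q i j hi hj =>
    intro t s ht hs hW
    have hle : ∀ d, d ≤ (Expr.arr q i j).size → X ^ d ≤ W := fun d hd =>
      (Nat.pow_le_pow_right (by omega) hd).trans hW
    obtain ⟨s1, v1, f1, b1⟩ := hi t s ht hs (hle _ (by simp only [size]; omega))
    have hs1 := hs.frame f1 ht
    obtain ⟨s2, v2, f2, b2⟩ := hj (t + 1) _ (by omega) hs1 (hle _ (by simp only [size]; omega))
    have hs2 := hs1.frame f2 (by omega)
    obtain ⟨s3, v3, f3⟩ := addrCode_spec (q := q) hX ht i.one_le_size j.one_le_size hE.base_lt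
      hs2.base_eq ((f2.tmp t (by omega)).trans v1) v2 b1 b2 hW
    have hs3 := hs2.frame f3 (by omega)
    have hval := hs3.arr q (i.eval E σ) (j.eval E σ)
    have hlt : σ.a q (i.eval E σ) (j.eval E σ) < X ^ 3 :=
      hval ▸ (hs3.mem_le _).trans_lt hE.cap_lt
    simp only [compile, safe_append, runList_append]
    refine ⟨⟨s1, s2, s3, ?_, trivial⟩, ?_, ?_, lt_pow_mono hX (by simp only [size]; omega) hlt⟩
    · simp only [Instr.value, v3, hval]
      exact hlt.trans_le (hle 3 (by simp only [size]; omega))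
    · simp only [runList, Instr.apply, Function.update_self, Instr.value, v3, hval, eval]
    · exact (((f1.trans f2 (by omega)).trans f3 (by omega)).trans (frame_update le_rfl) le_rfl)

lemma capCode_spec {E : Env} {base X W t c : ℕ} {σ : Store} {s : State} (hs : Rep E base σ s)
    (hc : s.reg (tmp t) = c) (hcX : c < X) (hW : X ≤ W) :
    Safe W (capCode t) s ∧ (runList (capCode t) s).reg (tmp t) = min c E.cap ∧
      Frame t s (runList (capCode t) s) := by
  have e3 : (3 : ℕ) = tmp 1 := rfl
  have h3 := hs.cap
  rw [e3] at h3
  refine ⟨?_, ?_, ?_⟩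
  · simp [capCode, Safe, Instr.value, Instr.apply, tmp_inj, hc, e3, h3]
    omega
  · simp [capCode, runList, Instr.value, Instr.apply, tmp_inj, hc, e3, h3]
    omega
  · refine ⟨rfl, fun x => ?_, fun k hk => ?_⟩
    · simp [capCode, runList, Instr.value, Instr.apply, Function.update_apply, two_mul_ne_tmp]
    · have n1 : ¬ (k = t) := by omega
      have n2 : ¬ (k = t + 1) := by omega
      simp [capCode, runList, Instr.value, Instr.apply, tmp_inj, n1, n2]

/-- Evaluation of an expression, cut off at the cap. -/
lemma Expr.compile_cap_spec {E : Env} {base X W : ℕ} (hE : Fits E base X) {σ : Store} (e : Expr)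
    {t : ℕ} {s : State} (ht : 3 ≤ t) (hs : Rep E base σ s) (hW : X ^ e.size ≤ W) :
    Safe W (e.compile t ++ capCode t) s ∧
      (runList (e.compile t ++ capCode t) s).reg (tmp t) = min (e.eval E σ) E.cap ∧
      Frame t s (runList (e.compile t ++ capCode t) s) := by
  obtain ⟨s1, v1, f1, b1⟩ := e.compile_spec hE t s ht hs hW
  obtain ⟨s2, v2, f2⟩ := capCode_spec (W := W) (hs.frame f1 ht) v1 b1 hW
  simp only [safe_append, runList_append]
  exact ⟨⟨s1, s2⟩, v2, f1.trans f2 le_rfl⟩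

lemma Rep.setVar {E : Env} {base : ℕ} {σ : Store} {s : State} (hs : Rep E base σ s) {x c : ℕ}
    (hc : c ≤ E.cap) :
    Rep E base (σ.setVar x c) { s with reg := Function.update s.reg (2 * x) c } := by
  refine ⟨fun y => ?_, ?_, ?_, hs.inp_eq, hs.arr, fun y => ?_, hs.mem_le⟩
  · by_cases h : y = x
    · simp [Store.setVar, h]
    · have : 2 * y ≠ 2 * x := by omega
      simp [Store.setVar, h, hs.var]
  · have : 3 ≠ 2 * x := by omega
    simp [this, hs.cap]
  · have : 5 ≠ 2 * x := by omega
    simp [this, hs.base_eq]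
  · by_cases h : y = x
    · simp [Store.setVar, h, hc]
    · simp [Store.setVar, h, hs.var_le]

lemma Rep.setArr {E : Env} {base : ℕ} {σ : Store} {s : State} (hs : Rep E base σ s)
    {q i j c : ℕ} (hc : c ≤ E.cap) :
    Rep E base (σ.setArr q i j c)
      ⟨s.reg, Function.update s.mem (base + pair (pair i j) q) c⟩ := by
  refine ⟨hs.var, hs.cap, hs.base_eq, fun x hx => ?_, fun q' i' j' => ?_, hs.var_le, fun x => ?_⟩
  · rw [← hs.inp_eq x hx]
    exact Function.update_of_ne (by omega) _ _
  · by_cases h : q' = q ∧ i' = i ∧ j' = j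
    · obtain ⟨rfl, rfl, rfl⟩ := h
      simp [Store.setArr]
    · simp only [Store.setArr, if_neg h]
      rw [← hs.arr]
      refine Function.update_of_ne (fun heq => h ?_) _ _
      have h1 := pair_inj (Nat.add_left_cancel heq)
      exact ⟨h1.2, pair_inj h1.1⟩
  · by_cases h : x = base + pair (pair i j) q
    · simp [h, hc]
    · simp only [Function.update_of_ne h]
      exact hs.mem_le x

/-- The program of `C` performs `C` within the time bound on words below `W`, without touching
earlier temporary values. -/
def Cmd.CompiledCorrectly (E : Env) (base W : ℕ) (C : Cmd) : Prop :=
  ∀ (t : ℕ) (σ : Store) (s : State), 3 ≤ t → Rep E base σ s →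
    ∃ k s', Exec W (C.compile t) s k s' ∧ k ≤ C.cost E.cap ∧ Rep E base (C.exec E σ) s' ∧
      ∀ i < t, s'.reg (tmp i) = s.reg (tmp i)

section CompiledCorrectly

variable {E : Env} {base X W : ℕ}

namespace Cmd

lemma compiledCorrectly_assign (hE : Fits E base X) (x : ℕ) (e : Expr)
    (hW : X ^ (assign x e).size ≤ W) :
    (assign x e).CompiledCorrectly E base W := by
  have hmono : ∀ {a b : ℕ}, X ^ b ≤ W → a ≤ b → X ^ a ≤ W := fun h hab =>
    (Nat.pow_le_pow_right (by have := hE.two_le; omega) hab).trans h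
  intro t σ s ht hs
  obtain ⟨s1, v1, f1⟩ := e.compile_cap_spec hE ht hs (hmono hW (by simp [size]))
  have hcap := hmono hW (a := 3) (by simp [size])
  refine ⟨_, _, exec_ofList (L := e.compile t ++ (capCode t ++ [.move (2 * x) (tmp t)])) ?_,
    ?_, ?_, ?_⟩
  · rw [← List.append_assoc, safe_append]
    refine ⟨s1, ?_, trivial⟩
    simp only [Instr.value, v1]
    exact ((min_le_right _ _).trans_lt hE.cap_lt).trans_le hcap
  · simp [cost, Expr.length_compile, capCode]
  · rw [← List.append_assoc, runList_append]
    simp only [runList, Instr.apply, Instr.value, v1]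
    exact (hs.frame f1 ht).setVar (min_le_right _ _)
  · intro i hi
    rw [← List.append_assoc, runList_append]
    simp only [runList, Instr.apply, Function.update_of_ne (tmp_ne_two_mul i x)]
    exact f1.tmp i hi

lemma compiledCorrectly_store (hE : Fits E base X) (q : ℕ) (i j e : Expr)
    (hW : X ^ (store q i j e).size ≤ W) :
    (store q i j e).CompiledCorrectly E base W := by
  have hX := hE.two_le
  have hmono : ∀ {a b : ℕ}, X ^ b ≤ W → a ≤ b → X ^ a ≤ W := fun h hab =>
    (Nat.pow_le_pow_right (by have := hE.two_le; omega) hab).trans h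
  intro t σ s ht hs
  obtain ⟨s1, v1, f1⟩ := e.compile_cap_spec hE ht hs (hmono hW (by simp only [size]; omega))
  set s₁ := runList (e.compile t ++ capCode t) s with hs₁
  have hs1 := hs.frame f1 ht
  obtain ⟨s2, v2, f2, b2⟩ := i.compile_spec hE (W := W) (t + 1) _ (by omega) hs1
    (hmono hW (by simp only [size]; omega))
  set s₂ := runList (i.compile (t + 1)) s₁ with hs₂
  have hs2 := hs1.frame f2 (by omega)
  obtain ⟨s3, v3, f3, b3⟩ := j.compile_spec hE (W := W) (t + 2) _ (by omega) hs2
    (hmono hW (by simp only [size]; omega))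
  set s₃ := runList (j.compile (t + 2)) s₂ with hs₃
  have hs3 := hs2.frame f3 (by omega)
  obtain ⟨s4, v4, f4⟩ := addrCode_spec (W := W) (q := q) (t := t + 1) hX (by omega) i.one_le_size
    j.one_le_size hE.base_lt hs3.base_eq ((f3.tmp (t + 1) (by omega)).trans v2) v3 b2 b3
    (hmono hW (by simp only [size]; omega))
  set s₄ := runList (addrCode (t + 1) q) s₃ with hs₄
  have hs4 := hs3.frame f4 (by omega)
  have hval : s₄.reg (tmp t) = min (e.eval E σ) E.cap := by
    rw [f4.tmp t (by omega), f3.tmp t (by omega), f2.tmp t (by omega), v1]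
  have hle : min (e.eval E σ) E.cap ≤ E.cap := min_le_right _ _
  have hlist : e.compile t ++ (capCode t ++ (i.compile (t + 1) ++
      (j.compile (t + 2) ++ (addrCode (t + 1) q ++ [.store (tmp (t + 3)) (tmp t)])))) =
      (e.compile t ++ capCode t) ++ (i.compile (t + 1) ++
      (j.compile (t + 2) ++ (addrCode (t + 1) q ++ [.store (tmp (t + 3)) (tmp t)]))) := by
    simp only [List.append_assoc]
  have hrun : runList (e.compile t ++ (capCode t ++ (i.compile (t + 1) ++
      (j.compile (t + 2) ++ (addrCode (t + 1) q ++ [.store (tmp (t + 3)) (tmp t)]))))) s =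
      ⟨s₄.reg, Function.update s₄.mem (base + pair (pair (i.eval E σ) (j.eval E σ)) q)
        (min (e.eval E σ) E.cap)⟩ := by
    rw [hlist, runList_append (e.compile t ++ capCode t), ← hs₁, runList_append, ← hs₂,
      runList_append, ← hs₃, runList_append, ← hs₄]
    simp only [runList, Instr.apply, Instr.value, hval]
    rw [show t + 3 = t + 1 + 2 from rfl, v4]
  refine ⟨_, _, exec_ofList (L := e.compile t ++ (capCode t ++ (i.compile (t + 1) ++
      (j.compile (t + 2) ++ (addrCode (t + 1) q ++ [.store (tmp (t + 3)) (tmp t)]))))) ?_, ?_, ?_,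
      ?_⟩
  · rw [hlist]
    refine safe_append.2 ⟨s1, safe_append.2 ⟨s2, safe_append.2 ⟨s3, safe_append.2
      ⟨s4, ?_, trivial⟩⟩⟩⟩
    change s₄.reg (tmp t) < W
    rw [hval]
    exact (hle.trans_lt hE.cap_lt).trans_le (hmono hW (by simp only [size]; omega))
  · simp [cost, Expr.length_compile, capCode, addrCode]
    omega
  · rw [hrun]
    exact hs4.setArr hle
  · intro k hk
    rw [hrun]
    change s₄.reg (tmp k) = s.reg (tmp k)
    rw [f4.tmp k (by omega), f3.tmp k (by omega), f2.tmp k (by omega), f1.tmp k hk]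

lemma compiledCorrectly_ite (hE : Fits E base X) (e : Expr) {C D : Cmd} (hW : X ^ (e.size + 1) ≤ W)
    (hC : C.CompiledCorrectly E base W) (hD : D.CompiledCorrectly E base W) :
    (ite e C D).CompiledCorrectly E base W := by
  have hX := hE.two_le
  have hmono : ∀ {a b : ℕ}, X ^ b ≤ W → a ≤ b → X ^ a ≤ W := fun h hab =>
    (Nat.pow_le_pow_right (by have := hE.two_le; omega) hab).trans h
  intro t σ s ht hs
  obtain ⟨s1, v1, f1, b1⟩ := e.compile_spec hE (W := W) t s ht hs
    (hmono hW (by omega))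
  have hf := f1.trans (frame_update (t := t) (c := 0) (i := t + 1) (by omega)) le_rfl
  have hs1 := hs.frame hf ht
  have hWpos : 0 < W := (pow_pos (by omega : 0 < X) _).trans_le hW
  have hex := exec_ofList (W := W) (L := e.compile t ++ [Instr.const (tmp (t + 1)) 0]) (s := s)
    (safe_append.2 ⟨s1, by simpa only [Instr.value] using hWpos, trivial⟩)
  rw [runList_append] at hex
  have hlen : (e.compile t ++ [Instr.const (tmp (t + 1)) 0]).length = e.len + 1 := by
    simp [Expr.length_compile]
  rw [hlen] at hex
  set s₁ : State := runList [Instr.const (tmp (t + 1)) 0] (runList (e.compile t) s) with hs₁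
  have hs1 : Rep E base σ s₁ := hs1
  have hf : Frame t s s₁ := hf
  have r1 : s₁.reg (tmp (t + 1)) = 0 := by simp [hs₁, runList, Instr.apply, Instr.value]
  have r0 : s₁.reg (tmp t) = e.eval E σ := by
    simp [hs₁, runList, Instr.apply, tmp_inj, v1]
  by_cases hpos : 0 < e.eval E σ
  · obtain ⟨k, s', h1, h2, h3, h4⟩ := hC t σ s₁ ht hs1
    refine ⟨_, s', .seq hex (.ite_true (by rw [r1, r0]; exact hpos) h1), ?_, ?_,
      fun i hi => (h4 i hi).trans (hf.tmp i hi)⟩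
    · simp only [cost]; omega
    · simpa only [exec, if_pos hpos] using h3
  · obtain ⟨k, s', h1, h2, h3, h4⟩ := hD t σ s₁ ht hs1
    refine ⟨_, s', .seq hex (.ite_false (by rw [r1, r0]; exact hpos) h1), ?_, ?_,
      fun i hi => (h4 i hi).trans (hf.tmp i hi)⟩
    · simp only [cost]; omega
    · simpa only [exec, if_neg hpos] using h3

lemma compiledCorrectly_loop (hE : Fits E base X) (x : ℕ) (e : Expr) {C : Cmd}
    (hW : X ^ (e.size + 3) ≤ W)
    (hC : C.CompiledCorrectly E base W) : (loop x e C).CompiledCorrectly E base W := by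
  have hX := hE.two_le
  have hmono : ∀ {a b : ℕ}, X ^ b ≤ W → a ≤ b → X ^ a ≤ W := fun h hab =>
    (Nat.pow_le_pow_right (by have := hE.two_le; omega) hab).trans h
  intro t σ s ht hs
  obtain ⟨s1, v1, f1⟩ := e.compile_cap_spec hE ht hs (hmono hW (by omega))
  have hf := f1.trans (frame_update (t := t) (c := 0) (i := t + 1) (by omega)) le_rfl
  have hs1 := hs.frame hf ht
  have hXW : X ≤ W := by simpa using hmono hW (a := 1) (by omega)
  have hcapW : E.cap < W := hE.cap_lt.trans_le (hmono hW (by omega))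
  have hex := exec_ofList (W := W)
    (L := (e.compile t ++ capCode t) ++ [Instr.const (tmp (t + 1)) 0]) (s := s)
    (safe_append.2 ⟨s1, by simp only [Instr.value]; omega, trivial⟩)
  rw [runList_append, List.append_assoc] at hex
  have hlen : (e.compile t ++ (capCode t ++ [Instr.const (tmp (t + 1)) 0])).length = e.len + 3 := by
    simp [Expr.length_compile, capCode]
  rw [hlen] at hex
  set s₁ : State := runList [Instr.const (tmp (t + 1)) 0] (runList (e.compile t ++ capCode t) s)
    with hs₁
  have hs1 : Rep E base σ s₁ := hs1
  have hf : Frame t s s₁ := hf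
  set cnt := min (e.eval E σ) E.cap with hcnt
  have r1 : s₁.reg (tmp (t + 1)) = 0 := by simp [hs₁, runList, Instr.apply, Instr.value]
  have r0 : s₁.reg (tmp t) = cnt := by
    simp [hs₁, runList, Instr.apply, tmp_inj, v1]
  have hcntle : cnt ≤ E.cap := min_le_right _ _
  have hloop : ∀ (d i : ℕ) (s₀ : State), i + d = cnt → s₀.reg (tmp (t + 1)) = i →
      s₀.reg (tmp t) = cnt →
      Rep E base (iter (fun i τ => C.exec E (τ.setVar x i)) σ i) s₀ →
      ∃ k s', Exec W (.loop (tmp (t + 1)) (tmp t) (.seq (.ofList [.move (2 * x) (tmp (t + 1))])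
        (.seq (C.compile (t + 2)) (.ofList [.const (tmp (t + 2)) 1,
          .add (tmp (t + 1)) (tmp (t + 1)) (tmp (t + 2))])))) s₀ k s' ∧
        k ≤ d * (C.cost E.cap + 6) + 1 ∧
        Rep E base (iter (fun i τ => C.exec E (τ.setVar x i)) σ cnt) s' ∧
        ∀ i < t, s'.reg (tmp i) = s₀.reg (tmp i) := by
    intro d
    induction d with
    | zero =>
      intro i s₀ hi hr1 hr0 hrep
      obtain rfl : i = cnt := hi
      exact ⟨1, s₀, .loop_false (by omega), by omega, hrep, fun _ _ => rfl⟩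
    | succ d ih =>
      intro i s₀ hi hr1 hr0 hrep
      have e1 := exec_ofList (W := W) (L := [.move (2 * x) (tmp (t + 1))]) (s := s₀)
        ⟨by simp only [Instr.value]; omega, trivial⟩
      have hrep1 : Rep E base ((iter (fun i τ => C.exec E (τ.setVar x i)) σ i).setVar x i)
          (runList [.move (2 * x) (tmp (t + 1))] s₀) := by
        simp only [runList, Instr.apply, Instr.value, hr1]
        exact hrep.setVar (by omega)
      have htmp1 : ∀ k, (runList [.move (2 * x) (tmp (t + 1))] s₀).reg (tmp k) =
          s₀.reg (tmp k) := fun k => Function.update_of_ne (tmp_ne_two_mul k x) _ _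
      obtain ⟨k, s', h1, h2, h3, h4⟩ := hC (t + 2) _ _ (by omega) hrep1
      have hr1' : s'.reg (tmp (t + 1)) = i := by
        rw [h4 _ (by omega), htmp1, hr1]
      have hr0' : s'.reg (tmp t) = cnt := by
        rw [h4 _ (by omega), htmp1, hr0]
      have e3 := exec_ofList (W := W) (L := [.const (tmp (t + 2)) 1,
          .add (tmp (t + 1)) (tmp (t + 1)) (tmp (t + 2))]) (s := s') (by
        simp [Safe, Instr.value, Instr.apply, tmp_inj, hr1']
        omega)
      set s'' := runList [.const (tmp (t + 2)) 1,
          .add (tmp (t + 1)) (tmp (t + 1)) (tmp (t + 2))] s' with hs''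
      have hfr : Frame (t + 1) s' s'' :=
        (frame_update (i := t + 2) (by omega)).trans (frame_update (i := t + 1) le_rfl) le_rfl
      obtain ⟨k', s₃, h1', h2', h3', h4'⟩ := ih (i + 1) s'' (by omega)
        (by simp [hs'', runList, Instr.value, Instr.apply, tmp_inj, hr1'])
        (by rw [hfr.tmp t (by omega), hr0']) (h3.frame hfr (by omega))
      refine ⟨_, s₃, .loop_true (by omega) (.seq e1 (.seq h1 e3)) h1', ?_, h3', fun j hj => ?_⟩
      · simp only [List.length_cons, List.length_nil]
        rw [add_mul]
        omega
      · rw [h4' j hj, hfr.tmp j (by omega), h4 j (by omega), htmp1]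
  obtain ⟨k, s', h1, h2, h3, h4⟩ := hloop cnt 0 s₁ (by omega) r1 r0 hs1
  refine ⟨_, s', .seq hex h1, ?_, h3, fun i hi => (h4 i hi).trans (hf.tmp i hi)⟩
  have := Nat.mul_le_mul_right (C.cost E.cap + 6) hcntle
  simp only [cost]
  omega

/-- The correctness of the compilation, on words that are polynomially large. -/
theorem compiledCorrectly (hE : Fits E base X) (C : Cmd) (hW : X ^ C.size ≤ W) :
    C.CompiledCorrectly E base W := by
  have hX := hE.two_le
  have hmono : ∀ {a b : ℕ}, X ^ b ≤ W → a ≤ b → X ^ a ≤ W := fun h hab =>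
    (Nat.pow_le_pow_right (by have := hE.two_le; omega) hab).trans h
  induction C with
  | skip =>
    exact fun t σ s _ hs => ⟨1, s, exec_ofList (L := []) trivial, le_rfl, hs, fun _ _ => rfl⟩
  | assign x e => exact compiledCorrectly_assign hE x e hW
  | store q i j e => exact compiledCorrectly_store hE q i j e hW
  | seq C D hC hD =>
    intro t σ s ht hs
    obtain ⟨k, s', h1, h2, h3, h4⟩ := hC (hmono hW (by simp [size])) t σ s ht hs
    obtain ⟨k', s'', h1', h2', h3', h4'⟩ := hD (hmono hW (by simp [size])) t _ s' ht h3
    exact ⟨k + k', s'', .seq h1 h1', Nat.add_le_add h2 h2', h3',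
      fun i hi => (h4' i hi).trans (h4 i hi)⟩
  | ite e C D hC hD =>
    exact compiledCorrectly_ite hE e (hmono hW (by simp only [size]; omega))
      (hC (hmono hW (by simp only [size]; omega))) (hD (hmono hW (by simp only [size]; omega)))
  | loop x e C hC =>
    exact compiledCorrectly_loop hE x e (hmono hW (by simp only [size]; omega))
      (hC (hmono hW (by simp only [size]; omega)))

end Cmd

end CompiledCorrectly


/-! ### Reasoning about commands -/

section Commands

instance : Add Expr := ⟨Expr.add⟩
instance : Sub Expr := ⟨Expr.sub⟩
instance : Mul Expr := ⟨Expr.mul⟩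
instance (c : ℕ) : OfNat Expr c := ⟨Expr.const c⟩

variable {E : Env} {σ : Store}

@[simp] lemma Expr.eval_var (x : ℕ) : (Expr.var x).eval E σ = σ.v x := rfl

@[simp] lemma Expr.eval_cap : Expr.cap.eval E σ = E.cap := rfl

@[simp] lemma Expr.eval_inp (e : Expr) : (Expr.inp e).eval E σ = E.inp (e.eval E σ) := rfl

@[simp] lemma Expr.eval_arr (q : ℕ) (i j : Expr) :
    (Expr.arr q i j).eval E σ = σ.a q (i.eval E σ) (j.eval E σ) := rfl

@[simp] lemma Expr.eval_ofNat (c : ℕ) :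
    (no_index (OfNat.ofNat c : Expr)).eval E σ = c := rfl

@[simp] lemma Expr.eval_add (e₁ e₂ : Expr) :
    (e₁ + e₂).eval E σ = e₁.eval E σ + e₂.eval E σ := rfl

@[simp] lemma Expr.eval_sub (e₁ e₂ : Expr) :
    (e₁ - e₂).eval E σ = e₁.eval E σ - e₂.eval E σ := rfl

@[simp] lemma Expr.eval_mul (e₁ e₂ : Expr) :
    (e₁ * e₂).eval E σ = e₁.eval E σ * e₂.eval E σ := rfl

@[simp] lemma Store.setVar_v (x c y : ℕ) :
    (σ.setVar x c).v y = if y = x then c else σ.v y := by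
  simp [Store.setVar, Function.update_apply]

@[simp] lemma Store.setVar_a (x c : ℕ) : (σ.setVar x c).a = σ.a := rfl

@[simp] lemma Store.setArr_v (q i j c : ℕ) : (σ.setArr q i j c).v = σ.v := rfl

lemma Store.setArr_a (q i j c q' i' j' : ℕ) : (σ.setArr q i j c).a q' i' j' =
    if q' = q ∧ i' = i ∧ j' = j then c else σ.a q' i' j' := rfl

/-- Sequential composition of a list of commands. -/
def Cmd.block : List Cmd → Cmd
  | [] => .skip
  | C :: L => .seq C (block L)

@[simp] lemma Cmd.exec_block_nil : (Cmd.block []).exec E σ = σ := rfl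

@[simp] lemma Cmd.exec_block_cons (C : Cmd) (L : List Cmd) :
    (Cmd.block (C :: L)).exec E σ = (Cmd.block L).exec E (C.exec E σ) := rfl

@[simp] lemma Cmd.exec_assign (x : ℕ) (e : Expr) :
    (Cmd.assign x e).exec E σ = σ.setVar x (min (e.eval E σ) E.cap) := rfl

@[simp] lemma Cmd.exec_store (q : ℕ) (i j e : Expr) : (Cmd.store q i j e).exec E σ =
    σ.setArr q (i.eval E σ) (j.eval E σ) (min (e.eval E σ) E.cap) := rfl

@[simp] lemma Cmd.exec_skip : Cmd.skip.exec E σ = σ := rfl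

lemma Cmd.exec_ite (e : Expr) (C D : Cmd) : (Cmd.ite e C D).exec E σ =
    if 0 < e.eval E σ then C.exec E σ else D.exec E σ := rfl

/-- The command may change the variable `x`. -/
def Cmd.writesVar (x : ℕ) : Cmd → Bool
  | .skip | .store _ _ _ _ => false
  | .assign y _ => y == x
  | .seq C D | .ite _ C D => C.writesVar x || D.writesVar x
  | .loop y _ C => y == x || C.writesVar x

/-- The command may change the array `q`. -/
def Cmd.writesArr (q : ℕ) : Cmd → Bool
  | .skip | .assign _ _ => false
  | .store q' _ _ _ => q' == q
  | .seq C D | .ite _ C D => C.writesArr q || D.writesArr q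
  | .loop _ _ C => C.writesArr q

lemma iter_induct {f : ℕ → Store → Store} {P : ℕ → Store → Prop} {n : ℕ} (h0 : P 0 σ)
    (hs : ∀ i < n, ∀ τ, P i τ → P (i + 1) (f i τ)) : P n (iter f σ n) := by
  suffices ∀ i ≤ n, P i (iter f σ i) from this n le_rfl
  intro i hi
  induction i with
  | zero => exact h0
  | succ i ih => exact hs i hi _ (ih (by omega))

lemma Cmd.exec_v {C : Cmd} {x : ℕ} (h : C.writesVar x = false) : (C.exec E σ).v x = σ.v x := by
  induction C generalizing σ with
  | skip => rfl
  | assign y e =>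
    simp only [writesVar, beq_eq_false_iff_ne] at h
    simp [h.symm]
  | store q i j e => rfl
  | seq C D hC hD =>
    simp only [writesVar, Bool.or_eq_false_iff] at h
    exact (hD h.2).trans (hC h.1)
  | ite e C D hC hD =>
    simp only [writesVar, Bool.or_eq_false_iff] at h
    rw [exec_ite]
    split_ifs
    exacts [hC h.1, hD h.2]
  | loop y e C hC =>
    simp only [writesVar, Bool.or_eq_false_iff, beq_eq_false_iff_ne] at h
    refine iter_induct (P := fun _ τ => τ.v x = σ.v x) rfl fun i _ τ hτ => ?_
    rw [hC h.2, Store.setVar_v, if_neg h.1.symm, hτ]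

lemma Cmd.exec_a {C : Cmd} {q : ℕ} (h : C.writesArr q = false) : (C.exec E σ).a q = σ.a q := by
  induction C generalizing σ with
  | skip => rfl
  | assign y e => rfl
  | store q' i j e =>
    simp only [writesArr, beq_eq_false_iff_ne] at h
    funext i' j'
    simp [Store.setArr_a, h.symm]
  | seq C D hC hD =>
    simp only [writesArr, Bool.or_eq_false_iff] at h
    exact (hD h.2).trans (hC h.1)
  | ite e C D hC hD =>
    simp only [writesArr, Bool.or_eq_false_iff] at h
    rw [exec_ite]
    split_ifs
    exacts [hC h.1, hD h.2]
  | loop y e C hC =>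
    refine iter_induct (P := fun _ τ => τ.a q = σ.a q) rfl fun i _ τ hτ => ?_
    rw [hC h, Store.setVar_a, hτ]

/-- The invariant rule for loops. What the loop does not write need not be mentioned in the
invariant. -/
lemma Cmd.exec_loop {x n : ℕ} {e : Expr} {C : Cmd} {P : ℕ → Store → Prop}
    (hn : min (e.eval E σ) E.cap = n) (h0 : P 0 σ)
    (hs : ∀ i < n, ∀ τ : Store, (∀ y, (Cmd.loop x e C).writesVar y = false → τ.v y = σ.v y) →
      (∀ q, C.writesArr q = false → τ.a q = σ.a q) → P i τ → P (i + 1) (C.exec E (τ.setVar x i))) :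
    P n ((Cmd.loop x e C).exec E σ) := by
  have := iter_induct (f := fun i τ => C.exec E (τ.setVar x i)) (n := n) (σ := σ)
    (P := fun i τ => (∀ y, (Cmd.loop x e C).writesVar y = false → τ.v y = σ.v y) ∧
      (∀ q, C.writesArr q = false → τ.a q = σ.a q) ∧ P i τ)
    ⟨fun _ _ => rfl, fun _ _ => rfl, h0⟩ fun i hi τ hτ => ⟨fun y hy => ?_, fun q hq => ?_,
      hs i hi τ hτ.1 hτ.2.1 hτ.2.2⟩
  · rw [← hn] at this ⊢
    exact this.2.2
  · rw [← hτ.1 y hy]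
    simp only [writesVar, Bool.or_eq_false_iff, beq_eq_false_iff_ne] at hy
    rw [Cmd.exec_v hy.2, Store.setVar_v, if_neg hy.1.symm]
  · rw [Cmd.exec_a hq, Store.setVar_a, hτ.2.1 q hq]

/-- The number `x` is the minimum of `B` and the numbers with the property `P`. -/
structure CapMin (B : ℕ) (P : ℕ → Prop) (x : ℕ) : Prop where
  le : x ≤ B
  prop : x < B → P x
  min : ∀ y, P y → x ≤ y

lemma CapMin.congr {B x : ℕ} {P Q : ℕ → Prop} (h : CapMin B P x) (hPQ : ∀ y, P y ↔ Q y) :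
    CapMin B Q x :=
  ⟨h.le, fun hx => (hPQ x).1 (h.prop hx), fun y hy => h.min y ((hPQ y).2 hy)⟩

lemma CapMin.of_false {B : ℕ} {P : ℕ → Prop} (h : ∀ y, ¬ P y) : CapMin B P B :=
  ⟨le_rfl, fun hx => absurd hx (lt_irrefl B), fun y hy => absurd hy (h y)⟩

/-- The expression for the minimum. -/
def Expr.min (e₁ e₂ : Expr) : Expr := e₁ - (e₁ - e₂)

@[simp] lemma Expr.eval_min (e₁ e₂ : Expr) :
    (Expr.min e₁ e₂).eval E σ = Min.min (e₁.eval E σ) (e₂.eval E σ) := by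
  simp only [Expr.min, Expr.eval_sub]
  omega

/-- A loop that replaces the variable `b` by the minimum of its value and of the values of `e'`
over all rounds in which `c` is positive. -/
def Cmd.minLoop (x b : ℕ) (e c e' : Expr) : Cmd :=
  .loop x e (.ite c (.assign b (Expr.min (.var b) e')) .skip)

lemma Cmd.exec_minLoop {x b n : ℕ} {e c e' : Expr} (hxb : x ≠ b) {Q : ℕ → Prop} {g : ℕ → ℕ}
    {P : ℕ → Prop} (hn : Min.min (e.eval E σ) E.cap = n)
    (h : ∀ i < n, ∀ τ : Store, (∀ y, y ≠ x → y ≠ b → τ.v y = σ.v y) → τ.a = σ.a → τ.v x = i →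
      (0 < c.eval E τ ↔ P i) ∧ e'.eval E τ = g i)
    (h0 : CapMin E.cap Q (σ.v b)) :
    CapMin E.cap (fun y => Q y ∨ ∃ i < n, P i ∧ y = g i)
      (((minLoop x b e c e').exec E σ).v b) := by
  refine Cmd.exec_loop (P := fun i τ => CapMin E.cap (fun y => Q y ∨ ∃ k < i, P k ∧ y = g k)
    (τ.v b)) hn (h0.congr fun y => by simp) ?_
  intro i hi τ hv ha hcap
  obtain ⟨hc, he⟩ := h i hi (τ.setVar x i)
    (fun y h1 h2 => by
      rw [Store.setVar_v, if_neg h1]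
      exact hv y (by simp [writesVar, Ne.symm h1, Ne.symm h2]))
    (funext fun q => ha q rfl) (by simp)
  rw [exec_ite]
  by_cases hP : P i
  · rw [if_pos (hc.2 hP), exec_assign, Expr.eval_min, he]
    have hvb : (τ.setVar x i).v b = τ.v b := by simp [hxb.symm]
    simp only [Expr.eval_var, hvb, Store.setVar_v, if_true]
    have hle := hcap.le
    refine ⟨min_le_right _ _, fun hx => ?_, fun y hy => ?_⟩
    · rw [min_eq_left (by omega)] at hx ⊢
      rcases le_total (τ.v b) (g i) with hle' | hle'
      · rw [min_eq_left hle'] at hx ⊢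
        exact (hcap.prop hx).imp_right fun ⟨k, hk, h⟩ => ⟨k, by omega, h⟩
      · rw [min_eq_right hle'] at hx ⊢
        exact .inr ⟨i, by omega, hP, rfl⟩
    · have : τ.v b ≤ y ∨ g i ≤ y := by
        rcases hy with hy | ⟨k, hk, hPk, rfl⟩
        · exact .inl (hcap.min y (.inl hy))
        · rcases Nat.lt_succ_iff_lt_or_eq.1 hk with hk | rfl
          · exact .inl (hcap.min _ (.inr ⟨k, hk, hPk, rfl⟩))
          · exact .inr le_rfl
      omega
  · rw [if_neg (fun h => hP (hc.1 h)), exec_skip, Store.setVar_v, if_neg hxb.symm]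
    refine hcap.congr fun y => or_congr_right ⟨fun ⟨k, hk, h⟩ => ⟨k, by omega, h⟩, ?_⟩
    rintro ⟨k, hk, hPk, h⟩
    rcases Nat.lt_succ_iff_lt_or_eq.1 hk with hk | rfl
    exacts [⟨k, hk, hPk, h⟩, absurd hPk hP]

end Commands

/-! ### The search order -/

section Search

/-- Chooses an unvisited vertex (variable `3`), if possible a marked one. Array `1` holds the marks
and array `2` holds the visited vertices. -/
def selectCmd : Cmd :=
  .loop 5 (.var 0) (.ite (1 + .arr 1 (.var 5) 0 - 2 * .arr 2 (.var 5) 0 - .var 4)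
    (.block [.assign 4 (1 + .arr 1 (.var 5) 0 - 2 * .arr 2 (.var 5) 0), .assign 3 (.var 5)]) .skip)

/-- Marks the neighbours of the chosen vertex. -/
def markCmd : Cmd :=
  .loop 5 (.var 0) (.ite (.inp (.var 3 * .var 0 + .var 5)) (.store 1 (.var 5) 0 1) .skip)

/-- Computes a search order of the input graph in array `0`. -/
def searchCmd : Cmd :=
  .loop 2 (.var 0) (.block [.assign 3 0, .assign 4 0, selectCmd, .store 0 (.var 2) 0 (.var 3),
    .store 2 (.var 3) 0 1, markCmd])

variable {E : Env} {σ : Store} {n : ℕ}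

lemma exec_selectCmd (hn : σ.v 0 = n) (hcap : n + 2 ≤ E.cap) (h4 : σ.v 4 = 0)
    (h1 : ∀ u < n, σ.a 1 u 0 ≤ 1) {τ : Store} (hτ : τ = selectCmd.exec E σ) :
    (∀ u < n, 1 + σ.a 1 u 0 - 2 * σ.a 2 u 0 ≤ τ.v 4) ∧
      (0 < τ.v 4 → τ.v 3 < n ∧ 1 + σ.a 1 (τ.v 3) 0 - 2 * σ.a 2 (τ.v 3) 0 = τ.v 4) := by
  subst hτ
  refine Cmd.exec_loop (n := n) (P := fun i τ =>
    (∀ u < i, 1 + σ.a 1 u 0 - 2 * σ.a 2 u 0 ≤ τ.v 4) ∧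
      (0 < τ.v 4 → τ.v 3 < i ∧ 1 + σ.a 1 (τ.v 3) 0 - 2 * σ.a 2 (τ.v 3) 0 = τ.v 4))
    (by simp [hn]; omega) ⟨by simp, by omega⟩ ?_
  intro i hi τ hv ha ⟨hle, hbest⟩
  have ha1 : τ.a 1 = σ.a 1 := ha 1 rfl
  have ha2 : τ.a 2 = σ.a 2 := ha 2 rfl
  have hi1 := h1 i hi
  rw [Cmd.exec_ite]
  simp only [Expr.eval_sub, Expr.eval_add, Expr.eval_mul, Expr.eval_ofNat, Expr.eval_arr,
    Expr.eval_var, Store.setVar_v, Store.setVar_a, ha1, ha2, if_true]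
  have h45 : (4 : ℕ) ≠ 5 := by omega
  rw [if_neg h45]
  have hm : min (1 + σ.a 1 i 0 - 2 * σ.a 2 i 0) E.cap = 1 + σ.a 1 i 0 - 2 * σ.a 2 i 0 :=
    min_eq_left (by omega)
  have hm' : min i E.cap = i := min_eq_left (by omega)
  by_cases hlt : 0 < 1 + σ.a 1 i 0 - 2 * σ.a 2 i 0 - τ.v 4
  · rw [if_pos hlt]
    simp only [Cmd.exec_block_cons, Cmd.exec_block_nil, Cmd.exec_assign, Expr.eval_sub,
      Expr.eval_add, Expr.eval_mul, Expr.eval_ofNat, Expr.eval_arr, Expr.eval_var, Store.setVar_v,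
      Store.setVar_a, ha1, ha2, hm, reduceIte, Nat.reduceEqDiff, hm']
    refine ⟨fun u hu => ?_, fun _ => ⟨by omega, trivial⟩⟩
    rcases Nat.lt_succ_iff_lt_or_eq.1 hu with hu | rfl
    · have := hle u hu
      omega
    · exact le_rfl
  · rw [if_neg hlt]
    simp only [Cmd.exec_skip, Store.setVar_v, reduceIte, Nat.reduceEqDiff]
    refine ⟨fun u hu => ?_, fun h => ⟨(hbest h).1.trans (by omega), (hbest h).2⟩⟩
    rcases Nat.lt_succ_iff_lt_or_eq.1 hu with hu | rfl
    · exact hle u hu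
    · omega

lemma exec_markCmd (hn : σ.v 0 = n) (hcap : n + 2 ≤ E.cap) {τ : Store}
    (hτ : τ = markCmd.exec E σ) :
    ∀ u < n, τ.a 1 u 0 = if 0 < E.inp (σ.v 3 * n + u) then 1 else σ.a 1 u 0 := by
  subst hτ
  suffices ∀ u, (markCmd.exec E σ).a 1 u 0 =
      if u < n ∧ 0 < E.inp (σ.v 3 * n + u) then 1 else σ.a 1 u 0 by
    intro u hu
    rw [this u]
    simp [hu]
  refine Cmd.exec_loop (n := n) (P := fun i τ => ∀ u, τ.a 1 u 0 =
      if u < i ∧ 0 < E.inp (σ.v 3 * n + u) then 1 else σ.a 1 u 0)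
    (by simp [hn]; omega) (by simp) ?_
  intro i hi τ hv ha hP u
  have hv3 : τ.v 3 = σ.v 3 := hv 3 rfl
  have hv0 : τ.v 0 = n := (hv 0 rfl).trans hn
  rw [Cmd.exec_ite]
  simp only [Expr.eval_inp, Expr.eval_add, Expr.eval_mul, Expr.eval_var, Store.setVar_v, hv3, hv0]
  have hcap1 : min 1 E.cap = 1 := min_eq_left (by omega)
  by_cases hui : u = i
  · subst hui
    have := hP u
    by_cases hadj : 0 < E.inp (σ.v 3 * n + u) <;> simp [hadj, Store.setArr_a, hcap1, this]
  · have h1 : u < i + 1 ↔ u < i := by omega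
    by_cases hadj : 0 < E.inp (σ.v 3 * n + i) <;> simp [hadj, Store.setArr_a, hui, hP u, h1]

/-- What the search achieves. Vertices `u` and `v` are adjacent if `E.inp (u * n + v)` is
positive. -/
lemma exec_searchCmd (hn : σ.v 0 = n) (hcap : n + 2 ≤ E.cap) (h1 : ∀ u, σ.a 1 u 0 = 0)
    (h2 : ∀ u, σ.a 2 u 0 = 0) {τ : Store} (hτ : τ = searchCmd.exec E σ) :
    (∀ i < n, τ.a 0 i 0 < n) ∧ (∀ i < n, ∀ j < n, τ.a 0 i 0 = τ.a 0 j 0 → i = j) ∧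
      ∀ i < n, (∃ j < i, 0 < E.inp (τ.a 0 j 0 * n + τ.a 0 i 0)) ∨
        ∀ j < i, ∀ u < n, 0 < E.inp (τ.a 0 j 0 * n + u) → ∃ k < i, τ.a 0 k 0 = u := by
  subst hτ
  have key := Cmd.exec_loop (E := E) (σ := σ) (x := 2) (e := .var 0) (n := n)
    (C := .block [.assign 3 0, .assign 4 0, selectCmd, .store 0 (.var 2) 0 (.var 3),
      .store 2 (.var 3) 0 1, markCmd])
    (P := fun t τ => ((∀ i < t, τ.a 0 i 0 < n) ∧
      (∀ i < t, ∀ j < t, τ.a 0 i 0 = τ.a 0 j 0 → i = j) ∧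
      ∀ i < t, (∃ j < i, 0 < E.inp (τ.a 0 j 0 * n + τ.a 0 i 0)) ∨
        ∀ j < i, ∀ u < n, 0 < E.inp (τ.a 0 j 0 * n + u) → ∃ k < i, τ.a 0 k 0 = u) ∧
      (∀ u, τ.a 2 u 0 = if ∃ i < t, τ.a 0 i 0 = u then 1 else 0) ∧
      (∀ u < n, τ.a 1 u 0 = if ∃ i < t, 0 < E.inp (τ.a 0 i 0 * n + u) then 1 else 0))
    (by simp [hn]; omega) (by simp [h1, h2]) ?_
  · exact key.1
  intro t ht τ hv ha ⟨⟨hlt, hinj, hsearch⟩, hvis, hmark⟩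
  have hv0 : τ.v 0 = n := (hv 0 rfl).trans hn
  -- The stores before and after the choice of a vertex.
  set τ₁ := ((τ.setVar 2 t).setVar 3 (min 0 E.cap)).setVar 4 (min 0 E.cap) with hτ₁
  set τ₂ := selectCmd.exec E τ₁ with hτ₂
  have h20 : τ₂.v 0 = n := (Cmd.exec_v (x := 0) rfl).trans (by simp [hτ₁, hv0])
  have h22 : τ₂.v 2 = t := (Cmd.exec_v (x := 2) rfl).trans (by simp [hτ₁])
  have h2a : τ₂.a = τ.a := funext fun q => Cmd.exec_a (C := selectCmd) (E := E) (σ := τ₁) rfl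
  obtain ⟨hmax, hbest⟩ := exec_selectCmd (E := E) (σ := τ₁) (n := n) (by simp [hτ₁, hv0]) hcap
    (by simp [hτ₁]) (fun u hu => by
      change τ.a 1 u 0 ≤ 1
      rw [hmark u hu]
      split_ifs <;> omega) hτ₂
  have ha₁ : τ₁.a = τ.a := rfl
  rw [ha₁] at hmax hbest
  have hfree : ∃ u < n, ∀ i < t, τ.a 0 i 0 ≠ u := by
    by_contra hcon
    push Not at hcon
    have hcard := Finset.card_le_card_of_surjOn (s := Finset.range t) (t := Finset.range n)
      (fun i => τ.a 0 i 0) (fun u hu => by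
        obtain ⟨i, hi, hiu⟩ := hcon u (by simpa using hu)
        exact ⟨i, by simpa using hi, hiu⟩)
    simp only [Finset.card_range] at hcard
    omega
  obtain ⟨u₀, hu₀, hu₀'⟩ := hfree
  have hvis0 : τ.a 2 u₀ 0 = 0 := by
    rw [hvis, if_neg]
    rintro ⟨i, hi, h⟩
    exact hu₀' i hi h
  have hpos : 0 < τ₂.v 4 := by
    have := hmax u₀ hu₀
    omega
  obtain ⟨hbn, hbkey⟩ := hbest hpos
  set b := τ₂.v 3 with hb
  have hbnew : ∀ i < t, τ.a 0 i 0 ≠ b := by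
    intro i hi h
    have h5 := hvis b
    rw [if_pos ⟨i, hi, h⟩] at h5
    have h6 := hmark b hbn
    have h7 : τ.a 1 b 0 ≤ 1 := by rw [h6]; split_ifs <;> omega
    omega
  have hbprop : (∃ j < t, 0 < E.inp (τ.a 0 j 0 * n + b)) ∨
      ∀ j < t, ∀ u < n, 0 < E.inp (τ.a 0 j 0 * n + u) → ∃ k < t, τ.a 0 k 0 = u := by
    by_contra hcon
    push Not at hcon
    obtain ⟨h3, j, hj, u, hu, hju, hku⟩ := hcon
    have h4 := hmax u hu
    have h5 := hvis u
    rw [if_neg (by rintro ⟨k, hk, h⟩; exact hku k hk h)] at h5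
    have h6 := hmark u hu
    rw [if_pos ⟨j, hj, hju⟩] at h6
    have h7 := hmark b hbn
    rw [if_neg (by rintro ⟨k, hk, h⟩; have := h3 k hk; omega)] at h7
    omega
  -- The store before marking.
  have hcap1 : min 1 E.cap = 1 := min_eq_left (by omega)
  set τ₃ := (τ₂.setArr 0 t 0 b).setArr 2 b 0 1 with hτ₃
  have hexec : (Cmd.block [.assign 3 0, .assign 4 0, selectCmd, .store 0 (.var 2) 0 (.var 3),
      .store 2 (.var 3) 0 1, markCmd]).exec E (τ.setVar 2 t) = markCmd.exec E τ₃ := by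
    have hbcap : min b E.cap = b := min_eq_left (by omega)
    simp only [Cmd.exec_block_cons, Cmd.exec_block_nil, Cmd.exec_assign, Expr.eval_ofNat, ← hτ₁,
      ← hτ₂, Cmd.exec_store, Expr.eval_var, h22, ← hb, hbcap, Store.setArr_v, hcap1, ← hτ₃]
  rw [hexec]
  have hord : ∀ i, (markCmd.exec E τ₃).a 0 i 0 = if i = t then b else τ.a 0 i 0 := by
    intro i
    rw [Cmd.exec_a (q := 0) rfl]
    simp [hτ₃, Store.setArr_a, h2a]
  have hord' : ∀ i < t, (markCmd.exec E τ₃).a 0 i 0 = τ.a 0 i 0 := fun i hi => by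
    rw [hord, if_neg (by omega)]
  have hordt : (markCmd.exec E τ₃).a 0 t 0 = b := by rw [hord, if_pos rfl]
  have hvis' : ∀ u, (markCmd.exec E τ₃).a 2 u 0 = if u = b then 1 else τ.a 2 u 0 := by
    intro u
    rw [Cmd.exec_a (q := 2) rfl]
    simp [hτ₃, Store.setArr_a, h2a]
  have hmark' := exec_markCmd (E := E) (σ := τ₃) (n := n) h20 hcap rfl
  have hτ₃1 : ∀ u, τ₃.a 1 u 0 = τ.a 1 u 0 := fun u => by simp [hτ₃, Store.setArr_a, h2a]
  have hτ₃3 : τ₃.v 3 = b := rfl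
  simp only [hτ₃1, hτ₃3] at hmark'
  have hex : ∀ p : ℕ → Prop, (∃ i < t + 1, p ((markCmd.exec E τ₃).a 0 i 0)) ↔
      p b ∨ ∃ i < t, p (τ.a 0 i 0) := by
    intro p
    constructor
    · rintro ⟨i, hi, h⟩
      rcases Nat.lt_succ_iff_lt_or_eq.1 hi with hi | rfl
      · exact .inr ⟨i, hi, by rwa [hord' i hi] at h⟩
      · exact .inl (by rwa [hordt] at h)
    · rintro (h | ⟨i, hi, h⟩)
      · exact ⟨t, by omega, by rwa [hordt]⟩
      · exact ⟨i, by omega, by rwa [hord' i hi]⟩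
  refine ⟨⟨fun i hi => ?_, fun i hi j hj hij => ?_, fun i hi => ?_⟩, fun u => ?_, fun u hu => ?_⟩
  · rcases Nat.lt_succ_iff_lt_or_eq.1 hi with hi | rfl
    · rw [hord' i hi]; exact hlt i hi
    · rwa [hordt]
  · rcases Nat.lt_succ_iff_lt_or_eq.1 hi with hi | rfl <;>
      rcases Nat.lt_succ_iff_lt_or_eq.1 hj with hj | rfl
    · rw [hord' i hi, hord' j hj] at hij
      exact hinj i hi j hj hij
    · rw [hord' i hi, hordt] at hij
      exact absurd hij (hbnew i hi)
    · rw [hord' j hj, hordt] at hij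
      exact absurd hij.symm (hbnew j hj)
    · rfl
  · have hrest : ∀ i ≤ t, ∀ j < i, (markCmd.exec E τ₃).a 0 j 0 = τ.a 0 j 0 :=
      fun i hi j hj => hord' j (by omega)
    rcases Nat.lt_succ_iff_lt_or_eq.1 hi with hi | rfl
    · rcases hsearch i hi with ⟨j, hj, h⟩ | h
      · exact .inl ⟨j, hj, by rwa [hord' i hi, hrest i (by omega) j hj]⟩
      · refine .inr fun j hj u hu hju => ?_
        rw [hrest i (by omega) j hj] at hju
        obtain ⟨k, hk, hku⟩ := h j hj u hu hju
        exact ⟨k, hk, by rwa [hrest i (by omega) k hk]⟩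
    · rw [hordt]
      rcases hbprop with ⟨j, hj, h⟩ | h
      · exact .inl ⟨j, hj, by rwa [hord' j hj]⟩
      · refine .inr fun j hj u hu hju => ?_
        rw [hord' j hj] at hju
        obtain ⟨k, hk, hku⟩ := h j hj u hu hju
        exact ⟨k, hk, by rwa [hord' k hk]⟩
  · rw [hvis', hvis]
    simp only [hex (fun w => w = u), eq_comm (a := u)]
    by_cases h1 : b = u <;> simp [h1]
  · rw [hmark' u hu, hmark u hu]
    simp only [hex (fun w => 0 < E.inp (w * n + u))]
    by_cases h1 : 0 < E.inp (b * n + u) <;> simp [h1]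

end Search


/-! ### Minimisation over a block -/

section Block

lemma CapMin.add {B n x : ℕ} {P : ℕ → Prop} {R : ℕ → ℕ → Prop} {d g : ℕ → ℕ}
    (h : CapMin B (fun y => ∃ i < n, P i ∧ y = d i + g i) x)
    (hd : ∀ i < n, P i → CapMin B (R i) (d i)) :
    CapMin B (fun y => ∃ i < n, P i ∧ ∃ z, R i z ∧ y = z + g i) x := by
  refine ⟨h.le, fun hx => ?_, ?_⟩
  · obtain ⟨i, hi, hP, rfl⟩ := h.prop hx
    exact ⟨i, hi, hP, d i, (hd i hi hP).prop (by omega), rfl⟩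
  · rintro y ⟨i, hi, hP, z, hz, rfl⟩
    exact (h.min _ ⟨i, hi, hP, rfl⟩).trans (Nat.add_le_add_right ((hd i hi hP).min z hz) _)

lemma mul_pos_iff_nat {a b : ℕ} : 0 < a * b ↔ 0 < a ∧ 0 < b := CanonicallyOrderedAdd.mul_pos

variable {n : ℕ} {S : Set (Fin n)} {K : Finset (Fin n)} {c : Option (Fin n) → ℕ → ℕ}
  {N w s : ℕ} {E : Env} {σ τ : Store}

/-- In the part of the block `K` that consists of vertices smaller than `w`, a total occupation of
`s` can be had at the cost `y`. -/
def PartialCost (S : Set (Fin n)) (K : Finset (Fin n)) (c : Option (Fin n) → ℕ → ℕ)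
    (N w s y : ℕ) : Prop :=
  ∃ f : Fin n → ℕ, (∀ v ∈ K, f v ≤ N ∧ (N ≠ 0 → v ∈ S → 0 < f v)) ∧
    ∑ v ∈ K with v.val < w, f v = s ∧ ∑ v ∈ K with v.val < w, c (some v) (f v) = y

lemma partialCost_zero {y : ℕ} : PartialCost S K c N 0 s y ↔ s = 0 ∧ y = 0 := by
  constructor
  · rintro ⟨f, -, rfl, rfl⟩
    simp
  · rintro ⟨rfl, rfl⟩
    exact ⟨fun _ => N, fun v _ => ⟨le_rfl, fun h _ => Nat.pos_of_ne_zero h⟩, by simp, by simp⟩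

lemma filter_lt_succ_of_mem {w : Fin n} (hw : w ∈ K) :
    K.filter (fun v => v.val < w.val + 1) = insert w (K.filter (fun v => v.val < w.val)) := by
  ext v
  simp only [Finset.mem_filter, Finset.mem_insert, Nat.lt_succ_iff_lt_or_eq, ← Fin.ext_iff]
  constructor
  · rintro ⟨h, h' | rfl⟩
    exacts [.inr ⟨h, h'⟩, .inl rfl]
  · rintro (rfl | ⟨h, h'⟩)
    exacts [⟨hw, .inr rfl⟩, ⟨h, .inl h'⟩]

lemma filter_lt_succ_of_notMem {w : Fin n} (hw : w ∉ K) :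
    K.filter (fun v => v.val < w.val + 1) = K.filter (fun v => v.val < w.val) := by
  refine Finset.filter_congr fun v hv => ?_
  have : v.val ≠ w.val := fun h => hw (Fin.ext h ▸ hv)
  omega

lemma partialCost_succ_of_mem {w : Fin n} (hw : w ∈ K) {y : ℕ} :
    PartialCost S K c N (w + 1) s y ↔ ∃ f < N + 1, (f ≤ s ∧ (N ≠ 0 → w ∈ S → 0 < f)) ∧
      ∃ z, PartialCost S K c N w (s - f) z ∧ y = z + c (some w) f := by
  have hnot : w ∉ K.filter (fun v => v.val < w.val) := by simp
  constructor
  · rintro ⟨f, hf, rfl, rfl⟩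
    rw [filter_lt_succ_of_mem hw, Finset.sum_insert hnot, Finset.sum_insert hnot]
    exact ⟨f w, Nat.lt_succ_of_le (hf w hw).1, ⟨by omega, (hf w hw).2⟩, _,
      ⟨f, hf, by omega, rfl⟩, add_comm _ _⟩
  · rintro ⟨a, ha, ⟨has, haS⟩, z, ⟨f, hf, hs, rfl⟩, rfl⟩
    have hupd : ∀ v ∈ K.filter (fun v => v.val < w.val), Function.update f w a v = f v :=
      fun v hv => Function.update_of_ne (by rintro rfl; exact hnot hv) _ _
    refine ⟨Function.update f w a, fun v hv => ?_, ?_, ?_⟩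
    · by_cases h : v = w
      · subst h
        rw [Function.update_self]
        exact ⟨by omega, haS⟩
      · rw [Function.update_of_ne h]
        exact hf v hv
    · rw [filter_lt_succ_of_mem hw, Finset.sum_insert hnot, Function.update_self,
        Finset.sum_congr rfl hupd]
      exact (congrArg (a + ·) hs).trans (Nat.add_sub_cancel' has)
    · rw [filter_lt_succ_of_mem hw, Finset.sum_insert hnot, Function.update_self, add_comm]
      exact congrArg (· + _) (Finset.sum_congr rfl fun v hv => by rw [hupd v hv])

lemma partialCost_succ_of_notMem {w : Fin n} (hw : w ∉ K) {y : ℕ} :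
    PartialCost S K c N (w + 1) s y ↔ PartialCost S K c N w s y := by
  unfold PartialCost
  rw [filter_lt_succ_of_notMem hw]

/-- The characteristic function of the first independent set. -/
def Expr.source (e : Expr) : Expr := .inp (.var 0 * .var 0 + e)

/-- The characteristic function of the second independent set. -/
def Expr.target (e : Expr) : Expr := .inp (.var 0 * .var 0 + .var 0 + e)

/-- The adjacency matrix. -/
def Expr.adj (e₁ e₂ : Expr) : Expr := .inp (e₁ * .var 0 + e₂)

/-- Computes one cell of the table of partial costs: array `4`, row `w + 1`, column `s`, with `w` in
variable `14`, `s` in variable `16`, and `N` in variable `15`. Array `6` describes the block, and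
array `3` holds the costs of the vertices. -/
def cellCmd : Cmd :=
  .ite (.arr 6 (.var 14) 0)
    (.block [.assign 3 .cap,
      .minLoop 17 3 (.var 15 + 1)
        ((.var 16 + 1 - .var 17) * (1 - .var 15 * .source (.var 14) * (1 - .var 17)))
        (.arr 4 (.var 14) (.var 16 - .var 17) + .arr 3 (.var 14) (.var 17)),
      .store 4 (.var 14 + 1) (.var 16) (.var 3)])
    (.store 4 (.var 14 + 1) (.var 16) (.arr 4 (.var 14) (.var 16)))

/-- Computes the table of partial costs. -/
def tableCmd : Cmd :=
  .block [.loop 16 .cap (.store 4 0 (.var 16) (.cap * .var 16)),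
    .loop 14 (.var 0) (.loop 16 .cap cellCmd)]

/-- What a store tells about the block `K` and the costs `c`. -/
structure BlockData (E : Env) (S : Set (Fin n)) (K : Finset (Fin n))
    (c : Option (Fin n) → ℕ → ℕ) (m : ℕ) (σ : Store) : Prop where
  card : σ.v 0 = n
  source : ∀ v : Fin n, E.inp (n * n + v) = ind S v
  mem_block : ∀ v : Fin n, 0 < σ.a 6 v 0 ↔ v ∈ K
  cost : ∀ v : Fin n, ∀ a < m, σ.a 3 v a = c (some v) a

lemma BlockData.of_eq {m : ℕ} (h : BlockData E S K c m σ) (h0 : τ.v 0 = σ.v 0)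
    (h3 : τ.a 3 = σ.a 3) (h6 : τ.a 6 = σ.a 6) : BlockData E S K c m τ :=
  ⟨h0.trans h.card, h.source, by rw [h6]; exact h.mem_block, by rw [h3]; exact h.cost⟩

lemma ind_pos_iff {v : Fin n} : 0 < ind S v ↔ v ∈ S := by
  by_cases h : v ∈ S
  · simp [ind_of_mem h, h]
  · simp [ind_of_notMem h, h]

lemma exec_cellCmd {m : ℕ} {w : Fin n} (hσ : BlockData E S K c m σ) (h14 : σ.v 14 = w)
    (h15 : σ.v 15 = N) (h16 : σ.v 16 = s) (hN : N < m) (hm : m ≤ E.cap)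
    (hs : s < E.cap)
    (hD : ∀ s < E.cap, CapMin E.cap (PartialCost S K c N w s) (σ.a 4 w s))
    (hτ : τ = cellCmd.exec E σ) :
    CapMin E.cap (PartialCost S K c N (w + 1) s) (τ.a 4 (w + 1) s) ∧
      ∀ i j : ℕ, i ≠ w + 1 ∨ j ≠ s → τ.a 4 i j = σ.a 4 i j := by
  subst hτ
  unfold cellCmd
  rw [Cmd.exec_ite]
  simp only [Expr.eval_arr, Expr.eval_var, Expr.eval_ofNat, h14]
  by_cases hw : w ∈ K
  · rw [if_pos ((hσ.mem_block w).2 hw)]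
    set σ₁ := σ.setVar 3 E.cap with hσ₁
    have key := Cmd.exec_minLoop (E := E) (σ := σ₁) (x := 17) (b := 3) (n := N + 1)
      (e := .var 15 + 1)
      (c := (.var 16 + 1 - .var 17) * (1 - .var 15 * .source (.var 14) * (1 - .var 17)))
      (e' := .arr 4 (.var 14) (.var 16 - .var 17) + .arr 3 (.var 14) (.var 17))
      (Q := fun _ => False) (g := fun f => σ.a 4 w (s - f) + c (some w) f)
      (P := fun f => f ≤ s ∧ (N ≠ 0 → w ∈ S → 0 < f)) (by omega)
      (by simp [hσ₁, h15]; omega) ?_ (CapMin.of_false fun _ h => h)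
    · simp only [false_or] at key
      have key' := (CapMin.add (R := fun f => PartialCost S K c N w (s - f)) key
        (fun f _ _ => hD _ (by omega))).congr (fun y => (partialCost_succ_of_mem hw).symm)
      set σ₂ := (Cmd.minLoop 17 3 (.var 15 + 1)
        ((.var 16 + 1 - .var 17) * (1 - .var 15 * .source (.var 14) * (1 - .var 17)))
        (.arr 4 (.var 14) (.var 16 - .var 17) + .arr 3 (.var 14) (.var 17))).exec E σ₁ with hσ₂
      have h14' : σ₂.v 14 = w := (Cmd.exec_v rfl).trans h14
      have h16' : σ₂.v 16 = s := (Cmd.exec_v rfl).trans h16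
      have ha : σ₂.a 4 = σ.a 4 := Cmd.exec_a rfl
      simp only [Cmd.exec_block_cons, Cmd.exec_block_nil, Cmd.exec_assign, Expr.eval_cap, min_self,
        ← hσ₁, ← hσ₂, Cmd.exec_store, Expr.eval_add, Expr.eval_var, Expr.eval_ofNat, h14', h16',
        min_eq_left key'.le, Store.setArr_a, and_self, if_true, ha, true_and]
      exact ⟨key', fun i j hij => if_neg (by omega)⟩
    · intro f hf τ hv ha h17
      have hv' : ∀ y, y ≠ 17 → y ≠ 3 → τ.v y = σ.v y := fun y h1 h2 =>
        (hv y h1 h2).trans (by simp [hσ₁, h2])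
      have hx0 : τ.v 0 = n := (hv' 0 (by omega) (by omega)).trans hσ.card
      have hx14 : τ.v 14 = w := (hv' 14 (by omega) (by omega)).trans h14
      have hx15 : τ.v 15 = N := (hv' 15 (by omega) (by omega)).trans h15
      have hx16 : τ.v 16 = s := (hv' 16 (by omega) (by omega)).trans h16
      have ha' : τ.a = σ.a := ha
      simp only [Expr.eval_mul, Expr.eval_sub, Expr.eval_add, Expr.eval_var, Expr.eval_ofNat,
        Expr.source, Expr.eval_inp, Expr.eval_arr, hx0, hx14, hx15, hx16, h17, ha', hσ.source,
        hσ.cost w f (by omega), and_true, mul_pos_iff_nat]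
      have hcond : N * ind S w * (1 - f) = 0 ↔ (N ≠ 0 → w ∈ S → 0 < f) := by
        rw [← ind_pos_iff, mul_eq_zero, mul_eq_zero]
        omega
      rw [← hcond]
      omega
  · rw [if_neg (fun h => hw ((hσ.mem_block w).1 h))]
    simp only [Cmd.exec_store, Expr.eval_add, Expr.eval_var, Expr.eval_ofNat, Expr.eval_arr, h14,
      h16, Store.setArr_a, and_self, if_true, true_and, min_eq_left (hD s hs).le]
    exact ⟨(hD s hs).congr fun y => (partialCost_succ_of_notMem hw).symm,
      fun i j hij => if_neg (by omega)⟩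

lemma exec_tableCmd {m : ℕ} (hσ : BlockData E S K c m σ) (h15 : σ.v 15 = N) (hN : N < m)
    (hm : m ≤ E.cap) (hn : n ≤ E.cap) (hτ : τ = tableCmd.exec E σ) :
    ∀ s < E.cap, CapMin E.cap (PartialCost S K c N n s) (τ.a 4 n s) := by
  set σ₁ := (Cmd.loop 16 .cap (.store 4 0 (.var 16) (.cap * .var 16))).exec E σ with hσ₁
  have hrow : ∀ s < E.cap, CapMin E.cap (PartialCost S K c N 0 s) (σ₁.a 4 0 s) := by
    refine Cmd.exec_loop (n := E.cap) (P := fun i τ => ∀ s < i,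
      CapMin E.cap (PartialCost S K c N 0 s) (τ.a 4 0 s)) (by simp) (by simp) ?_
    intro i hi τ _ _ hP s hs
    simp only [Cmd.exec_store, Expr.eval_var, Expr.eval_ofNat, Expr.eval_mul, Expr.eval_cap,
      Store.setVar_v, if_true, Store.setArr_a, Store.setVar_a, true_and]
    split_ifs with h
    · subst h
      refine CapMin.congr (P := fun y => s = 0 ∧ y = 0) ?_ fun y => partialCost_zero.symm
      rcases Nat.eq_zero_or_pos s with rfl | hpos
      · exact ⟨by simp, fun _ => by simp, fun y _ => by simp⟩
      · rw [min_eq_right (Nat.le_mul_of_pos_right _ hpos)]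
        exact CapMin.of_false fun y h => by omega
    · exact hP s (by omega)
  have h1 : BlockData E S K c m σ₁ := hσ.of_eq (Cmd.exec_v rfl) (Cmd.exec_a rfl) (Cmd.exec_a rfl)
  have h15' : σ₁.v 15 = N := (Cmd.exec_v rfl).trans h15
  have hexec : τ = (Cmd.loop 14 (.var 0) (.loop 16 .cap cellCmd)).exec E σ₁ := hτ
  rw [hexec]
  refine Cmd.exec_loop (n := n) (P := fun i τ => ∀ s < E.cap,
    CapMin E.cap (PartialCost S K c N i s) (τ.a 4 i s)) (by simp [h1.card, hn]) hrow ?_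
  intro i hi ρ hv ha hP
  have hρ : BlockData E S K c m (ρ.setVar 14 i) := h1.of_eq (hv 0 rfl) (ha 3 rfl) (ha 6 rfl)
  have hρ15 : (ρ.setVar 14 i).v 15 = N := (hv 15 rfl).trans h15'
  have key := Cmd.exec_loop (E := E) (σ := ρ.setVar 14 i) (x := 16) (e := .cap) (n := E.cap)
    (C := cellCmd) (P := fun j τ =>
      (∀ s < E.cap, CapMin E.cap (PartialCost S K c N i s) (τ.a 4 i s))
      ∧ ∀ s < j, CapMin E.cap (PartialCost S K c N (i + 1) s) (τ.a 4 (i + 1) s)) (by simp)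
    ⟨hP, by simp⟩ ?_
  · exact key.2
  intro j hj μ hv' ha' ⟨hD, hD'⟩
  have hμ : BlockData E S K c m (μ.setVar 16 j) := hρ.of_eq (hv' 0 rfl) (ha' 3 rfl) (ha' 6 rfl)
  obtain ⟨hnew, hold⟩ := exec_cellCmd (w := ⟨i, hi⟩) (s := j) hμ
    ((hv' 14 rfl).trans (by simp)) ((hv' 15 rfl).trans hρ15) (by simp) hN hm hj hD rfl
  refine ⟨fun s hs => ?_, fun s hs => ?_⟩
  · rw [hold i s (.inl (by simp))]
    exact hD s hs
  · by_cases hsj : s = j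
    · subst hsj
      exact hnew
    · rw [hold (i + 1) s (.inr hsj)]
      exact hD' s (by omega)

end Block


section BlockMin

variable {n : ℕ} {S : Set (Fin n)} {K : Finset (Fin n)} {p : Option (Fin n)}
  {c : Option (Fin n) → ℕ → ℕ} {N m : ℕ} {E : Env} {σ τ : Store}

/-- The contribution of the runs of length `N` inside the block to the cost of its elimination. -/
def LayerCost (S : Set (Fin n)) (K : Finset (Fin n)) (p : Option (Fin n))
    (c : Option (Fin n) → ℕ → ℕ) (B N a z : ℕ) : Prop :=
  a ≤ N ∧ (N ≠ 0 → (∃ v ∈ S, p = some v) → 0 < a) ∧ ∃ s < B, (N ≤ s + a ∧ s + a ≤ 2 * N ∧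
    (N ≠ 0 → (¬ ∃ v ∈ S, v ∈ K ∨ p = some v) → s + a < 2 * N)) ∧
    ∃ y, PartialCost S K c N n s y ∧ z = y + (N - a)

lemma blockCost_iff_layerCost {B a z : ℕ} (hB : 2 * m ≤ B) :
    BlockCost S K p c m a z ↔ ∃ N < m, LayerCost S K p c B N a z := by
  have hfilter : K.filter (fun v => v.val < n) = K := Finset.filter_true_of_mem fun v _ => v.isLt
  refine exists_congr fun N => and_congr_right fun hN => and_congr_right fun ha => ?_
  have hno : (∀ v ∈ S, v ∉ K ∧ p ≠ some v) ↔ ¬ ∃ v ∈ S, v ∈ K ∨ p = some v := by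
    push Not
    rfl
  refine and_congr (imp_congr_right fun _ => ?_) ?_
  · exact ⟨fun h ⟨v, hv, hpv⟩ => h v hv hpv, fun h v hv hpv => h ⟨v, hv, hpv⟩⟩
  rw [hno]
  unfold PartialCost
  rw [hfilter]
  constructor
  · rintro ⟨f, hf, h1, h2, h3, h4⟩
    exact ⟨_, by omega, ⟨h1, h2, h3⟩, _, ⟨f, hf, rfl, rfl⟩, by omega⟩
  · rintro ⟨s, -, ⟨h1, h2, h3⟩, y, ⟨f, hf, rfl, rfl⟩, h4⟩
    exact ⟨f, hf, h1, h2, h3, by omega⟩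

/-- Updates the costs of the elimination, in array `5`, by the runs of length `N`, with `N` in
variable `15`. Variable `11` tells whether the block has a parent, which is then in variable `12`.
Variable `13` is positive if the block or its parent meets the first independent set. -/
def layerCmd : Cmd :=
  .loop 8 (.var 15 + 1) (.block [.assign 3 (.arr 5 (.var 8) 0),
    .minLoop 16 3 .cap
      ((.var 16 + .var 8 + 1 - .var 15) * (2 * .var 15 + 1 - (.var 16 + .var 8)) *
        (1 - .var 15 * (.var 11 * .source (.var 12)) * (1 - .var 8)) *
        (1 - (1 - .var 13) * .var 15 * (1 - (2 * .var 15 - (.var 16 + .var 8)))))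
      (.arr 4 (.var 0) (.var 16) + (.var 15 - .var 8)),
    .store 5 (.var 8) 0 (.var 3)])

/-- Computes the costs of the elimination of the block. -/
def blockMinCmd : Cmd :=
  .block [.loop 8 (.var 6) (.store 5 (.var 8) 0 .cap),
    .loop 15 (.var 6) (.block [tableCmd, layerCmd])]

/-- What a store tells about the block `K` with parent `p`. -/
structure RootedBlockData (E : Env) (S : Set (Fin n)) (K : Finset (Fin n)) (p : Option (Fin n))
    (c : Option (Fin n) → ℕ → ℕ) (m : ℕ) (σ : Store) : Prop extends BlockData E S K c m σ where
  parent : 0 < σ.v 11 * E.inp (n * n + σ.v 12) ↔ ∃ v ∈ S, p = some v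
  meets : 0 < σ.v 13 ↔ ∃ v ∈ S, v ∈ K ∨ p = some v

lemma RootedBlockData.of_eq (h : RootedBlockData E S K p c m σ) (h0 : τ.v 0 = σ.v 0)
    (h11 : τ.v 11 = σ.v 11) (h12 : τ.v 12 = σ.v 12) (h13 : τ.v 13 = σ.v 13)
    (h3 : τ.a 3 = σ.a 3) (h6 : τ.a 6 = σ.a 6) : RootedBlockData E S K p c m τ :=
  ⟨h.toBlockData.of_eq h0 h3 h6, by rw [h11, h12]; exact h.parent, by rw [h13]; exact h.meets⟩

lemma exec_layerCmd (hσ : RootedBlockData E S K p c m σ) (h15 : σ.v 15 = N) (hN : N < m)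
    (hm : m ≤ E.cap)
    (hD : ∀ s < E.cap, CapMin E.cap (PartialCost S K c N n s) (σ.a 4 n s))
    (hG : ∀ a < m, CapMin E.cap (fun z => ∃ N' < N, LayerCost S K p c E.cap N' a z) (σ.a 5 a 0))
    (hτ : τ = layerCmd.exec E σ) :
    ∀ a < m, CapMin E.cap (fun z => ∃ N' < N + 1, LayerCost S K p c E.cap N' a z) (τ.a 5 a 0) := by
  subst hτ
  suffices ∀ a < m, CapMin E.cap (fun z => (∃ N' < N, LayerCost S K p c E.cap N' a z) ∨
      a < N + 1 ∧ LayerCost S K p c E.cap N a z) ((layerCmd.exec E σ).a 5 a 0) by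
    intro a ha
    refine (this a ha).congr fun z => ⟨?_, ?_⟩
    · rintro (⟨N', hN', h⟩ | ⟨-, h⟩)
      exacts [⟨N', by omega, h⟩, ⟨N, by omega, h⟩]
    · rintro ⟨N', hN', h⟩
      rcases Nat.lt_succ_iff_lt_or_eq.1 hN' with hN' | rfl
      exacts [.inl ⟨N', hN', h⟩, .inr ⟨Nat.lt_succ_of_le h.1, h⟩]
  refine Cmd.exec_loop (n := N + 1) (P := fun i τ => ∀ a < m, CapMin E.cap
    (fun z => (∃ N' < N, LayerCost S K p c E.cap N' a z) ∨ a < i ∧ LayerCost S K p c E.cap N a z)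
    (τ.a 5 a 0)) (by simp [h15]; omega) (fun a ha => (hG a ha).congr fun z => by simp) ?_
  intro i hi ρ hv ha hP
  have hρ : RootedBlockData E S K p c m ρ :=
    hσ.of_eq (hv 0 rfl) (hv 11 rfl) (hv 12 rfl) (hv 13 rfl) (ha 3 rfl) (ha 6 rfl)
  have h4 : ρ.a 4 = σ.a 4 := ha 4 rfl
  have hρ15 : ρ.v 15 = N := (hv 15 rfl).trans h15
  have hle := (hP i (by omega)).le
  set ρ₁ := (ρ.setVar 8 i).setVar 3 (ρ.a 5 i 0) with hρ₁
  have key := Cmd.exec_minLoop (E := E) (σ := ρ₁) (x := 16) (b := 3) (n := E.cap) (e := .cap)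
    (c := (.var 16 + .var 8 + 1 - .var 15) * (2 * .var 15 + 1 - (.var 16 + .var 8)) *
        (1 - .var 15 * (.var 11 * .source (.var 12)) * (1 - .var 8)) *
        (1 - (1 - .var 13) * .var 15 * (1 - (2 * .var 15 - (.var 16 + .var 8)))))
    (e' := .arr 4 (.var 0) (.var 16) + (.var 15 - .var 8))
    (Q := fun z => ∃ N' < N, LayerCost S K p c E.cap N' i z)
    (g := fun s => σ.a 4 n s + (N - i))
    (P := fun s => (N ≠ 0 → (∃ v ∈ S, p = some v) → 0 < i) ∧ N ≤ s + i ∧ s + i ≤ 2 * N ∧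
      (N ≠ 0 → (¬ ∃ v ∈ S, v ∈ K ∨ p = some v) → s + i < 2 * N)) (by omega)
    (by simp) ?_ ?_
  · set ρ₂ := (Cmd.minLoop 16 3 .cap
      ((.var 16 + .var 8 + 1 - .var 15) * (2 * .var 15 + 1 - (.var 16 + .var 8)) *
        (1 - .var 15 * (.var 11 * .source (.var 12)) * (1 - .var 8)) *
        (1 - (1 - .var 13) * .var 15 * (1 - (2 * .var 15 - (.var 16 + .var 8)))))
      (.arr 4 (.var 0) (.var 16) + (.var 15 - .var 8))).exec E ρ₁ with hρ₂
    have h8 : ρ₂.v 8 = i := (Cmd.exec_v rfl).trans (by simp [hρ₁])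
    have h5 : ρ₂.a 5 = ρ.a 5 := Cmd.exec_a rfl
    intro a ham
    simp only [Cmd.exec_block_cons, Cmd.exec_block_nil, Cmd.exec_assign, Expr.eval_arr,
      Expr.eval_var, Expr.eval_ofNat, Store.setVar_v, Store.setVar_a, if_true, min_eq_left hle,
      ← hρ₁, ← hρ₂, Cmd.exec_store, h8, min_eq_left key.le, Store.setArr_a, true_and, h5, and_true]
    split_ifs with h
    · subst h
      -- The minimum over the table becomes a minimum over the described sets of numbers.
      have hmin := key
      refine ⟨hmin.le, fun hx => ?_, fun y hy => ?_⟩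
      · rcases hmin.prop hx with h | ⟨s, hs, ⟨h1, h2⟩, h3⟩
        · exact .inl h
        · refine .inr ⟨by omega, by omega, h1, s, hs, h2, _, (hD s hs).prop ?_, h3⟩
          omega
      · rcases hy with hy | ⟨-, -, h1, s, hs, h2, y', hy', rfl⟩
        · exact hmin.min y (.inl hy)
        · exact (hmin.min _ (.inr ⟨s, hs, ⟨h1, h2⟩, rfl⟩)).trans
            (Nat.add_le_add_right ((hD s hs).min y' hy') _)
    · exact (hP a ham).congr fun z => or_congr_right (and_congr_left fun _ => by omega)
  · intro s hs μ hvμ haμ h16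
    have hv' : ∀ y, y ≠ 16 → y ≠ 3 → y ≠ 8 → μ.v y = ρ.v y := fun y h1 h2 h3 =>
      (hvμ y h1 h2).trans (by simp [hρ₁, h2, h3])
    have hx0 : μ.v 0 = n := (hv' 0 (by omega) (by omega) (by omega)).trans hρ.card
    have hx8 : μ.v 8 = i := (hvμ 8 (by omega) (by omega)).trans (by simp [hρ₁])
    have hx11 := hv' 11 (by omega) (by omega) (by omega)
    have hx12 := hv' 12 (by omega) (by omega) (by omega)
    have hx13 := hv' 13 (by omega) (by omega) (by omega)
    have hx15 : μ.v 15 = N := (hv' 15 (by omega) (by omega) (by omega)).trans hρ15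
    have haμ' : μ.a 4 = σ.a 4 := (congrFun haμ 4).trans h4
    simp only [Expr.eval_mul, Expr.eval_sub, Expr.eval_add, Expr.eval_var, Expr.eval_ofNat,
      Expr.source, Expr.eval_inp, Expr.eval_arr, hx0, hx8, hx11, hx12, hx13, hx15, h16, haμ',
      and_true, mul_pos_iff_nat (a := _ * _), mul_pos_iff_nat (a := _ - _) (b := _ - _)]
    rw [← hρ.parent, ← hρ.meets]
    have h1 : 0 < 1 - N * (ρ.v 11 * E.inp (n * n + ρ.v 12)) * (1 - i) ↔
        (N ≠ 0 → 0 < ρ.v 11 * E.inp (n * n + ρ.v 12) → 0 < i) := by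
      rw [Nat.sub_pos_iff_lt, Nat.lt_one_iff, mul_eq_zero, mul_eq_zero]
      omega
    have h2 : 0 < 1 - (1 - ρ.v 13) * N * (1 - (2 * N - (s + i))) ↔
        (N ≠ 0 → ¬ 0 < ρ.v 13 → s + i < 2 * N) := by
      rw [Nat.sub_pos_iff_lt, Nat.lt_one_iff, mul_eq_zero, mul_eq_zero]
      omega
    rw [h1, h2]
    omega
  · have h3 : ρ₁.v 3 = ρ.a 5 i 0 := by simp [hρ₁]
    rw [h3]
    exact (hP i (by omega)).congr fun z => by simp

lemma exec_blockMinCmd (hσ : RootedBlockData E S K p c m σ) (h6 : σ.v 6 = m)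
    (hm : 2 * m ≤ E.cap) (hn : n ≤ E.cap) (hτ : τ = blockMinCmd.exec E σ) :
    ∀ a < m, CapMin E.cap (BlockCost S K p c m a) (τ.a 5 a 0) := by
  set σ₁ := (Cmd.loop 8 (.var 6) (.store 5 (.var 8) 0 .cap)).exec E σ with hσ₁
  have h1 : RootedBlockData E S K p c m σ₁ := hσ.of_eq (Cmd.exec_v rfl) (Cmd.exec_v rfl)
    (Cmd.exec_v rfl) (Cmd.exec_v rfl) (Cmd.exec_a rfl) (Cmd.exec_a rfl)
  have h61 : σ₁.v 6 = m := (Cmd.exec_v rfl).trans h6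
  have hG : ∀ a < m, σ₁.a 5 a 0 = E.cap := by
    refine Cmd.exec_loop (n := m) (P := fun i τ => ∀ a < i, τ.a 5 a 0 = E.cap)
      (by simp [h6]; omega) (by simp) ?_
    intro i hi τ _ _ hP a ha
    simp only [Cmd.exec_store, Expr.eval_var, Expr.eval_ofNat, Expr.eval_cap, Store.setVar_v,
      if_true, Store.setArr_a, Store.setVar_a, true_and, and_true, min_self]
    split_ifs with h
    · rfl
    · exact hP a (by omega)
  have hexec : τ = (Cmd.loop 15 (.var 6) (.block [tableCmd, layerCmd])).exec E σ₁ := hτ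
  rw [hexec]
  suffices ∀ a < m, CapMin E.cap (fun z => ∃ N < m, LayerCost S K p c E.cap N a z)
      (((Cmd.loop 15 (.var 6) (.block [tableCmd, layerCmd])).exec E σ₁).a 5 a 0) from
    fun a ha => (this a ha).congr fun z => (blockCost_iff_layerCost hm).symm
  refine Cmd.exec_loop (n := m) (P := fun i τ => ∀ a < m,
    CapMin E.cap (fun z => ∃ N < i, LayerCost S K p c E.cap N a z) (τ.a 5 a 0))
    (by simp [h61]; omega) (fun a ha => ?_) ?_
  · rw [hG a ha]
    exact CapMin.of_false fun z ⟨N, hN, _⟩ => by omega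
  intro N hN ρ hv ha hP
  have hρ : RootedBlockData E S K p c m (ρ.setVar 15 N) :=
    h1.of_eq (hv 0 rfl) (hv 11 rfl) (hv 12 rfl) (hv 13 rfl) (ha 3 rfl) (ha 6 rfl)
  set ρ₁ := tableCmd.exec E (ρ.setVar 15 N) with hρ₁
  have hD := exec_tableCmd hρ.toBlockData (N := N) (by simp) hN (by omega) hn hρ₁
  have hρ₁' : RootedBlockData E S K p c m ρ₁ := hρ.of_eq (Cmd.exec_v rfl) (Cmd.exec_v rfl)
    (Cmd.exec_v rfl) (Cmd.exec_v rfl) (Cmd.exec_a rfl) (Cmd.exec_a rfl)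
  have h15 : ρ₁.v 15 = N := (Cmd.exec_v rfl).trans (by simp)
  have h5 : ρ₁.a 5 = ρ.a 5 := Cmd.exec_a rfl
  exact exec_layerCmd hρ₁' h15 hN (by omega) hD (by rw [h5]; exact hP) rfl

end BlockMin


/-! ### Eliminating the blocks -/

section Elimination

variable {n m j : ℕ} {G : SimpleGraph (Fin n)} {S T : Set (Fin n)} {K : Finset (Fin n)}
  {p : Option (Fin n)} {E : Env} {σ τ : Store}

/-- The environment describes the given instance. -/
structure Encodes (E : Env) (G : SimpleGraph (Fin n)) (S T : Set (Fin n)) : Prop where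
  cap : E.cap = 4 * n + 4
  adj : ∀ u v : Fin n, 0 < E.inp (u * n + v) ↔ G.Adj u v
  source : ∀ v : Fin n, E.inp (n * n + v) = ind S v
  target : ∀ v : Fin n, E.inp (n * n + n + v) = ind T v

/-- Counts in variable `11` the neighbours of the vertex in variable `10` among the first vertices
of the search order, up to the position in variable `9`. Variable `12` becomes the last of them. -/
def parentCmd : Cmd :=
  .block [.assign 11 0, .assign 12 (.var 0),
    .loop 5 (.var 9) (.ite (.adj (.var 10) (.arr 0 (.var 5) 0))
      (.block [.assign 11 (.var 11 + 1), .assign 12 (.arr 0 (.var 5) 0)]) .skip)]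

/-- Describes in array `6` the block that contains the vertex in variable `10` and its parent in
variable `12`, with the parent left out. Variable `11` is `0` if there is no parent. Variable `13`
becomes positive if the block, with its parent, meets the first independent set. -/
def memberCmd : Cmd :=
  .block [.assign 13 (.var 11 * .source (.var 12)),
    .loop 14 (.var 0) (.block [
      .store 6 (.var 14) 0 (1 - (.var 14 - .var 10) - (.var 10 - .var 14) +
        .adj (.var 14) (.var 10) * .adj (.var 14) (.var 12) * .var 11),
      .assign 13 (.var 13 + .arr 6 (.var 14) 0 * .source (.var 14))])]

/-- Adds the costs of the elimination to the costs of the parent. -/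
def relaxCmd : Cmd :=
  .loop 8 (.var 6) (.store 3 (.var 12) (.var 8) (.arr 3 (.var 12) (.var 8) + .arr 5 (.var 8) 0))

/-- Eliminates the block of the vertex at the position in variable `9` of the search order, unless
this vertex has two earlier neighbours, in which case its block is eliminated later. -/
def eliminateCmd : Cmd :=
  .block [.assign 10 (.arr 0 (.var 9) 0), parentCmd,
    .ite (2 - .var 11) (.block [memberCmd, blockMinCmd, relaxCmd]) .skip]

lemma exec_parentCmd {l : ℕ} (h0 : σ.v 0 = n) (h9 : σ.v 9 = j) (h10 : σ.v 10 = l) (hj : j < n)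
    (hcap : n + 2 ≤ E.cap) (hord : ∀ i < n, σ.a 0 i 0 < n) {q : ℕ → Prop}
    (hq : ∀ i < j, 0 < E.inp (l * n + σ.a 0 i 0) ↔ q i) (hτ : τ = parentCmd.exec E σ) :
    (τ.v 11 = 0 ∧ τ.v 12 = n ∧ ∀ i < j, ¬ q i) ∨
      (τ.v 11 = 1 ∧ ∃ i < j, τ.v 12 = σ.a 0 i 0 ∧ ∀ k < j, q k ↔ k = i) ∨
      (2 ≤ τ.v 11 ∧ ∃ i < j, ∃ k < i, q i ∧ q k) := by
  subst hτ
  refine Cmd.exec_loop (n := j) (σ := (σ.setVar 11 (min 0 E.cap)).setVar 12 (min (σ.v 0) E.cap))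
    (P := fun j τ => (τ.v 11 = 0 ∧ τ.v 12 = n ∧ ∀ i < j, ¬ q i) ∨
      (τ.v 11 = 1 ∧ ∃ i < j, τ.v 12 = σ.a 0 i 0 ∧ ∀ k < j, q k ↔ k = i) ∨
      (2 ≤ τ.v 11 ∧ ∃ i < j, ∃ k < i, q i ∧ q k)) (by simp [h9]; omega) (.inl ?_) ?_
  · simp only [Store.setVar_v, if_true, h0]
    exact ⟨by simp, by omega, by simp⟩
  intro i hi τ hv ha hP
  have h0' : τ.v 0 = n := (hv 0 rfl).trans (by simp [h0])
  have h10' : τ.v 10 = l := (hv 10 rfl).trans (by simp [h10])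
  have ha' : τ.a 0 = σ.a 0 := ha 0 rfl
  have hoi := hord i (by omega)
  have heval : (Expr.adj (.var 10) (.arr 0 (.var 5) 0)).eval E (τ.setVar 5 i) =
      E.inp (l * n + σ.a 0 i 0) := by
    simp [Expr.adj, h0', h10', ha']
  rw [Cmd.exec_ite, heval]
  by_cases hqi : q i
  · rw [if_pos ((hq i hi).2 hqi)]
    simp only [Cmd.exec_block_cons, Cmd.exec_block_nil, Cmd.exec_assign, Expr.eval_add,
      Expr.eval_var, Expr.eval_ofNat, Expr.eval_arr, Store.setVar_v, Store.setVar_a, reduceIte,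
      Nat.reduceEqDiff, ha']
    rcases hP with ⟨h1, h2, h3⟩ | ⟨h1, k, hk, h2, h3⟩ | ⟨h1, k, hk, k', hk', h2, h3⟩
    · refine .inr (.inl ⟨by omega, i, by omega, by omega, fun k hk => ⟨fun hqk => ?_, ?_⟩⟩)
      · by_contra hne
        exact h3 k (by omega) hqk
      · rintro rfl
        exact hqi
    · exact .inr (.inr ⟨by omega, i, by omega, k, hk, hqi, (h3 k hk).2 rfl⟩)
    · exact .inr (.inr ⟨by omega, k, by omega, k', hk', h2, h3⟩)
  · rw [if_neg (fun h => hqi ((hq i hi).1 h)), Cmd.exec_skip]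
    simp only [Store.setVar_v, reduceIte, Nat.reduceEqDiff]
    rcases hP with ⟨h1, h2, h3⟩ | ⟨h1, k, hk, h2, h3⟩ | ⟨h1, k, hk, k', hk', h2, h3⟩
    · refine .inl ⟨h1, h2, fun k hk => ?_⟩
      rcases Nat.lt_succ_iff_lt_or_eq.1 hk with hk | rfl
      exacts [h3 k hk, hqi]
    · refine .inr (.inl ⟨h1, k, by omega, h2, fun k' hk' => ?_⟩)
      rcases Nat.lt_succ_iff_lt_or_eq.1 hk' with hk' | rfl
      · exact h3 k' hk'
      · exact ⟨fun h => absurd h hqi, fun h => by omega⟩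
    · exact .inr (.inr ⟨h1, k, by omega, k', hk', h2, h3⟩)

lemma exec_memberCmd {l : Fin n} {c : Option (Fin n) → ℕ → ℕ} (hE : Encodes E G S T)
    (h0 : σ.v 0 = n) (h10 : σ.v 10 = l)
    (hp : (σ.v 11 = 0 ∧ p = none) ∨ ∃ u : Fin n, σ.v 11 = 1 ∧ σ.v 12 = u ∧ p = some u)
    (hK : ∀ w, w ∈ K ↔ w = l ∨ ∃ u, p = some u ∧ G.Adj w l ∧ G.Adj w u)
    (hc : ∀ v : Fin n, ∀ a < m, σ.a 3 v a = c (some v) a) (hτ : τ = memberCmd.exec E σ) :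
    RootedBlockData E S K p c m τ := by
  have hcap := hE.cap
  have h0τ : τ.v 0 = n := by rw [hτ]; exact (Cmd.exec_v rfl).trans h0
  have h3τ : τ.a 3 = σ.a 3 := by rw [hτ]; exact Cmd.exec_a rfl
  have h11τ : τ.v 11 = σ.v 11 := by rw [hτ]; exact Cmd.exec_v rfl
  have h12τ : τ.v 12 = σ.v 12 := by rw [hτ]; exact Cmd.exec_v rfl
  have hparent : 0 < σ.v 11 * E.inp (n * n + σ.v 12) ↔ ∃ v ∈ S, p = some v := by
    rcases hp with ⟨h1, rfl⟩ | ⟨u, h1, h2, rfl⟩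
    · simp [h1]
    · rw [h1, h2, hE.source, one_mul, ind_pos_iff]
      constructor
      · exact fun h => ⟨u, h, rfl⟩
      · rintro ⟨v, hv, h⟩
        rwa [Option.some.inj h]
  suffices h : (∀ v : Fin n, v.val < n → (0 < τ.a 6 v 0 ↔ v ∈ K)) ∧
      (0 < τ.v 13 ↔ (∃ v ∈ S, p = some v) ∨ ∃ v ∈ S, v.val < n ∧ v ∈ K) by
    refine ⟨⟨h0τ, hE.source, fun v => h.1 v v.isLt, by rw [h3τ]; exact hc⟩,
      by rw [h11τ, h12τ]; exact hparent, h.2.trans ⟨?_, ?_⟩⟩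
    · rintro (⟨v, hv, h⟩ | ⟨v, hv, -, h⟩)
      exacts [⟨v, hv, .inr h⟩, ⟨v, hv, .inl h⟩]
    · rintro ⟨v, hv, h | h⟩
      exacts [.inr ⟨v, hv, v.isLt, h⟩, .inl ⟨v, hv, h⟩]
  subst hτ
  refine Cmd.exec_loop (n := n) (P := fun i τ =>
      (∀ v : Fin n, v.val < i → (0 < τ.a 6 v 0 ↔ v ∈ K)) ∧
      (0 < τ.v 13 ↔ (∃ v ∈ S, p = some v) ∨ ∃ v ∈ S, v.val < i ∧ v ∈ K))
    (by simp [h0]; omega) ⟨by simp, ?_⟩ ?_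
  · simp only [Cmd.exec_assign, Expr.source, Expr.eval_mul, Expr.eval_inp, Expr.eval_add,
      Expr.eval_var, h0, Store.setVar_v, if_true, not_lt_zero, false_and, and_false, exists_false,
      or_false]
    rw [← hparent]
    omega
  intro i hi μ hv ha ⟨hP, hP'⟩
  have hx0 : μ.v 0 = n := (hv 0 rfl).trans (by simp [h0])
  have hx10 : μ.v 10 = l := (hv 10 rfl).trans (by simp [h10])
  have hx11 : μ.v 11 = σ.v 11 := (hv 11 rfl).trans (by simp)
  have hx12 : μ.v 12 = σ.v 12 := (hv 12 rfl).trans (by simp)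
  -- The new cell of the array that describes the block.
  set x := min (1 - (i - l) - (l - i) +
    E.inp (i * n + l) * E.inp (i * n + σ.v 12) * σ.v 11) E.cap with hx
  have hxK : 0 < x ↔ (⟨i, hi⟩ : Fin n) ∈ K := by
    have hadj1 := hE.adj ⟨i, hi⟩ l
    have hx' : 0 < x ↔ i = l ∨ 0 < E.inp (i * n + l) * E.inp (i * n + σ.v 12) * σ.v 11 := by
      omega
    rw [hx', hK, Fin.ext_iff, mul_pos_iff_nat, mul_pos_iff_nat]
    refine or_congr_right ?_
    rcases hp with ⟨h1, rfl⟩ | ⟨u, h1, h2, rfl⟩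
    · simp [h1]
    · have hadj2 := hE.adj ⟨i, hi⟩ u
      rw [h1, h2, ← hadj1]
      constructor
      · exact fun ⟨⟨h3, h4⟩, _⟩ => ⟨u, rfl, h3, hadj2.1 h4⟩
      · rintro ⟨v, hv, h3, h4⟩
        rw [← Option.some.inj hv] at h4
        exact ⟨⟨h3, hadj2.2 h4⟩, one_pos⟩
  have hsource := hE.source ⟨i, hi⟩
  dsimp only at hsource
  simp only [Cmd.exec_block_cons, Cmd.exec_block_nil, Cmd.exec_store, Cmd.exec_assign, Expr.adj,
    Expr.source, Expr.eval_add, Expr.eval_sub, Expr.eval_mul, Expr.eval_inp, Expr.eval_arr,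
    Expr.eval_var, Expr.eval_ofNat, Store.setVar_v, Store.setVar_a, Store.setArr_v, Store.setArr_a,
    reduceIte, Nat.reduceEqDiff, hx0, hx10, hx11, hx12, ← hx, hsource, and_true, and_self, true_and]
  refine ⟨fun v hv => ?_, ?_⟩
  · split_ifs with h
    · rw [hxK]
      exact iff_of_eq (congrArg (· ∈ K) (Fin.ext h.symm))
    · exact hP v (by omega)
  · have h1 : 0 < min (μ.v 13 + x * ind S ⟨i, hi⟩) E.cap ↔
        0 < μ.v 13 ∨ 0 < x * ind S ⟨i, hi⟩ := by omega
    rw [h1, hP', mul_pos_iff_nat, hxK, ind_pos_iff, or_assoc]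
    refine or_congr_right ⟨?_, ?_⟩
    · rintro (⟨v, hv, h2, h3⟩ | ⟨h2, h3⟩)
      exacts [⟨v, hv, by omega, h3⟩, ⟨_, h3, Nat.lt_succ_self _, h2⟩]
    · rintro ⟨v, hv, h2, h3⟩
      rcases Nat.lt_succ_iff_lt_or_eq.1 h2 with h2 | rfl
      exacts [.inl ⟨v, hv, h2, h3⟩, .inr ⟨h3, hv⟩]

lemma exec_relaxCmd {i : ℕ} (h6 : σ.v 6 = m) (h12 : σ.v 12 = i) (hm : m ≤ E.cap)
    (hτ : τ = relaxCmd.exec E σ) (i' a : ℕ) : τ.a 3 i' a =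
      if i' = i ∧ a < m then min (σ.a 3 i' a + σ.a 5 a 0) E.cap else σ.a 3 i' a := by
  subst hτ
  revert i' a
  refine Cmd.exec_loop (n := m) (P := fun k τ => ∀ i' a, τ.a 3 i' a =
      if i' = i ∧ a < k then min (σ.a 3 i' a + σ.a 5 a 0) E.cap else σ.a 3 i' a)
    (by simp [h6]; omega) (by simp) ?_
  intro k hk μ hv ha hP i' a
  have hx12 : μ.v 12 = i := (hv 12 rfl).trans h12
  have hx5 : μ.a 5 = σ.a 5 := ha 5 rfl
  simp only [Cmd.exec_store, Expr.eval_add, Expr.eval_arr, Expr.eval_var, Expr.eval_ofNat,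
    Store.setVar_v, Store.setVar_a, Store.setArr_a, reduceIte, Nat.reduceEqDiff, hx12, hx5, hP,
    true_and, lt_irrefl, and_false]
  by_cases h1 : i' = i
  · by_cases h2 : a = k
    · subst h1 h2
      simp
    · have h3 : a < k + 1 ↔ a < k := by omega
      simp [h1, h2, h3]
  · simp [h1]

lemma exec_blockMinCmd_frame : (blockMinCmd.exec E σ).v 6 = σ.v 6 ∧
    (blockMinCmd.exec E σ).v 12 = σ.v 12 ∧ (blockMinCmd.exec E σ).a 3 = σ.a 3 :=
  ⟨Cmd.exec_v rfl, Cmd.exec_v rfl, Cmd.exec_a rfl⟩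

/-- The costs that are stored in array `3`, where the row `n` belongs to no vertex. Only the first
`m` columns are in use; the costs beyond them count as infinite. -/
def storedCost (m B : ℕ) (σ : Store) (z : Option (Fin n)) (a : ℕ) : ℕ :=
  if a < m then σ.a 3 (z.elim n Fin.val) a else B

lemma elim_val_inj {z z' : Option (Fin n)} :
    z.elim n Fin.val = z'.elim n Fin.val ↔ z = z' := by
  rcases z with - | u <;> rcases z' with - | v
  · simp
  · have := v.isLt
    simp; omega
  · have := u.isLt
    simp; omega
  · simp [Fin.ext_iff]

/-- The stored costs of vertices are infinite unless the number of flips has the right parity. -/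
def ParityCost (S T : Set (Fin n)) (m : ℕ) (σ : Store) : Prop :=
  ∀ v : Fin n, ∀ a < m, σ.a 3 v a < m → Even (a + ind S v + ind T v)

lemma exec_eliminateCmd (hE : Encodes E G S T) (hG : IsBlockGraph G) (hS : G.IsIndepSet S)
    (hT : G.IsIndepSet T) {ord : Equiv.Perm (Fin n)}
    (ho : IsSearchOrder G fun v => (ord.symm v).val) (hm : m = 2 * n + 1) (h0 : σ.v 0 = n)
    (h6 : σ.v 6 = m) (hord : ∀ i : Fin n, σ.a 0 i 0 = ord i) (h9 : σ.v 9 = j) (hj : j < n)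
    (hpar : ParityCost S T m σ) (hτ : τ = eliminateCmd.exec E σ) :
    ParityCost S T m τ ∧ ∀ y < m,
      (HasRun G S T (remaining G (fun v => (ord.symm v).val) (j + 1))
        (storedCost m E.cap σ) y ↔
      HasRun G S T (remaining G (fun v => (ord.symm v).val) j)
        (storedCost m E.cap τ) y) := by
  classical
  subst hτ
  have hcap := hE.cap
  set pos : Fin n → ℕ := fun v => (ord.symm v).val with hpos
  set l : Fin n := ord ⟨j, hj⟩ with hl
  have hposl : pos l = j := by simp [hpos, hl]
  set σ₁ := σ.setVar 10 l with hσ₁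
  have hσ₁' : (Cmd.assign 10 (.arr 0 (.var 9) 0)).exec E σ = σ₁ := by
    have h1 := hord ⟨j, hj⟩
    have h2 := l.isLt
    simp only [← hl] at h1
    simp only [Cmd.exec_assign, Expr.eval_arr, Expr.eval_var, Expr.eval_ofNat, h9, h1, hσ₁]
    rw [min_eq_left (by omega)]
  set σ₂ := parentCmd.exec E σ₁ with hσ₂
  have hparent := exec_parentCmd (E := E) (σ := σ₁) (n := n) (j := j) (l := l)
    (q := fun i => ∃ h : i < n, G.Adj l (ord ⟨i, h⟩)) (by simp [hσ₁, h0]) (by simp [hσ₁, h9])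
    (by simp [hσ₁]) hj (by omega) (fun i hi => by
      have h1 := hord ⟨i, hi⟩
      have h2 := (ord ⟨i, hi⟩).isLt
      rw [← h1] at h2
      exact h2) (fun i hi => by
      have h1 := hord ⟨i, by omega⟩
      simp only [hσ₁, Store.setVar_a]
      dsimp only at h1
      rw [h1, hE.adj]
      exact ⟨fun h => ⟨by omega, h⟩, fun ⟨_, h⟩ => h⟩) hσ₂
  have h20 : σ₂.v 0 = n := (Cmd.exec_v rfl).trans (by simp [hσ₁, h0])
  have h26 : σ₂.v 6 = m := (Cmd.exec_v rfl).trans (by simp [hσ₁, h6])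
  have h210 : σ₂.v 10 = l := (Cmd.exec_v rfl).trans (by simp [hσ₁])
  have h23 : σ₂.a 3 = σ.a 3 := Cmd.exec_a rfl
  have hexec : eliminateCmd.exec E σ = if 0 < 2 - σ₂.v 11 then
      relaxCmd.exec E (blockMinCmd.exec E (memberCmd.exec E σ₂)) else σ₂ := by
    simp only [eliminateCmd, Cmd.exec_block_cons, Cmd.exec_block_nil, hσ₁', ← hσ₂, Cmd.exec_ite,
      Expr.eval_sub, Expr.eval_ofNat, Expr.eval_var, Cmd.exec_skip]
    rfl
  rw [hexec]
  by_cases htwo : 2 ≤ σ₂.v 11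
  · rw [if_neg (by omega)]
    have hcost : storedCost (n := n) m E.cap σ₂ = storedCost m E.cap σ := by
      unfold storedCost
      rw [h23]
    refine ⟨fun v a => by rw [h23]; exact hpar v a, fun y _ => ?_⟩
    rcases hparent with h | h | ⟨-, i, hi, k, hk, ⟨hi', hqi⟩, ⟨hk', hqk⟩⟩
    · omega
    · omega
    have := remaining_succ_of_two hG ho (l := l) (q := ord ⟨i, hi'⟩) (q' := ord ⟨k, hk'⟩)
      (fun h => by have := ord.injective h; simp at this; omega) (by simpa [hl, hpos] using hi)
      (by simpa [hl, hpos] using hk.trans hi) hqi hqk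
    change remaining G pos (pos l + 1) = remaining G pos (pos l) at this
    rw [hposl] at this
    rw [this, hcost]
  rw [if_pos (by omega)]
  -- The parent of the block.
  obtain ⟨p, hp, hpdef⟩ : ∃ p : Option (Fin n),
      ((σ₂.v 11 = 0 ∧ σ₂.v 12 = n ∧ p = none) ∨
        ∃ u : Fin n, σ₂.v 11 = 1 ∧ σ₂.v 12 = u ∧ p = some u) ∧
      ∀ u, p = some u ↔ pos u < pos l ∧ G.Adj l u := by
    rcases hparent with ⟨h1, h2, h3⟩ | ⟨h1, i, hi, h2, h3⟩ | h
    · refine ⟨none, .inl ⟨h1, h2, rfl⟩, fun u => ?_⟩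
      simp only [reduceCtorEq, false_iff, not_and, hposl]
      intro hu hadj
      exact h3 _ hu ⟨(ord.symm u).isLt, by simpa [hpos] using hadj⟩
    · refine ⟨some (ord ⟨i, by omega⟩), .inr ⟨_, h1, ?_, rfl⟩, fun u => ?_⟩
      · rw [h2, ← hord]
        rfl
      · rw [hposl]
        constructor
        · intro h
          rw [← Option.some.inj h]
          exact ⟨by simpa [hpos] using hi, ((h3 i hi).2 rfl).2⟩
        · rintro ⟨hu, hadj⟩
          have := (h3 _ hu).1 ⟨(ord.symm u).isLt, by simpa [hpos] using hadj⟩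
          rw [Option.some.injEq, ← ord.eq_symm_apply, Fin.ext_iff]
          exact this.symm
    · omega
  have h212 : σ₂.v 12 = p.elim n Fin.val := by
    rcases hp with ⟨-, h, rfl⟩ | ⟨u, -, h, rfl⟩ <;> exact h
  set K : Finset (Fin n) := Finset.univ.filter
    (fun w => w = l ∨ ∃ u, p = some u ∧ G.Adj w l ∧ G.Adj w u) with hKdef
  have hK : ∀ w, w ∈ K ↔ w = l ∨ ∃ u, p = some u ∧ G.Adj w l ∧ G.Adj w u := by simp [hKdef]
  set c := storedCost (n := n) m E.cap σ with hc
  set σ₃ := memberCmd.exec E σ₂ with hσ₃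
  have h3 : RootedBlockData E S K p c m σ₃ := exec_memberCmd hE h20 h210
    (hp.imp_left fun ⟨h1, _, h2⟩ => ⟨h1, h2⟩) hK
    (fun v a ha => by simp [hc, storedCost, ha, h23]) hσ₃
  have h36 : σ₃.v 6 = m := (Cmd.exec_v rfl).trans h26
  set σ₄ := blockMinCmd.exec E σ₃ with hσ₄
  have hmin := exec_blockMinCmd h3 h36 (by omega) (by omega) hσ₄
  obtain ⟨f6, f12, f3⟩ := exec_blockMinCmd_frame (E := E) (σ := σ₃)
  rw [← hσ₄] at f6 f12 f3
  have h312 : σ₃.v 12 = σ₂.v 12 := Cmd.exec_v rfl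
  have h33 : σ₃.a 3 = σ₂.a 3 := Cmd.exec_a rfl
  have h46 : σ₄.v 6 = m := f6.trans h36
  have h412 : σ₄.v 12 = p.elim n Fin.val := f12.trans (h312.trans h212)
  have h43 : σ₄.a 3 = σ.a 3 := f3.trans (h33.trans h23)
  have hrelax := exec_relaxCmd (E := E) h46 h412 (by omega) rfl
  rw [h43] at hrelax
  set τ := relaxCmd.exec E σ₄ with hτ
  refine ⟨fun v a ha h => hpar v a ha ?_, fun y hy => ?_⟩
  · rw [hrelax] at h
    split_ifs at h <;> omega
  have key := hasRun_remaining_iff hG ho hS hT (l := l) (p := p) hpdef hK (c := c)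
    (c' := storedCost m E.cap τ) (m := m) (fun v a h => ?_) (fun z hz => ?_)
    (fun a ha y hy => ?_) hy
  · change HasRun G S T (remaining G pos (pos l + 1)) c y ↔
      HasRun G S T (remaining G pos (pos l)) (storedCost m E.cap τ) y at key
    rwa [hposl] at key
  · simp only [hc, storedCost] at h
    split_ifs at h with ha
    · exact hpar v a ha h
    · omega
  · funext a
    simp only [hc, storedCost, hrelax, elim_val_inj, hz, false_and, if_false]
  · simp only [hc, storedCost, ha, if_true, hrelax, and_self]
    constructor
    · intro h
      exact ⟨σ₄.a 5 a 0, (hmin a ha).prop (by omega), by omega⟩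
    · rintro ⟨z, hz, h⟩
      have := (hmin a ha).min z hz
      omega

end Elimination


/-! ### The whole algorithm -/

section Algorithm

variable {n m : ℕ} {G : SimpleGraph (Fin n)} {S T : Set (Fin n)} {E : Env} {σ τ : Store}

/-- Sets up the costs of the vertices: `0` for numbers of flips of the right parity, and infinity
for the others. -/
def initCmd : Cmd :=
  .block [.assign 6 (2 * .var 0 + 1),
    .loop 14 (.var 0) (.block [
      .assign 7 (.source (.var 14) + .target (.var 14) - 2 * .source (.var 14) * .target (.var 14)),
      .loop 8 (.var 6) (.block [.store 3 (.var 14) (.var 8) (.cap * .var 7),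
        .assign 7 (1 - .var 7)])])]

/-- The algorithm. Variable `0` holds the number `n` of vertices, variable `6` the number `2 * n + 1`
of columns in use of the array `3` of costs, whose row `n` belongs to the virtual parent of the
blocks without a parent. Variable `1` becomes the length of a shortest reconfiguration sequence. -/
def mainCmd : Cmd :=
  .block [searchCmd, initCmd,
    .loop 2 (.var 0) (.block [.assign 9 (.var 0 - 1 - .var 2), eliminateCmd]),
    .assign 1 (.arr 3 (.var 0) 0)]

lemma exec_initCmd (hE : Encodes E G S T) (h0 : σ.v 0 = n) (hτ : τ = initCmd.exec E σ) :
    (∀ v : Fin n, ∀ a < 2 * n + 1,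
      τ.a 3 v a = if Even (a + ind S v + ind T v) then 0 else E.cap) ∧
      ∀ a, τ.a 3 n a = σ.a 3 n a := by
  have hcap := hE.cap
  subst hτ
  set σ₁ := σ.setVar 6 (2 * n + 1) with hσ₁
  have hexec : initCmd.exec E σ = (Cmd.loop 14 (.var 0) (.block [
      .assign 7 (.source (.var 14) + .target (.var 14) - 2 * .source (.var 14) * .target (.var 14)),
      .loop 8 (.var 6) (.block [.store 3 (.var 14) (.var 8) (.cap * .var 7),
        .assign 7 (1 - .var 7)])])).exec E σ₁ := by
    have h1 : min (2 * n + 1) E.cap = 2 * n + 1 := by omega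
    simp only [initCmd, Cmd.exec_block_cons, Cmd.exec_block_nil, Cmd.exec_assign, Expr.eval_add,
      Expr.eval_mul, Expr.eval_var, Expr.eval_ofNat, h0, h1, hσ₁]
  rw [hexec]
  suffices h : (∀ v : Fin n, v.val < n → ∀ a < 2 * n + 1, _ = _) ∧ _ from
    ⟨fun v => h.1 v v.isLt, h.2⟩
  refine Cmd.exec_loop (n := n) (P := fun i τ => (∀ v : Fin n, v.val < i → ∀ a < 2 * n + 1,
      τ.a 3 v a = if Even (a + ind S v + ind T v) then 0 else E.cap) ∧
      ∀ a, τ.a 3 n a = σ.a 3 n a) (by simp [hσ₁, h0]; omega) (by simp [hσ₁]) ?_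
  intro i hi μ hv ha ⟨hP, hP'⟩
  have hx0 : μ.v 0 = n := (hv 0 rfl).trans (by simp [hσ₁, h0])
  have hx6 : μ.v 6 = 2 * n + 1 := (hv 6 rfl).trans (by simp [hσ₁])
  have hs := hE.source ⟨i, hi⟩
  have ht := hE.target ⟨i, hi⟩
  have hs1 := ind_le_one S ⟨i, hi⟩
  have ht1 := ind_le_one T ⟨i, hi⟩
  dsimp only at hs ht
  set d := ind S ⟨i, hi⟩ + ind T ⟨i, hi⟩ with hd
  -- The parity of `d`.
  have hpar : min (ind S ⟨i, hi⟩ + ind T ⟨i, hi⟩ - 2 * ind S ⟨i, hi⟩ * ind T ⟨i, hi⟩) E.cap =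
      d % 2 := by
    generalize ind S ⟨i, hi⟩ = x at *
    generalize ind T ⟨i, hi⟩ = y at *
    interval_cases x <;> interval_cases y <;> omega
  set μ₁ := (μ.setVar 14 i).setVar 7 (d % 2) with hμ₁
  have hexec' : (Cmd.block [
      .assign 7 (.source (.var 14) + .target (.var 14) - 2 * .source (.var 14) * .target (.var 14)),
      .loop 8 (.var 6) (.block [.store 3 (.var 14) (.var 8) (.cap * .var 7),
        .assign 7 (1 - .var 7)])]).exec E (μ.setVar 14 i) =
      (Cmd.loop 8 (.var 6) (.block [.store 3 (.var 14) (.var 8) (.cap * .var 7),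
        .assign 7 (1 - .var 7)])).exec E μ₁ := by
    simp only [Cmd.exec_block_cons, Cmd.exec_block_nil, Cmd.exec_assign, Expr.source, Expr.target,
      Expr.eval_add, Expr.eval_sub, Expr.eval_mul, Expr.eval_var, Expr.eval_ofNat, Expr.eval_inp,
      Store.setVar_v, reduceIte, Nat.reduceEqDiff, hx0, hs, ht, hpar, hμ₁]
  rw [hexec']
  have key := Cmd.exec_loop (E := E) (σ := μ₁) (x := 8) (e := .var 6) (n := 2 * n + 1)
    (C := .block [.store 3 (.var 14) (.var 8) (.cap * .var 7), .assign 7 (1 - .var 7)])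
    (P := fun j τ => τ.v 7 = (j + d) % 2 ∧ (∀ a < j,
      τ.a 3 i a = if Even (a + d) then 0 else E.cap) ∧ ∀ i' ≠ i, τ.a 3 i' = μ.a 3 i')
    (by simp [hμ₁, hx6]; omega) (by simp [hμ₁]) ?_
  · obtain ⟨-, h1, h2⟩ := key
    refine ⟨fun v hv a ha => ?_, fun a => ?_⟩
    · by_cases hvi : v.val = i
      · have hv' : v = ⟨i, hi⟩ := Fin.ext hvi
        rw [hv', add_assoc]
        exact h1 a ha
      · rw [h2 v hvi]
        exact hP v (by omega) a ha
    · rw [h2 n (by omega)]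
      exact hP' a
  intro j hj ν hvν haν ⟨h7, h3, hrest⟩
  have h14 : ν.v 14 = i := (hvν 14 rfl).trans (by simp [hμ₁])
  have hval : min (E.cap * ((j + d) % 2)) E.cap = if Even (j + d) then 0 else E.cap := by
    rcases Nat.mod_two_eq_zero_or_one (j + d) with h | h <;> simp [Nat.even_iff, h]
  simp only [Cmd.exec_block_cons, Cmd.exec_block_nil, Cmd.exec_assign, Cmd.exec_store,
    Expr.eval_sub, Expr.eval_mul, Expr.eval_var, Expr.eval_ofNat, Expr.eval_cap, Store.setVar_v,
    Store.setVar_a, Store.setArr_v, Store.setArr_a, reduceIte, Nat.reduceEqDiff, h7, h14, hval,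
    true_and]
  refine ⟨by omega, fun a ha => ?_, fun i' hi' => ?_⟩
  · by_cases h1 : a = j
    · rw [if_pos h1, h1]
    · rw [if_neg h1, h3 a (by omega)]
  · funext a
    simp only [Store.setArr_a, hi', false_and, and_false, if_false]
    exact congrFun (hrest i' hi') a

lemma exists_isSearchOrder {ord : ℕ → ℕ} {adj : ℕ → ℕ → Prop}
    (hadj : ∀ u v : Fin n, adj u v ↔ G.Adj u v) (hlt : ∀ i < n, ord i < n)
    (hinj : ∀ i < n, ∀ j < n, ord i = ord j → i = j)
    (hsearch : ∀ i < n, (∃ j < i, adj (ord j) (ord i)) ∨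
      ∀ j < i, ∀ u < n, adj (ord j) u → ∃ k < i, ord k = u) :
    ∃ e : Equiv.Perm (Fin n), (∀ i : Fin n, ord i = e i) ∧
      IsSearchOrder G fun v => (e.symm v).val := by
  have hf : Function.Injective fun i : Fin n => (⟨ord i, hlt i i.isLt⟩ : Fin n) := fun i j h =>
    Fin.ext (hinj i i.isLt j j.isLt (Fin.ext_iff.1 h))
  set e := Equiv.ofBijective _ (Finite.injective_iff_bijective.1 hf) with he
  have hord : ∀ i : Fin n, ord i = e i := fun i => rfl
  refine ⟨e, hord, fun u v h => e.symm.injective (Fin.ext h), fun w => ?_⟩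
  have hw : ord (e.symm w) = w := by rw [hord, e.apply_symm_apply]
  rcases hsearch (e.symm w) (e.symm w).isLt with ⟨j, hj, h⟩ | h
  · left
    have hjn : j < n := hj.trans (e.symm w).isLt
    refine ⟨e ⟨j, hjn⟩, by simpa using hj, ?_⟩
    rw [← hadj, ← hord, ← hw]
    exact h
  · right
    intro u v hu huv
    obtain ⟨k, hk, hkv⟩ := h (e.symm u) hu v v.isLt (by
      rw [hord, e.apply_symm_apply]
      exact (hadj u v).2 huv)
    have hkn : k < n := hk.trans (e.symm w).isLt
    have : v = e ⟨k, hkn⟩ := Fin.ext (by rw [← hord]; exact hkv.symm)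
    rw [this, e.symm_apply_apply]
    exact hk

lemma exec_mainCmd (hE : Encodes E G S T) (hG : IsBlockGraph G) (hS : G.IsIndepSet S)
    (hT : G.IsIndepSet T) (h0 : σ.v 0 = n) (ha : ∀ q i j, σ.a q i j = 0)
    (hτ : τ = mainCmd.exec E σ) (k : ℕ) : YesInstance G S T k ↔ τ.v 1 ≤ k := by
  subst hτ
  have hcap := hE.cap
  set σ₁ := searchCmd.exec E σ with hσ₁
  obtain ⟨hlt, hinj, hsearch⟩ := exec_searchCmd h0 (by omega) (ha 1 · 0) (ha 2 · 0) hσ₁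
  obtain ⟨ord, hord, ho⟩ := exists_isSearchOrder (adj := fun u v => 0 < E.inp (u * n + v)) hE.adj
    hlt hinj hsearch
  have h10 : σ₁.v 0 = n := (Cmd.exec_v rfl).trans h0
  have h13 : σ₁.a 3 = σ.a 3 := Cmd.exec_a rfl
  set σ₂ := initCmd.exec E σ₁ with hσ₂
  obtain ⟨hcost, hnone⟩ := exec_initCmd hE h10 hσ₂
  have h20 : σ₂.v 0 = n := (Cmd.exec_v rfl).trans h10
  have h26 : σ₂.v 6 = 2 * n + 1 := by
    have h1 : min (2 * n + 1) E.cap = 2 * n + 1 := by omega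
    rw [hσ₂, initCmd, Cmd.exec_block_cons, Cmd.exec_block_cons, Cmd.exec_block_nil,
      Cmd.exec_v rfl]
    simp [h10, h1]
  have h2ord : ∀ i : Fin n, σ₂.a 0 i 0 = ord i := by
    rw [show σ₂.a 0 = σ₁.a 0 from Cmd.exec_a rfl]
    exact hord
  set pos : Fin n → ℕ := fun v => (ord.symm v).val with hpos
  set σ₃ := (Cmd.loop 2 (.var 0) (.block [.assign 9 (.var 0 - 1 - .var 2), eliminateCmd])).exec E σ₂
    with hσ₃
  have hmain : ParityCost S T (2 * n + 1) σ₃ ∧ ∀ y < 2 * n + 1, (YesInstance G S T y ↔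
      HasRun G S T (remaining G pos (n - n)) (storedCost (2 * n + 1) E.cap σ₃) y) := by
    refine Cmd.exec_loop (n := n) (P := fun i σ => ParityCost S T (2 * n + 1) σ ∧
      ∀ y < 2 * n + 1, (YesInstance G S T y ↔
      HasRun G S T (remaining G pos (n - i)) (storedCost (2 * n + 1) E.cap σ) y))
      (by simp [h20]; omega) ⟨fun v a ha h => ?_, fun y hy => ?_⟩ ?_
    · rw [hcost v a ha] at h
      split_ifs at h with heven
      · exact heven
      · omega
    · have huniv : remaining G pos (n - 0) = Set.univ :=
        Set.eq_univ_of_forall fun v => .inl (ord.symm v).isLt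
      rw [huniv]
      refine (hasRun_univ_iff hS ?_ (fun v a ha heven => ?_) hy).symm
      · simp only [storedCost, Option.elim_none, hnone, h13, ha, ite_true, Nat.succ_pos]
      · simp only [storedCost, Option.elim_some, ha, if_true, hcost v a ha, heven]
    intro i hi ρ hv ha ⟨hpar, hrun⟩
    have h0' : ρ.v 0 = n := (hv 0 rfl).trans h20
    have h6' : ρ.v 6 = 2 * n + 1 := (hv 6 rfl).trans h26
    have hord' : ∀ i : Fin n, ρ.a 0 i 0 = ord i := by
      rw [show ρ.a 0 = σ₂.a 0 from ha 0 rfl]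
      exact h2ord
    have h9 : min (n - 1 - i) E.cap = n - 1 - i := by omega
    set ρ₁ := (ρ.setVar 2 i).setVar 9 (n - 1 - i) with hρ₁
    have hexec : (Cmd.block [.assign 9 (.var 0 - 1 - .var 2), eliminateCmd]).exec E
        (ρ.setVar 2 i) = eliminateCmd.exec E ρ₁ := by
      simp only [Cmd.exec_block_cons, Cmd.exec_block_nil, Cmd.exec_assign, Expr.eval_sub,
        Expr.eval_var, Expr.eval_ofNat, Store.setVar_v, reduceIte, Nat.reduceEqDiff, h0', h9, hρ₁]
    rw [hexec]
    obtain ⟨hpar', hrun'⟩ := exec_eliminateCmd (σ := ρ₁) (j := n - 1 - i) hE hG hS hT ho rfl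
      (by simp [hρ₁, h0']) (by simp [hρ₁, h6']) hord' (by simp [hρ₁]) (by omega) hpar rfl
    refine ⟨hpar', fun y hy => (hrun y hy).trans ?_⟩
    have h1 : n - i = n - 1 - i + 1 := by omega
    have h2 : n - (i + 1) = n - 1 - i := by omega
    rw [h1, h2]
    exact hrun' y hy
  have hempty : remaining G pos (n - n) = ∅ := by
    ext v
    simp [remaining]
  have hyes : ∀ y < 2 * n + 1, (YesInstance G S T y ↔ σ₃.a 3 n 0 ≤ y) := by
    intro y hy
    rw [hmain.2 y hy, hempty, hasRun_empty_iff]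
    simp [storedCost]
  have h30 : σ₃.v 0 = n := (Cmd.exec_v rfl).trans h20
  have hres : (mainCmd.exec E σ).v 1 = min (σ₃.a 3 n 0) E.cap := by
    simp only [mainCmd, Cmd.exec_block_cons, Cmd.exec_block_nil, ← hσ₁, ← hσ₂, ← hσ₃,
      Cmd.exec_assign, Expr.eval_arr, Expr.eval_var, Expr.eval_ofNat, h30, Store.setVar_v, if_true]
  have htwo := yesInstance_two_mul_card hS hT
  rw [Fintype.card_fin] at htwo
  have hle := (hyes (2 * n) (by omega)).1 htwo
  rw [hres]
  by_cases hk : k < 2 * n + 1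
  · rw [hyes k hk]
    omega
  · obtain ⟨l, hl, h⟩ := htwo
    exact ⟨fun _ => by omega, fun _ => ⟨l, by omega, h⟩⟩

end Algorithm


/-! ### The program of the random access machine -/

section Machine

variable {n k : ℕ} {G : SimpleGraph (Fin n)} {S T : Set (Fin n)}

/-- The environment of an instance. The cap `4 * n + 4` is the value that stands for infinity. -/
noncomputable def instanceEnv (G : SimpleGraph (Fin n)) (S T : Set (Fin n)) (k : ℕ) : Env where
  cap := 4 * n + 4
  inp := (input G S T k).mem

/-- The store at the beginning. -/
def initialStore (n : ℕ) : Store where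
  v x := if x = 0 then n else 0
  a _ _ _ := 0

lemma mul_add_lt_sq (u v : Fin n) : u.val * n + v.val < n * n :=
  calc u.val * n + v.val < u.val * n + n := Nat.add_lt_add_left v.isLt _
    _ = (u.val + 1) * n := by ring
    _ ≤ n * n := Nat.mul_le_mul_right _ u.isLt

lemma mul_add_inj {u v u' v' : Fin n} (h : u.val * n + v.val = u'.val * n + v'.val) :
    u = u' ∧ v = v' := by
  have hn : 0 < n := u.pos
  have h1 : u.val = u'.val := by
    have := congrArg (· / n) h
    simpa [Nat.add_comm (_ * n), Nat.add_mul_div_right _ _ hn, Nat.div_eq_of_lt] using this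
  rw [h1] at h
  exact ⟨Fin.ext h1, Fin.ext (by omega)⟩

lemma input_mem_eq_zero {x : ℕ} (hx : n * n + 2 * n ≤ x) : (input G S T k).mem x = 0 := by
  refine if_neg ?_
  rintro (⟨u, v, -, rfl⟩ | ⟨u, -, rfl⟩ | ⟨u, -, rfl⟩)
  · have := mul_add_lt_sq u v
    omega
  · omega
  · omega

lemma input_mem_le_one (x : ℕ) : (input G S T k).mem x ≤ 1 := by
  simp only [input]
  split_ifs <;> omega

lemma encodes_instanceEnv : Encodes (instanceEnv G S T k) G S T where
  cap := rfl
  adj u v := by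
    have huv := mul_add_lt_sq u v
    simp only [instanceEnv, input]
    split_ifs with h
    · refine iff_of_true one_pos ?_
      rcases h with ⟨u', v', h, he⟩ | ⟨i, -, h⟩ | ⟨i, -, h⟩
      · obtain ⟨rfl, rfl⟩ := mul_add_inj he
        exact h
      · omega
      · omega
    · exact iff_of_false (lt_irrefl 0) fun hadj => h (.inl ⟨u, v, hadj, rfl⟩)
  source v := by
    simp only [instanceEnv, input]
    by_cases hv : v ∈ S
    · rw [ind_of_mem hv]
      exact if_pos (.inr (.inl ⟨v, hv, rfl⟩))
    · rw [ind_of_notMem hv]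
      refine if_neg ?_
      rintro (⟨u, w, -, h⟩ | ⟨i, hi, h⟩ | ⟨i, -, h⟩)
      · have := mul_add_lt_sq u w
        omega
      · exact hv (by rwa [show v = i from Fin.ext (by omega)])
      · omega
  target v := by
    simp only [instanceEnv, input]
    by_cases hv : v ∈ T
    · rw [ind_of_mem hv]
      exact if_pos (.inr (.inr ⟨v, hv, rfl⟩))
    · rw [ind_of_notMem hv]
      refine if_neg ?_
      rintro (⟨u, w, -, h⟩ | ⟨i, -, h⟩ | ⟨i, hi, h⟩)
      · have := mul_add_lt_sq u w
        omega
      · omega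
      · exact hv (by rwa [show v = i from Fin.ext (by omega)])

/-- Writes the cap `4 * n + 4` to register `3` and the end `n * n + 2 * n` of the input to
register `5`. -/
def prologue : List Instr :=
  [.const 7 4, .mul 3 0 7, .add 3 3 7, .mul 5 0 0, .add 5 5 0, .add 5 5 0]

/-- Compares the result, in register `2`, to the bound `k`, in register `1`. -/
def epilogue : List Instr := [.sub 7 2 1, .const 9 1, .sub 0 9 7]

/-- The program. -/
def symISRProgram : Program :=
  .seq (.ofList prologue) (.seq (mainCmd.compile 3) (.ofList epilogue))

lemma four_mul_add_lt_pow : 4 * n + 4 < (n + k + 2) ^ 3 :=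
  calc 4 * n + 4 < (n + 2) ^ 3 := by nlinarith [sq_nonneg n]
    _ ≤ (n + k + 2) ^ 3 := Nat.pow_le_pow_left (by omega) 3

lemma sq_add_lt_pow : n * n + 2 * n < (n + k + 2) ^ 3 :=
  calc n * n + 2 * n < (n + 2) ^ 2 := by nlinarith
    _ ≤ (n + k + 2) ^ 2 := Nat.pow_le_pow_left (by omega) 2
    _ ≤ (n + k + 2) ^ 3 := Nat.pow_le_pow_right (by omega) (by omega)

lemma fits_instanceEnv : Fits (instanceEnv G S T k) (n * n + 2 * n) (n + k + 2) where
  two_le := by omega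
  cap_lt := four_mul_add_lt_pow
  base_lt := sq_add_lt_pow
  inp _ hx := input_mem_eq_zero (k := k) hx

lemma rep_prologue :
    Rep (instanceEnv G S T k) (n * n + 2 * n) (initialStore n)
      (runList prologue (input G S T k)) where
  var x := by
    have h3 : 2 * x ≠ 3 := by omega
    have h5 : 2 * x ≠ 5 := by omega
    have h7 : 2 * x ≠ 7 := by omega
    have h1 : 2 * x ≠ 1 := by omega
    simp [prologue, runList, Instr.apply, Instr.value, input, initialStore, h1, h3, h5, h7]
  cap := by
    simp [prologue, runList, Instr.apply, Instr.value, input, instanceEnv]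
    ring
  base_eq := by
    simp [prologue, runList, Instr.apply, Instr.value, input]
    ring
  inp_eq _ _ := rfl
  arr q i j := input_mem_eq_zero (k := k) (Nat.le_add_right _ _)
  var_le x := by
    simp only [initialStore, instanceEnv]
    split_ifs <;> omega
  mem_le x := (input_mem_le_one (k := k) x).trans (by simp [instanceEnv])

lemma safe_prologue {W : ℕ} (hW : (n + k + 2) ^ 3 ≤ W) :
    Safe W prologue (input G S T k) := by
  have h1 := four_mul_add_lt_pow (n := n) (k := k)
  have h2 := sq_add_lt_pow (n := n) (k := k)
  simp [prologue, Safe, Instr.apply, Instr.value, input]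
  refine ⟨?_, ?_, ?_, ?_, ?_, ?_⟩ <;> omega

lemma symISRProgram_spec (hG : IsBlockGraph G) (hS : G.IsIndepSet S) (hT : G.IsIndepSet T) :
    ∃ t s, t ≤ mainCmd.cost (4 * n + 4) + 11 ∧
      Exec ((n + k + 2) ^ (mainCmd.size + 3)) symISRProgram (input G S T k) t s ∧
      (YesInstance G S T k ∧ s.reg 0 = 1 ∨ ¬ YesInstance G S T k ∧ s.reg 0 = 0) := by
  set W := (n + k + 2) ^ (mainCmd.size + 3) with hWdef
  have hX : ∀ d ≤ mainCmd.size + 3, (n + k + 2) ^ d ≤ W := fun d hd =>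
    Nat.pow_le_pow_right (by omega) hd
  have hW3 := hX 3 (by omega)
  obtain ⟨t, s, hexec, ht, hrep, hframe⟩ := Cmd.compiledCorrectly
    (fits_instanceEnv (G := G) (S := S) (T := T) (k := k)) mainCmd (hX _ (by omega)) 3 _ _ le_rfl
    rep_prologue
  have hmain := exec_mainCmd (encodes_instanceEnv (G := G) (S := S) (T := T) (k := k)) hG hS hT
    (σ := initialStore n) rfl (fun _ _ _ => rfl) rfl k
  have h1 : s.reg 1 = k := by
    rw [show s.reg 1 = _ from hframe 0 (by omega)]
    simp [tmp, prologue, runList, Instr.apply, Instr.value, input]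
  have h2 : s.reg 2 = (mainCmd.exec (instanceEnv G S T k) (initialStore n)).v 1 := hrep.var 1
  have hle : s.reg 2 ≤ 4 * n + 4 := by
    rw [h2]
    exact hrep.var_le 1
  have hlt := four_mul_add_lt_pow (n := n) (k := k)
  have hsafe : Safe W epilogue s := by
    simp [epilogue, Safe, Instr.apply, Instr.value]
    omega
  have h0 : (runList epilogue s).reg 0 = 1 - (s.reg 2 - s.reg 1) := by
    simp [epilogue, runList, Instr.apply, Instr.value]
  refine ⟨_, _, ?_, .seq (exec_ofList (safe_prologue hW3)) (.seq hexec (exec_ofList hsafe)), ?_⟩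
  · have h3 : prologue.length = 6 := rfl
    have h4 : epilogue.length = 3 := rfl
    have h5 : (instanceEnv G S T k).cap = 4 * n + 4 := rfl
    rw [h5] at ht
    omega
  · rw [hmain, h0, ← h2]
    omega

/-- The five nested loops of the algorithm run over the blocks, the lengths of runs in the block,
the vertices, the total occupations, and the occupations of one vertex. -/
lemma depth_mainCmd : mainCmd.depth = 5 := rfl

lemma isBigO_cost :
    (fun n : ℕ => ((mainCmd.cost (4 * n + 4) + 11 : ℕ) : ℝ)) =O[Filter.atTop]
      fun n : ℕ => (n : ℝ) ^ 5 := by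
  obtain ⟨κ, hκ⟩ := mainCmd.exists_cost_le
  rw [depth_mainCmd] at hκ
  refine Asymptotics.IsBigO.of_bound (κ * 9 ^ 5 + 11 : ℕ) ?_
  filter_upwards [Filter.eventually_ge_atTop 1] with n hn
  have h1 : mainCmd.cost (4 * n + 4) + 11 ≤ (κ * 9 ^ 5 + 11) * n ^ 5 :=
    calc mainCmd.cost (4 * n + 4) + 11 ≤ κ * (9 * n) ^ 5 + 11 * n ^ 5 :=
          Nat.add_le_add ((hκ _).trans (Nat.mul_le_mul_left _ (Nat.pow_le_pow_left (by omega) 5)))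
            (Nat.le_mul_of_pos_right _ (by positivity))
      _ = (κ * 9 ^ 5 + 11) * n ^ 5 := by ring
  rw [Real.norm_of_nonneg (by positivity), Real.norm_of_nonneg (by positivity)]
  exact_mod_cast h1

end Machine

end SymISR


theorem mainTheorem8 :
    ∃ (P : SymISR.Program) (c : ℕ) (τ : ℕ → ℕ),
      ((fun n : ℕ => (τ n : ℝ)) =O[Filter.atTop] fun n : ℕ => (n : ℝ) ^ 5) ∧
      SymISR.SolvesInTime (fun _ G => SymISR.IsBlockGraph G) P c τ := by
  refine ⟨SymISR.symISRProgram, SymISR.mainCmd.size + 3,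
    fun n => SymISR.mainCmd.cost (4 * n + 4) + 11, SymISR.isBigO_cost, ?_⟩
  intro n G S T k hG hS hT
  obtain ⟨t, s, ht, hexec, h⟩ := SymISR.symISRProgram_spec (k := k) hG hS hT
  refine ⟨t, s, ht, hexec, ?_⟩
  rcases h with ⟨hyes, h⟩ | ⟨hno, h⟩
  · rw [if_pos hyes, h]
  · rw [if_neg hno, h]
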